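/- Let $n\ge 2$ and let $\Omega\subset\mathbb R^n$ be a bounded open connected set with conical points $p_1,\dots,p_l\in\partial\Omega$ ($l\ge 0$) and without cracks. That is: - $\Omega_0:=\partial\Omega\setminus\{p_1,\dots,p_l\}$ is a smooth embedded hypersurface of $\mathbb R^n$; - for each $i$ there are an open neighbourhood $V_i$ of $p_i$, a (possibly disconnected) open set $\omega_i\subsetneq S^{n-1}$ whose boundary $\partial\omega_i$ in $S^{n-1}$ is a smooth embedded hypersurface of $S^{n-1}$, and a diffeomorphism $\phi_i$ of $V_i$ onto the open unit ball $B^n$ with $\phi_i(p_i)=0$ and $\phi_i(\Omega\cap V_i)=\{r x' : 0<r<1,\ x'\in\omega_i\}$, and $\overline{V_i}\cap\overline{V_j}=\emptyset$ for $i\ne j$; - $\partial\Omega=\partial\overline\Omega$. A groupoid $\mathcal G\rightrightarrows M$ with domain map $d$ and range map $r$ is a *Lie groupoid* if $\mathcal G$ and $M$ are second countable smooth manifolds, possibly with corners, $M$ is Hausdorff, all structural maps are smooth, and $d$ is a tame submersion (its differentials are surjective, and $dd(v)$ is inward pointing if and only if $v$ is). For $A\subset M$ let $\mathcal G|_A$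 be the set of arrows with domain and range in $A$. Let $\mathcal H=[0,\infty)\rtimes(0,\infty)$ be the action groupoid of the action of the multiplicative group $(0,\infty)$ on $[0,\infty)$ by dilations, and let $$\mathcal J_i=\bigl(\mathcal H\times(\partial\omega_i\times\partial\omega_i)\bigr)\big|_{[0,1)\times\partial\omega_i}\rightrightarrows[0,1)\times\partial\omega_i ,$$ where $\partial\omega_i\times\partial\omega_i$ is the pair groupoid. The map $\varphi_i(t,y)=\phi_i^{-1}(ty)$ is a diffeomorphism of $(0,1)\times\partial\omega_i$ onto $V_i\cap\Omega_0$. Let $$M=\Bigl(\bigsqcup_{i=1}^l[0,1)\times\partial\omega_i\Bigr)\cup_{\varphi}\Omega_0$$ be the manifold with boundary obtained by gluing along the $\varphi_i$. The *layer potentials groupoid* of $\Omega$ is the groupoid over $M$ $$\mathcal G=\Bigl(\bigsqcup_{i=1}^l\mathcal J_i\Bigr)\cup_\varphi(\Omega_0\times\Omega_0)\rightrightarrows M$$ obtained by gluing the $\mathcal J_i$ with the pair groupoid of $\Omega_0$ along the isomorphisms $\mathcal J_i|_{(0,1)\times\partial\omega_i}\simeq(\Omega_0\times\Omega_0)|_{V_i\cap\Omega_0}$,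 $g\mapsto(\varphi_i(r(g)),\varphi_i(d(g)))$. **Theorem.** $\mathcal G$ is a boundary action groupoid. That is, $\mathcal G\rightrightarrows M$ is a Lie groupoid and 1. there is an open dense $\mathcal G$-invariant subset $U\subset M$ such that $\mathcal G|_U$ is isomorphic to the pair groupoid $U\times U$ as a Lie groupoid; 2. there is an open cover $(U_j)_{j\in J}$ of $M$ such that, for each $j$, there are a Hausdorff manifold (possibly with corners) $X_j$, a Lie group $G_j$ acting smoothly on $X_j$ from the right, an open subset $U_j'\subset X_j$, and an isomorphism of Lie groupoids $\mathcal G|_{U_j}\simeq(X_j\rtimes G_j)|_{U_j'}$ covering a diffeomorphism $U_j\simeq U_j'$; 3. (weak gluing condition) for the same cover, any two composable arrows of $\mathcal G$ lie together in $\mathcal G|_{U_j}$ for some $j$. -/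

import Mathlib

open Set Topology Metric
open scoped Manifold ContDiff NNReal

set_option linter.unusedVariables false
set_option linter.unusedSectionVars false

noncomputable section

/-! ### Groupoids, given by their five structural maps -/

/-- A groupoid with set of objects (units) `Obj` and set of arrows `Arr`, described by the domain
`d`, the range `r`, the units `u`, the inverse `inv` and the product `mul g h`, which is defined
when `d g = r h`. -/
structure GroupoidOn (Arr Obj : Type*) where
  d : Arr → Obj
  r : Arr → Obj
  u : Obj → Arr
  inv : Arr → Arr
  mul : ∀ g h : Arr, d g = r h → Arr
  d_u : ∀ x, d (u x) = x
  r_u : ∀ x, r (u x) = x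
  d_inv : ∀ g, d (inv g) = r g
  r_inv : ∀ g, r (inv g) = d g
  d_mul : ∀ g h hgh, d (mul g h hgh) = d h
  r_mul : ∀ g h hgh, r (mul g h hgh) = r g
  mul_assoc : ∀ (g h k : Arr) (hgh : d g = r h) (hhk : d h = r k),
    mul (mul g h hgh) k ((d_mul g h hgh).trans hhk) =
      mul g (mul h k hhk) (hgh.trans (r_mul h k hhk).symm)
  u_mul : ∀ g, mul (u (r g)) g (d_u (r g)) = g
  mul_u : ∀ g, mul g (u (d g)) (r_u (d g)).symm = g
  inv_mul : ∀ g, mul (inv g) g (d_inv g) = u (d g)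
  mul_inv : ∀ g, mul g (inv g) (r_inv g).symm = u (r g)

namespace GroupoidOn

/-- The arrows of the reduction `𝒢|_A`: those with domain and range in `A`. -/
def arrowsOver {Arr Obj : Type*} (𝒢 : GroupoidOn Arr Obj) (A : Set Obj) : Set Arr :=
  {g | 𝒢.r g ∈ A ∧ 𝒢.d g ∈ A}

/-- The reduction `𝒢|_A` of a groupoid to a set `A` of units. -/
def reduction {Arr Obj : Type*} (𝒢 : GroupoidOn Arr Obj) (A : Set Obj) :
    GroupoidOn (𝒢.arrowsOver A) A where
  d g := ⟨𝒢.d g.1, g.2.2⟩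
  r g := ⟨𝒢.r g.1, g.2.1⟩
  u x := ⟨𝒢.u x.1, by rw [𝒢.r_u]; exact x.2, by rw [𝒢.d_u]; exact x.2⟩
  inv g := ⟨𝒢.inv g.1, by rw [𝒢.r_inv]; exact g.2.2, by rw [𝒢.d_inv]; exact g.2.1⟩
  mul g h hgh := ⟨𝒢.mul g.1 h.1 (congrArg Subtype.val hgh),
    by rw [𝒢.r_mul]; exact g.2.1, by rw [𝒢.d_mul]; exact h.2.2⟩
  d_u x := Subtype.ext (𝒢.d_u _)
  r_u x := Subtype.ext (𝒢.r_u _)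
  d_inv g := Subtype.ext (𝒢.d_inv _)
  r_inv g := Subtype.ext (𝒢.r_inv _)
  d_mul g h _ := Subtype.ext (𝒢.d_mul _ _ _)
  r_mul g h _ := Subtype.ext (𝒢.r_mul _ _ _)
  mul_assoc g h k _ _ := Subtype.ext (𝒢.mul_assoc _ _ _ _ _)
  u_mul g := Subtype.ext (𝒢.u_mul _)
  mul_u g := Subtype.ext (𝒢.mul_u _)
  inv_mul g := Subtype.ext (𝒢.inv_mul _)
  mul_inv g := Subtype.ext (𝒢.mul_inv _)

/-- The product of two groupoids. -/
def prod {Arr Obj Arr' Obj' : Type*} (𝒢 : GroupoidOn Arr Obj) (ℋ : GroupoidOn Arr' Obj') :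
    GroupoidOn (Arr × Arr') (Obj × Obj') where
  d g := (𝒢.d g.1, ℋ.d g.2)
  r g := (𝒢.r g.1, ℋ.r g.2)
  u x := (𝒢.u x.1, ℋ.u x.2)
  inv g := (𝒢.inv g.1, ℋ.inv g.2)
  mul g h hgh := (𝒢.mul g.1 h.1 (congrArg Prod.fst hgh), ℋ.mul g.2 h.2 (congrArg Prod.snd hgh))
  d_u x := Prod.ext (𝒢.d_u _) (ℋ.d_u _)
  r_u x := Prod.ext (𝒢.r_u _) (ℋ.r_u _)
  d_inv g := Prod.ext (𝒢.d_inv _) (ℋ.d_inv _)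
  r_inv g := Prod.ext (𝒢.r_inv _) (ℋ.r_inv _)
  d_mul g h _ := Prod.ext (𝒢.d_mul _ _ _) (ℋ.d_mul _ _ _)
  r_mul g h _ := Prod.ext (𝒢.r_mul _ _ _) (ℋ.r_mul _ _ _)
  mul_assoc g h k _ _ := Prod.ext (𝒢.mul_assoc _ _ _ _ _) (ℋ.mul_assoc _ _ _ _ _)
  u_mul g := Prod.ext (𝒢.u_mul _) (ℋ.u_mul _)
  mul_u g := Prod.ext (𝒢.mul_u _) (ℋ.mul_u _)
  inv_mul g := Prod.ext (𝒢.inv_mul _) (ℋ.inv_mul _)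
  mul_inv g := Prod.ext (𝒢.mul_inv _) (ℋ.mul_inv _)

/-- The pair groupoid `M × M`, with `d (x, y) = y`, `r (x, y) = x` and
`(x, y) (y, z) = (x, z)`. -/
def pair (M : Type*) : GroupoidOn (M × M) M where
  d g := g.2
  r g := g.1
  u x := (x, x)
  inv g := (g.2, g.1)
  mul g h _ := (g.1, h.2)
  d_u _ := rfl
  r_u _ := rfl
  d_inv _ := rfl
  r_inv _ := rfl
  d_mul _ _ _ := rfl
  r_mul _ _ _ := rfl
  mul_assoc _ _ _ _ _ := rfl
  u_mul _ := rfl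
  mul_u _ := rfl
  inv_mul _ := rfl
  mul_inv _ := rfl

/-- The action groupoid `X ⋊ G` of a right action of `G` on `X`, with `r (x, g) = x`,
`d (x, g) = x · g⁻¹` and `(x, h) (x · h⁻¹, g) = (x, g h)`. -/
def action (X G : Type*) [Group G] [MulAction Gᵐᵒᵖ X] : GroupoidOn (X × G) X where
  d q := MulOpposite.op q.2⁻¹ • q.1
  r q := q.1
  u x := (x, 1)
  inv q := (MulOpposite.op q.2⁻¹ • q.1, q.2⁻¹)
  mul p q _ := (p.1, q.2 * p.2)
  d_u x := by simp
  r_u _ := rfl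
  d_inv q := by simp
  r_inv _ := rfl
  d_mul p q h := by
    have h' : q.1 = MulOpposite.op p.2⁻¹ • p.1 := h.symm
    simp [h', mul_smul]
  r_mul _ _ _ := rfl
  mul_assoc p q s _ _ := by simp [_root_.mul_assoc]
  u_mul q := by simp
  mul_u q := by simp
  inv_mul q := by simp
  mul_inv q := by simp

end GroupoidOn

/-! ### Manifolds with corners and Lie groupoids -/

/-- The model `I` identifies `H` with a model corner `[0, ∞)^s × ℝ^(k - s)` in suitable linear
coordinates of a `k`-dimensional space, so that `C^∞` manifolds modelled on `I` are manifolds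
with corners (of dimension `k`). -/
def IsCornerModel {E H : Type*} [NormedAddCommGroup E] [NormedSpace ℝ E] [TopologicalSpace H]
    (I : ModelWithCorners ℝ E H) : Prop :=
  ∃ (k : ℕ) (b : Module.Basis (Fin k) ℝ E) (s : Set (Fin k)),
    range I = {v | ∀ i ∈ s, 0 ≤ b.repr v i}

/-- The tangent vector `v` at `p` is inward pointing: in the chart at `p`, small positive
displacements in the direction `v` stay in the model corner. -/
def InwardPointing {E H M : Type*} [NormedAddCommGroup E] [NormedSpace ℝ E] [TopologicalSpace H]
    (I : ModelWithCorners ℝ E H) [TopologicalSpace M] [ChartedSpace H M]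
    (p : M) (v : TangentSpace I p) : Prop :=
  ∃ ε : ℝ, 0 < ε ∧ ∀ t ∈ Icc 0 ε, extChartAt I p p + t • (show E from v) ∈ range I

/-- A tame submersion: a smooth map with surjective differentials, such that `df(v)` is inward
pointing if and only if `v` is. -/
structure IsTameSubmersion {E H M E' H' M' : Type*}
    [NormedAddCommGroup E] [NormedSpace ℝ E] [TopologicalSpace H]
    [NormedAddCommGroup E'] [NormedSpace ℝ E'] [TopologicalSpace H']
    (I : ModelWithCorners ℝ E H) (I' : ModelWithCorners ℝ E' H')
    [TopologicalSpace M] [ChartedSpace H M] [TopologicalSpace M'] [ChartedSpace H' M']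
    (f : M → M') : Prop where
  smooth : ContMDiff I I' ∞ f
  surjective : ∀ p, Function.Surjective (mfderiv I I' f p)
  inward_iff : ∀ (p : M) (v : TangentSpace I p),
    InwardPointing I' (f p) (mfderiv I I' f p v) ↔ InwardPointing I p v

open Classical in
/-- A Lie groupoid: arrows and units are (second countable) manifolds with corners, the space of
units is Hausdorff, all structural maps are smooth and `d` is a tame submersion. The product is
smooth as a map on the set of composable pairs. -/
structure IsLieGroupoid {E H E' H' Arr Obj : Type*}
    [NormedAddCommGroup E] [NormedSpace ℝ E] [TopologicalSpace H]
    [NormedAddCommGroup E'] [NormedSpace ℝ E'] [TopologicalSpace H']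
    (I : ModelWithCorners ℝ E H) (I' : ModelWithCorners ℝ E' H')
    [TopologicalSpace Arr] [ChartedSpace H Arr] [TopologicalSpace Obj] [ChartedSpace H' Obj]
    (𝒢 : GroupoidOn Arr Obj) : Prop where
  corner_arrows : IsCornerModel I
  corner_units : IsCornerModel I'
  manifold_arrows : IsManifold I ∞ Arr
  manifold_units : IsManifold I' ∞ Obj
  countable_arrows : SecondCountableTopology Arr
  countable_units : SecondCountableTopology Obj
  hausdorff_units : T2Space Obj
  smooth_d : ContMDiff I I' ∞ 𝒢.d
  smooth_r : ContMDiff I I' ∞ 𝒢.r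
  smooth_inv : ContMDiff I I ∞ 𝒢.inv
  smooth_u : ContMDiff I' I ∞ 𝒢.u
  tame_d : IsTameSubmersion I I' 𝒢.d
  smooth_mul : ContMDiffOn (I.prod I) I ∞
    (fun q : Arr × Arr => if h : 𝒢.d q.1 = 𝒢.r q.2 then 𝒢.mul q.1 q.2 h else q.1)
    {q | 𝒢.d q.1 = 𝒢.r q.2}

/-- An isomorphism of Lie groupoids `𝒢|_A ≃ ℋ|_B` between reductions to open sets of units:
mutually inverse smooth maps between the arrows of the two reductions, covering a diffeomorphism
`A → B` and compatible with the products. -/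
structure ReductionIso {E H E' H' Arr Obj F K F' K' Arr' Obj' : Type*}
    [NormedAddCommGroup E] [NormedSpace ℝ E] [TopologicalSpace H]
    [NormedAddCommGroup E'] [NormedSpace ℝ E'] [TopologicalSpace H']
    [NormedAddCommGroup F] [NormedSpace ℝ F] [TopologicalSpace K]
    [NormedAddCommGroup F'] [NormedSpace ℝ F'] [TopologicalSpace K']
    (I : ModelWithCorners ℝ E H) (I' : ModelWithCorners ℝ E' H')
    (J : ModelWithCorners ℝ F K) (J' : ModelWithCorners ℝ F' K')
    [TopologicalSpace Arr] [ChartedSpace H Arr] [TopologicalSpace Obj] [ChartedSpace H' Obj]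
    [TopologicalSpace Arr'] [ChartedSpace K Arr'] [TopologicalSpace Obj'] [ChartedSpace K' Obj']
    (𝒢 : GroupoidOn Arr Obj) (A : Set Obj) (ℋ : GroupoidOn Arr' Obj') (B : Set Obj') where
  onArrows : OpenPartialHomeomorph Arr Arr'
  onUnits : OpenPartialHomeomorph Obj Obj'
  arrows_source : onArrows.source = 𝒢.arrowsOver A
  arrows_target : onArrows.target = ℋ.arrowsOver B
  units_source : onUnits.source = A
  units_target : onUnits.target = B
  arrows_smooth : ContMDiffOn I J ∞ onArrows onArrows.source
  arrows_symm_smooth : ContMDiffOn J I ∞ onArrows.symm onArrows.target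
  units_smooth : ContMDiffOn I' J' ∞ onUnits onUnits.source
  units_symm_smooth : ContMDiffOn J' I' ∞ onUnits.symm onUnits.target
  map_r : ∀ g ∈ 𝒢.arrowsOver A, ℋ.r (onArrows g) = onUnits (𝒢.r g)
  map_d : ∀ g ∈ 𝒢.arrowsOver A, ℋ.d (onArrows g) = onUnits (𝒢.d g)
  map_mul : ∀ g ∈ 𝒢.arrowsOver A, ∀ h ∈ 𝒢.arrowsOver A, ∀ (hgh : 𝒢.d g = 𝒢.r h)
    (hgh' : ℋ.d (onArrows g) = ℋ.r (onArrows h)),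
    onArrows (𝒢.mul g h hgh) = ℋ.mul (onArrows g) (onArrows h) hgh'

/-- A Lie group `G` acting smoothly from the right on a Hausdorff manifold (with corners) `X`. -/
structure SmoothRightAction where
  X : Type
  G : Type
  EX : Type
  HX : Type
  EG : Type
  HG : Type
  [normX : NormedAddCommGroup EX]
  [spaceX : NormedSpace ℝ EX]
  [topHX : TopologicalSpace HX]
  [normG : NormedAddCommGroup EG]
  [spaceG : NormedSpace ℝ EG]
  [finG : FiniteDimensional ℝ EG]
  [topHG : TopologicalSpace HG]
  IX : ModelWithCorners ℝ EX HX
  IG : ModelWithCorners ℝ EG HG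
  corner : IsCornerModel IX
  [boundaryless : IG.Boundaryless]
  [topX : TopologicalSpace X]
  [hausdorffX : T2Space X]
  [countableX : SecondCountableTopology X]
  [chartedX : ChartedSpace HX X]
  [manifoldX : IsManifold IX ∞ X]
  [topG : TopologicalSpace G]
  [countableG : SecondCountableTopology G]
  [chartedG : ChartedSpace HG G]
  [groupG : Group G]
  [lieG : LieGroup IG ∞ G]
  [act : MulAction Gᵐᵒᵖ X]
  smooth_act : ContMDiff (IX.prod IG) IX ∞ (fun q : X × G => MulOpposite.op q.2 • q.1)

attribute [instance] SmoothRightAction.normX SmoothRightAction.spaceX SmoothRightAction.topHX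
  SmoothRightAction.normG SmoothRightAction.spaceG SmoothRightAction.topHG
  SmoothRightAction.topX SmoothRightAction.chartedX SmoothRightAction.topG
  SmoothRightAction.chartedG SmoothRightAction.groupG SmoothRightAction.act

/-- A Lie groupoid `𝒢 ⇉ M` is a boundary action groupoid if there is an open dense invariant set
`U` of units with `𝒢_U ≃ U × U` (the pair groupoid), and an open cover of `M` such that over each
of its members `𝒢` is isomorphic to the reduction of the action groupoid of a smooth right action
to an open set, and such that two composable arrows always lie over a common member of the cover
(weak gluing condition). -/
structure IsBoundaryActionGroupoid {E H E' H' Arr Obj : Type*}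
    [NormedAddCommGroup E] [NormedSpace ℝ E] [TopologicalSpace H]
    [NormedAddCommGroup E'] [NormedSpace ℝ E'] [TopologicalSpace H']
    (I : ModelWithCorners ℝ E H) (I' : ModelWithCorners ℝ E' H')
    [TopologicalSpace Arr] [ChartedSpace H Arr] [TopologicalSpace Obj] [ChartedSpace H' Obj]
    (𝒢 : GroupoidOn Arr Obj) : Prop where
  lie : IsLieGroupoid I I' 𝒢
  pair_on_dense : ∃ U : Set Obj, IsOpen U ∧ Dense U ∧ (∀ g, 𝒢.d g ∈ U → 𝒢.r g ∈ U) ∧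
    Nonempty (ReductionIso I I' (I'.prod I') I' 𝒢 U (GroupoidOn.pair Obj) U)
  local_action : ∃ (ι : Type) (W : ι → Set Obj), (∀ j, IsOpen (W j)) ∧ (⋃ j, W j) = univ ∧
    (∀ j, ∃ (α : SmoothRightAction) (W' : Set α.X), IsOpen W' ∧
      Nonempty (ReductionIso I I' (α.IX.prod α.IG) α.IX
        𝒢 (W j) (GroupoidOn.action α.X α.G) W')) ∧
    (∀ g h, 𝒢.d g = 𝒢.r h → ∃ j, g ∈ 𝒢.arrowsOver (W j) ∧ h ∈ 𝒢.arrowsOver (W j))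

/-! ### Gluing spaces: `(⊔ i, X i) ∪_f Y` -/

section Glue

variable {ι : Type} {X : ι → Type} {Y : Type} (U : ∀ i, Set (X i)) (f : ∀ i, U i → Y)

/-- A point `x` of the part `U i` of `X i` is identified with the point `f i x` of `Y`. -/
inductive Glue.Rel : (Σ i, X i) ⊕ Y → (Σ i, X i) ⊕ Y → Prop
  | mk (i : ι) (x : U i) : Glue.Rel (Sum.inl ⟨i, x.1⟩) (Sum.inr (f i x))

/-- The space obtained from the disjoint union of the `X i` and of `Y` by gluing `U i ⊆ X i` to
`Y` along `f i`. It carries the quotient topology. -/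
def Glue : Type := Quot (Glue.Rel U f)

namespace Glue

/-- The canonical map `X i → Glue U f`. -/
def piece (i : ι) (x : X i) : Glue U f := Quot.mk _ (Sum.inl ⟨i, x⟩)

/-- The canonical map `Y → Glue U f`. -/
def core (y : Y) : Glue U f := Quot.mk _ (Sum.inr y)

theorem glue (i : ι) (x : U i) : piece U f i x.1 = core U f (f i x) :=
  Quot.sound (Rel.mk i x)

theorem cases_on (z : Glue U f) :
    (∃ y, z = core U f y) ∨ ∃ i x, x ∉ U i ∧ z = piece U f i x := by
  obtain ⟨a, rfl⟩ := Quot.exists_rep z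
  rcases a with ⟨i, x⟩ | y
  · by_cases hx : x ∈ U i
    · exact Or.inl ⟨_, glue U f i ⟨x, hx⟩⟩
    · exact Or.inr ⟨i, x, hx, rfl⟩
  · exact Or.inl ⟨y, rfl⟩

open Classical in
/-- The representative of a point that lies in `Y`, if there is one. -/
def normalForm : Glue U f → (Σ i, X i) ⊕ Y :=
  Quot.lift (fun a => Sum.elim
    (fun x => if hx : x.2 ∈ U x.1 then Sum.inr (f x.1 ⟨x.2, hx⟩) else Sum.inl x) Sum.inr a) (by
      rintro _ _ ⟨i, x⟩
      simp)

theorem normalForm_core (y : Y) : normalForm U f (core U f y) = Sum.inr y := rfl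

open Classical in
theorem normalForm_of_mem {i : ι} {x : X i} (hx : x ∈ U i) :
    normalForm U f (piece U f i x) = Sum.inr (f i ⟨x, hx⟩) := by
  show (if hx : x ∈ U i then Sum.inr (f i ⟨x, hx⟩) else Sum.inl ⟨i, x⟩ : (Σ i, X i) ⊕ Y) = _
  rw [dif_pos hx]

open Classical in
theorem normalForm_of_notMem {i : ι} {x : X i} (hx : x ∉ U i) :
    normalForm U f (piece U f i x) = Sum.inl ⟨i, x⟩ := by
  show (if hx : x ∈ U i then Sum.inr (f i ⟨x, hx⟩) else Sum.inl ⟨i, x⟩ : (Σ i, X i) ⊕ Y) = _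
  rw [dif_neg hx]

theorem core_injective : Function.Injective (core U f) := fun y y' h => by
  simpa [normalForm_core] using congrArg (normalForm U f) h

theorem piece_eq_core {i : ι} {x : X i} {y : Y} (h : piece U f i x = core U f y) :
    ∃ hx : x ∈ U i, f i ⟨x, hx⟩ = y := by
  have h' := congrArg (normalForm U f) h
  by_cases hx : x ∈ U i
  · rw [normalForm_of_mem U f hx, normalForm_core] at h'
    exact ⟨hx, Sum.inr_injective h'⟩
  · rw [normalForm_of_notMem U f hx, normalForm_core] at h'
    exact absurd h' (by simp)

theorem piece_eq_piece {i j : ι} {x : X i} {x' : X j} (hx : x ∉ U i)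
    (h : piece U f i x = piece U f j x') :
    (⟨i, x⟩ : Σ i, X i) = ⟨j, x'⟩ := by
  have h' := congrArg (normalForm U f) h
  rw [normalForm_of_notMem U f hx] at h'
  by_cases hx' : x' ∈ U j
  · rw [normalForm_of_mem U f hx'] at h'
    exact absurd h' (by simp)
  · rw [normalForm_of_notMem U f hx'] at h'
    exact Sum.inl_injective h'

theorem piece_injective (hf : ∀ i, Function.Injective (f i)) (i : ι) :
    Function.Injective (piece U f i) := fun x x' h => by
  by_cases hx : x ∈ U i
  · have h1 : piece U f i x' = core U f (f i ⟨x, hx⟩) := h.symm.trans (glue U f i ⟨x, hx⟩)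
    obtain ⟨hx', h2⟩ := piece_eq_core U f h1
    exact (congrArg Subtype.val (hf i h2)).symm
  · simpa using piece_eq_piece U f hx h

variable [∀ i, TopologicalSpace (X i)] [TopologicalSpace Y]

instance : TopologicalSpace (Glue U f) := inferInstanceAs (TopologicalSpace (Quot (Rel U f)))

theorem continuous_piece (i : ι) : Continuous (piece U f i) :=
  continuous_quot_mk.comp (continuous_inl.comp continuous_sigmaMk)

theorem continuous_core : Continuous (core U f) := continuous_quot_mk.comp continuous_inr

theorem isOpen_iff {s : Set (Glue U f)} :
    IsOpen s ↔ (∀ i, IsOpen (piece U f i ⁻¹' s)) ∧ IsOpen (core U f ⁻¹' s) := by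
  constructor
  · exact fun h => ⟨fun i => h.preimage (continuous_piece U f i), h.preimage (continuous_core U f)⟩
  · rintro ⟨h1, h2⟩
    have : IsOpen (Quot.mk (Rel U f) ⁻¹' s) := by
      rw [isOpen_sum_iff]
      refine ⟨?_, h2⟩
      rw [isOpen_sigma_iff]
      exact h1
    exact isQuotientMap_quot_mk.isOpen_preimage.mp this

theorem isOpenEmbedding_core (hU : ∀ i, IsOpen (U i)) (hf : ∀ i, IsOpenEmbedding (f i)) :
    IsOpenEmbedding (core U f) := by
  refine .of_continuous_injective_isOpenMap (continuous_core U f) (core_injective U f) ?_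
  intro s hs
  rw [isOpen_iff]
  constructor
  · intro i
    have : piece U f i ⁻¹' (core U f '' s) = Subtype.val '' (f i ⁻¹' s) := by
      ext x
      constructor
      · rintro ⟨y, hy, hxy⟩
        obtain ⟨hx, rfl⟩ := piece_eq_core U f hxy.symm
        exact ⟨⟨x, hx⟩, hy, rfl⟩
      · rintro ⟨x, hx, rfl⟩
        exact ⟨_, hx, (glue U f i x).symm⟩
    rw [this]
    exact (hU i).isOpenMap_subtype_val _ (hs.preimage (hf i).continuous)
  · rwa [preimage_image_eq _ (core_injective U f)]

theorem isOpenEmbedding_piece (hU : ∀ i, IsOpen (U i)) (hf : ∀ i, IsOpenEmbedding (f i)) (i : ι) :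
    IsOpenEmbedding (piece U f i) := by
  have hinj : ∀ i, Function.Injective (f i) := fun i => (hf i).injective
  refine .of_continuous_injective_isOpenMap (continuous_piece U f i)
    (piece_injective U f hinj i) ?_
  intro s hs
  have hV : IsOpen (f i '' (Subtype.val ⁻¹' s)) :=
    (hf i).isOpenMap _ (hs.preimage continuous_subtype_val)
  rw [isOpen_iff]
  constructor
  · intro j
    by_cases hij : j = i
    · subst hij
      rwa [preimage_image_eq _ (piece_injective U f hinj j)]
    · have : piece U f j ⁻¹' (piece U f i '' s) =
          Subtype.val '' (f j ⁻¹' (f i '' (Subtype.val ⁻¹' s))) := by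
        ext x
        constructor
        · rintro ⟨x', hx', h⟩
          by_cases hx : x' ∈ U i
          · have h1 := h.symm.trans (glue U f i ⟨x', hx⟩)
            obtain ⟨hxj, h2⟩ := piece_eq_core U f h1
            exact ⟨⟨x, hxj⟩, ⟨⟨x', hx⟩, hx', h2.symm⟩, rfl⟩
          · exact absurd (congrArg Sigma.fst (piece_eq_piece U f hx h)).symm hij
        · rintro ⟨x, ⟨x', hx', h⟩, rfl⟩
          refine ⟨x', hx', ?_⟩
          rw [glue U f i x', h, glue U f j x]
      rw [this]
      exact (hU j).isOpenMap_subtype_val _ (hV.preimage (hf j).continuous)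
  · have : core U f ⁻¹' (piece U f i '' s) = f i '' (Subtype.val ⁻¹' s) := by
      ext y
      constructor
      · rintro ⟨x, hx, h⟩
        obtain ⟨hxi, h2⟩ := piece_eq_core U f h
        exact ⟨⟨x, hxi⟩, hx, h2⟩
      · rintro ⟨x, hx, rfl⟩
        exact ⟨x, hx, glue U f i x⟩
    rwa [this]

variable (hU : ∀ i, IsOpen (U i)) (hf : ∀ i, IsOpenEmbedding (f i))
  {H H₀ : Type} [TopologicalSpace H] [TopologicalSpace H₀]
  [∀ i, ChartedSpace H (X i)] [ChartedSpace H₀ Y]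

/-- The chart of `X i` at `x`, seen as a chart of the glued space. -/
def pieceChart (i : ι) (x : X i) : OpenPartialHomeomorph (Glue U f) H :=
  haveI : Nonempty (X i) := ⟨x⟩
  ((isOpenEmbedding_piece U f hU hf i).toOpenPartialHomeomorph _).symm.trans (chartAt H x)

/-- The chart of `Y` at `y`, seen as a chart of the glued space. As charts of `Y` take their
values in `H₀`, they are followed by an open embedding `k` of `H₀` in `H`. -/
def coreChart (k : OpenPartialHomeomorph H₀ H) (y : Y) : OpenPartialHomeomorph (Glue U f) H :=
  haveI : Nonempty Y := ⟨y⟩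
  (((isOpenEmbedding_core U f hU hf).toOpenPartialHomeomorph _).symm.trans (chartAt H₀ y)).trans k

theorem mem_pieceChart_source (i : ι) (x : X i) :
    piece U f i x ∈ (pieceChart U f hU hf i x : OpenPartialHomeomorph _ H).source := by
  have : Nonempty (X i) := ⟨x⟩
  have h := (isOpenEmbedding_piece U f hU hf i).toOpenPartialHomeomorph_left_inv (x := x)
  simp [pieceChart, h]

theorem mem_coreChart_source (k : OpenPartialHomeomorph H₀ H) (hk : k.source = univ) (y : Y) :
    core U f y ∈ (coreChart U f hU hf k y).source := by
  have : Nonempty Y := ⟨y⟩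
  have h := (isOpenEmbedding_core U f hU hf).toOpenPartialHomeomorph_left_inv (x := y)
  simp [coreChart, h, hk]

open Classical in
/-- The atlas of the glued space, made of the charts of the `X i` and of `Y`. -/
@[reducible] def chartedSpace (k : OpenPartialHomeomorph H₀ H) (hk : k.source = univ) :
    ChartedSpace H (Glue U f) where
  atlas := {e | (∃ i x, e = pieceChart U f hU hf i x) ∨ ∃ y, e = coreChart U f hU hf k y}
  chartAt z :=
    if h : ∃ y, z = core U f y then coreChart U f hU hf k h.choose
    else
      have h' := (cases_on U f z).resolve_left h
      pieceChart U f hU hf h'.choose h'.choose_spec.choose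
  mem_chart_source z := by
    by_cases h : ∃ y, z = core U f y
    · simp only [dif_pos h]
      exact mem_of_eq_of_mem h.choose_spec (mem_coreChart_source U f hU hf k hk _)
    · simp only [dif_neg h]
      have h' := (cases_on U f z).resolve_left h
      exact mem_of_eq_of_mem h'.choose_spec.choose_spec.2 (mem_pieceChart_source U f hU hf _ _)
  chart_mem_atlas z := by
    by_cases h : ∃ y, z = core U f y
    · simp only [dif_pos h]
      exact Or.inr ⟨_, rfl⟩
    · simp only [dif_neg h]
      exact Or.inl ⟨_, _, rfl⟩

end Glue

end Glue

/-! ### Gluing groupoids `𝒜 i ⇉ X i` with the pair groupoid of `Y`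

The groupoids `𝒜 i` are glued with `Y × Y` along isomorphisms, covering `f i`, of their reductions
to invariant sets `U i` of units with reductions of `Y × Y`. An isomorphism with (a reduction of)
the pair groupoid covering `f i` sends `g` to `(f i (r g), f i (d g))`. -/

section AttachEnds

variable {ι : Type} {X A : ι → Type} {Y : Type} (𝒜 : ∀ i, GroupoidOn (A i) (X i))
  (U : ∀ i, Set (X i)) (f : ∀ i, U i → Y)

/-- The identification of the arrows over `U i` with arrows of the pair groupoid of `Y`. -/
def arrowMap (i : ι) (g : (𝒜 i).arrowsOver (U i)) : Y × Y :=
  (f i ⟨(𝒜 i).r g.1, g.2.1⟩, f i ⟨(𝒜 i).d g.1, g.2.2⟩)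

/-- The space of arrows of the glued groupoid. -/
abbrev GlueArrows : Type := Glue (fun i => (𝒜 i).arrowsOver (U i)) (arrowMap 𝒜 U f)

namespace GlueArrows

/-- The graph of the product of the glued groupoid: two arrows are multiplied inside a groupoid of
the family in which they have composable representatives. -/
inductive MulRel : GlueArrows 𝒜 U f → GlueArrows 𝒜 U f → GlueArrows 𝒜 U f → Prop
  | piece (i : ι) (g h : A i) (hgh : (𝒜 i).d g = (𝒜 i).r h) :
      MulRel (Glue.piece _ _ i g) (Glue.piece _ _ i h) (Glue.piece _ _ i ((𝒜 i).mul g h hgh))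
  | core (b c : Y × Y) (hbc : b.2 = c.1) :
      MulRel (Glue.core _ _ b) (Glue.core _ _ c) (Glue.core _ _ (b.1, c.2))

/-- The domain map of the glued groupoid. -/
def dom : GlueArrows 𝒜 U f → Glue U f :=
  Quot.lift (fun a => Sum.elim (fun g => Glue.piece U f g.1 ((𝒜 g.1).d g.2))
    (fun b => Glue.core U f b.2) a) (by
      rintro _ _ ⟨i, g⟩
      exact Glue.glue U f i ⟨_, g.2.2⟩)

/-- The range map of the glued groupoid. -/
def rng : GlueArrows 𝒜 U f → Glue U f :=
  Quot.lift (fun a => Sum.elim (fun g => Glue.piece U f g.1 ((𝒜 g.1).r g.2))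
    (fun b => Glue.core U f b.1) a) (by
      rintro _ _ ⟨i, g⟩
      exact Glue.glue U f i ⟨_, g.2.1⟩)

/-- The units of the glued groupoid. -/
def unit : Glue U f → GlueArrows 𝒜 U f :=
  Quot.lift (fun a => Sum.elim (fun x => Glue.piece _ _ x.1 ((𝒜 x.1).u x.2))
    (fun y => Glue.core _ _ (y, y)) a) (by
      rintro _ _ ⟨i, x⟩
      have hx : (𝒜 i).u x.1 ∈ (𝒜 i).arrowsOver (U i) :=
        ⟨by rw [(𝒜 i).r_u]; exact x.2, by rw [(𝒜 i).d_u]; exact x.2⟩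
      refine (Glue.glue _ (arrowMap 𝒜 U f) i ⟨_, hx⟩).trans (congrArg _ ?_)
      simp [arrowMap, (𝒜 i).r_u, (𝒜 i).d_u])

/-- The inverse map of the glued groupoid. -/
def inverse : GlueArrows 𝒜 U f → GlueArrows 𝒜 U f :=
  Quot.lift (fun a => Sum.elim (fun g => Glue.piece _ _ g.1 ((𝒜 g.1).inv g.2))
    (fun b => Glue.core _ _ (b.2, b.1)) a) (by
      rintro _ _ ⟨i, g⟩
      have hg : (𝒜 i).inv g.1 ∈ (𝒜 i).arrowsOver (U i) :=
        ⟨by rw [(𝒜 i).r_inv]; exact g.2.2, by rw [(𝒜 i).d_inv]; exact g.2.1⟩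
      refine (Glue.glue _ (arrowMap 𝒜 U f) i ⟨_, hg⟩).trans (congrArg _ ?_)
      simp [arrowMap, (𝒜 i).r_inv, (𝒜 i).d_inv])

variable {𝒜 U f}

/-- Arrows composable with an arrow of `Y × Y` are in `Y × Y`. -/
theorem core_of_rng (hinv : ∀ i g, (𝒜 i).r g ∈ U i ↔ (𝒜 i).d g ∈ U i)
    {x : GlueArrows 𝒜 U f} {y : Y} (h : rng 𝒜 U f x = Glue.core U f y) :
    ∃ b : Y × Y, x = Glue.core _ _ b := by
  rcases Glue.cases_on _ _ x with ⟨b, rfl⟩ | ⟨i, g, hg, rfl⟩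
  · exact ⟨b, rfl⟩
  · obtain ⟨hr, -⟩ := Glue.piece_eq_core U f (x := (𝒜 i).r g) h
    exact absurd ⟨hr, (hinv i g).1 hr⟩ hg

/-- Two composable arrows are both in `Y × Y`, or are both in the same `𝒜 i` and not in `Y × Y`. -/
theorem cases_comp (hinv : ∀ i g, (𝒜 i).r g ∈ U i ↔ (𝒜 i).d g ∈ U i)
    (x y : GlueArrows 𝒜 U f) (h : dom 𝒜 U f x = rng 𝒜 U f y) :
    (∃ b c : Y × Y, b.2 = c.1 ∧ x = Glue.core _ _ b ∧ y = Glue.core _ _ c) ∨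
    ∃ (i : ι) (g k : A i), (𝒜 i).r g ∉ U i ∧ (𝒜 i).d g ∉ U i ∧ (𝒜 i).d k ∉ U i ∧
      (𝒜 i).d g = (𝒜 i).r k ∧ x = Glue.piece _ _ i g ∧ y = Glue.piece _ _ i k := by
  rcases Glue.cases_on _ _ x with ⟨b, rfl⟩ | ⟨i, g, hg, rfl⟩
  · obtain ⟨c, rfl⟩ := core_of_rng hinv (y := b.2) h.symm
    exact Or.inl ⟨b, c, Glue.core_injective U f h, rfl, rfl⟩
  · have hd : (𝒜 i).d g ∉ U i := fun hd => hg ⟨(hinv i g).2 hd, hd⟩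
    have hr : (𝒜 i).r g ∉ U i := fun hr => hd ((hinv i g).1 hr)
    rcases Glue.cases_on _ _ y with ⟨c, rfl⟩ | ⟨j, k, hk, rfl⟩
    · obtain ⟨hd', -⟩ := Glue.piece_eq_core U f (x := (𝒜 i).d g) (y := c.1) h
      exact absurd hd' hd
    · have h1 : (⟨i, (𝒜 i).d g⟩ : Σ i, X i) = ⟨j, (𝒜 j).r k⟩ :=
        Glue.piece_eq_piece U f hd h
      obtain rfl : i = j := congrArg Sigma.fst h1
      have h2 : (𝒜 i).d g = (𝒜 i).r k := by simpa using h1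
      exact Or.inr ⟨i, g, k, hr, hd, fun h3 => hd (h2 ▸ (hinv i k).2 h3), h2, rfl, rfl⟩

theorem exists_mul (hinv : ∀ i g, (𝒜 i).r g ∈ U i ↔ (𝒜 i).d g ∈ U i)
    (x y : GlueArrows 𝒜 U f) (h : dom 𝒜 U f x = rng 𝒜 U f y) :
    ∃ z, MulRel 𝒜 U f x y z := by
  rcases cases_comp hinv x y h with ⟨b, c, hbc, rfl, rfl⟩ | ⟨i, g, k, -, -, -, hgk, rfl, rfl⟩
  · exact ⟨_, .core b c hbc⟩
  · exact ⟨_, .piece i g k hgk⟩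

theorem mulRel_core {b c : Y × Y} {z : GlueArrows 𝒜 U f}
    (h : MulRel 𝒜 U f (Glue.core _ _ b) (Glue.core _ _ c) z) :
    z = Glue.core _ _ (b.1, c.2) := by
  generalize hx : (Glue.core _ _ b : GlueArrows 𝒜 U f) = x at h
  generalize hy : (Glue.core _ _ c : GlueArrows 𝒜 U f) = y at h
  rcases h with ⟨i, g, k, hgk⟩ | ⟨b', c', hbc⟩
  · obtain ⟨hg, rfl⟩ := Glue.piece_eq_core _ _ hx.symm
    obtain ⟨hk, rfl⟩ := Glue.piece_eq_core _ _ hy.symm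
    have hm : (𝒜 i).mul g k hgk ∈ (𝒜 i).arrowsOver (U i) :=
      ⟨by rw [(𝒜 i).r_mul]; exact hg.1, by rw [(𝒜 i).d_mul]; exact hk.2⟩
    refine (Glue.glue _ (arrowMap 𝒜 U f) i ⟨_, hm⟩).trans (congrArg _ ?_)
    simp [arrowMap, (𝒜 i).r_mul, (𝒜 i).d_mul]
  · rw [Glue.core_injective _ _ hx, Glue.core_injective _ _ hy]

theorem mulRel_piece {i : ι} {g k : A i} {z : GlueArrows 𝒜 U f}
    (hg : (𝒜 i).d g ∉ U i) (hk : (𝒜 i).d k ∉ U i) (hgk : (𝒜 i).d g = (𝒜 i).r k)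
    (h : MulRel 𝒜 U f (Glue.piece _ _ i g) (Glue.piece _ _ i k) z) :
    z = Glue.piece _ _ i ((𝒜 i).mul g k hgk) := by
  have hg' : g ∉ (𝒜 i).arrowsOver (U i) := fun h => hg h.2
  have hk' : k ∉ (𝒜 i).arrowsOver (U i) := fun h => hk h.2
  generalize hx : (Glue.piece _ _ i g : GlueArrows 𝒜 U f) = x at h
  generalize hy : (Glue.piece _ _ i k : GlueArrows 𝒜 U f) = y at h
  rcases h with ⟨j, g', k', hgk'⟩ | ⟨b', c', hbc⟩
  · have h1 := Glue.piece_eq_piece (fun i => (𝒜 i).arrowsOver (U i)) _ hg' hx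
    have h2 := Glue.piece_eq_piece (fun i => (𝒜 i).arrowsOver (U i)) _ hk' hy
    obtain rfl : i = j := congrArg Sigma.fst h1
    obtain rfl : g = g' := by simpa using h1
    obtain rfl : k = k' := by simpa using h2
    rfl
  · exact absurd (Glue.piece_eq_core _ _ hx).1 hg'

/-- The product of the glued groupoid. -/
def product (hinv : ∀ i g, (𝒜 i).r g ∈ U i ↔ (𝒜 i).d g ∈ U i)
    (x y : GlueArrows 𝒜 U f) (h : dom 𝒜 U f x = rng 𝒜 U f y) : GlueArrows 𝒜 U f :=
  (exists_mul hinv x y h).choose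

theorem product_core (hinv : ∀ i g, (𝒜 i).r g ∈ U i ↔ (𝒜 i).d g ∈ U i) (b c : Y × Y)
    (h : dom 𝒜 U f (Glue.core _ _ b) = rng 𝒜 U f (Glue.core _ _ c)) :
    product hinv (Glue.core _ _ b) (Glue.core _ _ c) h = Glue.core _ _ (b.1, c.2) :=
  mulRel_core (exists_mul hinv _ _ h).choose_spec

theorem product_piece (hinv : ∀ i g, (𝒜 i).r g ∈ U i ↔ (𝒜 i).d g ∈ U i) (i : ι) (g k : A i)
    (hgk : (𝒜 i).d g = (𝒜 i).r k)
    (h : dom 𝒜 U f (Glue.piece _ _ i g) = rng 𝒜 U f (Glue.piece _ _ i k)) :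
    product hinv (Glue.piece _ _ i g) (Glue.piece _ _ i k) h =
      Glue.piece _ _ i ((𝒜 i).mul g k hgk) := by
  by_cases hg : (𝒜 i).d g ∈ U i
  · have hk : (𝒜 i).d k ∈ U i := (hinv i k).1 (hgk ▸ hg)
    have hg' : g ∈ (𝒜 i).arrowsOver (U i) := ⟨(hinv i g).2 hg, hg⟩
    have hk' : k ∈ (𝒜 i).arrowsOver (U i) := ⟨(hinv i k).2 hk, hk⟩
    have hm : (𝒜 i).mul g k hgk ∈ (𝒜 i).arrowsOver (U i) :=
      ⟨by rw [(𝒜 i).r_mul]; exact hg'.1, by rw [(𝒜 i).d_mul]; exact hk⟩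
    have h1 := Glue.glue _ (arrowMap 𝒜 U f) i ⟨g, hg'⟩
    have h2 := Glue.glue _ (arrowMap 𝒜 U f) i ⟨k, hk'⟩
    have h3 := (exists_mul hinv _ _ h).choose_spec
    rw [show product hinv _ _ h = (exists_mul hinv _ _ h).choose from rfl]
    generalize (exists_mul hinv _ _ h).choose = z at h3
    simp only at h1 h2
    rw [h1, h2] at h3
    rw [mulRel_core h3]
    refine Eq.trans (congrArg _ ?_) (Glue.glue _ (arrowMap 𝒜 U f) i ⟨_, hm⟩).symm
    simp [arrowMap, (𝒜 i).r_mul, (𝒜 i).d_mul]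
  · have hk : (𝒜 i).d k ∉ U i := fun hk => hg (hgk ▸ (hinv i k).2 hk)
    exact mulRel_piece hg hk hgk (exists_mul hinv _ _ h).choose_spec

end GlueArrows

open GlueArrows in
/-- The groupoid obtained by gluing the groupoids `𝒜 i` with the pair groupoid of `Y`. -/
def attachEnds (hinv : ∀ i g, (𝒜 i).r g ∈ U i ↔ (𝒜 i).d g ∈ U i) :
    GroupoidOn (GlueArrows 𝒜 U f) (Glue U f) where
  d := dom 𝒜 U f
  r := rng 𝒜 U f
  u := unit 𝒜 U f
  inv := inverse 𝒜 U f
  mul := product hinv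
  d_u x := by
    rcases Glue.cases_on _ _ x with ⟨y, rfl⟩ | ⟨i, x, -, rfl⟩
    · rfl
    · exact congrArg (Glue.piece U f i) ((𝒜 i).d_u x)
  r_u x := by
    rcases Glue.cases_on _ _ x with ⟨y, rfl⟩ | ⟨i, x, -, rfl⟩
    · rfl
    · exact congrArg (Glue.piece U f i) ((𝒜 i).r_u x)
  d_inv x := by
    rcases Glue.cases_on _ _ x with ⟨b, rfl⟩ | ⟨i, g, -, rfl⟩
    · rfl
    · exact congrArg (Glue.piece U f i) ((𝒜 i).d_inv g)
  r_inv x := by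
    rcases Glue.cases_on _ _ x with ⟨b, rfl⟩ | ⟨i, g, -, rfl⟩
    · rfl
    · exact congrArg (Glue.piece U f i) ((𝒜 i).r_inv g)
  d_mul x y h := by
    rcases cases_comp hinv x y h with ⟨b, c, -, rfl, rfl⟩ | ⟨i, g, k, -, -, -, hgk, rfl, rfl⟩
    · rw [product_core]; rfl
    · rw [product_piece hinv i g k hgk]; exact congrArg (Glue.piece U f i) ((𝒜 i).d_mul g k hgk)
  r_mul x y h := by
    rcases cases_comp hinv x y h with ⟨b, c, -, rfl, rfl⟩ | ⟨i, g, k, -, -, -, hgk, rfl, rfl⟩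
    · rw [product_core]; rfl
    · rw [product_piece hinv i g k hgk]; exact congrArg (Glue.piece U f i) ((𝒜 i).r_mul g k hgk)
  mul_assoc x y z h h' := by
    rcases cases_comp hinv x y h with ⟨b, c, -, rfl, rfl⟩ | ⟨i, g, k, -, -, hk, hgk, rfl, rfl⟩
    · obtain ⟨e, rfl⟩ := core_of_rng hinv (y := c.2) h'.symm
      simp only [product_core]
    · rcases cases_comp hinv _ z h' with ⟨b, c, -, h1, -⟩ | ⟨j, k', l, -, -, -, hkl, h1, rfl⟩
      · exact absurd (Glue.piece_eq_core _ _ h1).1.2 hk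
      · have h2 := Glue.piece_eq_piece _ _ (fun h => hk h.2) h1
        obtain rfl : i = j := congrArg Sigma.fst h2
        obtain rfl : k = k' := by simpa using h2
        simp only [product_piece hinv i g k hgk, product_piece hinv i k l hkl]
        rw [product_piece hinv i _ _ (((𝒜 i).d_mul g k hgk).trans hkl),
          product_piece hinv i _ _ (hgk.trans ((𝒜 i).r_mul k l hkl).symm), (𝒜 i).mul_assoc]
  u_mul x := by
    rcases Glue.cases_on _ _ x with ⟨b, rfl⟩ | ⟨i, g, -, rfl⟩
    · exact product_core hinv (b.1, b.1) b _
    · exact (product_piece hinv i ((𝒜 i).u ((𝒜 i).r g)) g ((𝒜 i).d_u _) _).trans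
        (congrArg _ ((𝒜 i).u_mul g))
  mul_u x := by
    rcases Glue.cases_on _ _ x with ⟨b, rfl⟩ | ⟨i, g, -, rfl⟩
    · exact product_core hinv b (b.2, b.2) _
    · exact (product_piece hinv i g ((𝒜 i).u ((𝒜 i).d g)) ((𝒜 i).r_u _).symm _).trans
        (congrArg _ ((𝒜 i).mul_u g))
  inv_mul x := by
    rcases Glue.cases_on _ _ x with ⟨b, rfl⟩ | ⟨i, g, -, rfl⟩
    · exact product_core hinv (b.2, b.1) b _
    · exact (product_piece hinv i ((𝒜 i).inv g) g ((𝒜 i).d_inv _) _).trans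
        (congrArg _ ((𝒜 i).inv_mul g))
  mul_inv x := by
    rcases Glue.cases_on _ _ x with ⟨b, rfl⟩ | ⟨i, g, -, rfl⟩
    · exact product_core hinv b (b.2, b.1) _
    · exact (product_piece hinv i g ((𝒜 i).inv g) ((𝒜 i).r_inv _).symm _).trans
        (congrArg _ ((𝒜 i).mul_inv g))

end AttachEnds

/-! ### The dilation action of `(0, ∞)` on `[0, ∞)` -/

/-- The model `[0, ∞) ⊆ ℝ` of one-dimensional manifolds with boundary. -/
def halfLineModel : ModelWithCorners ℝ ℝ ℝ≥0 :=
  ModelWithCorners.ofConvexRange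
    { toFun := fun x => (x : ℝ)
      invFun := Real.toNNReal
      source := univ
      target := Ici 0
      map_source' := fun x _ => x.2
      map_target' := fun _ _ => mem_univ _
      left_inv' := fun x _ => Real.toNNReal_coe
      right_inv' := fun x hx => Real.coe_toNNReal x hx }
    rfl (convex_Ici 0) NNReal.continuous_coe continuous_real_toNNReal (by simp)

/-- The open embedding `exp : ℝ → [0, ∞)`, with image `(0, ∞)`. -/
def expEmbedding : OpenPartialHomeomorph ℝ ℝ≥0 where
  toFun x := ⟨Real.exp x, (Real.exp_pos x).le⟩
  invFun x := Real.log x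
  source := univ
  target := {x | x ≠ 0}
  map_source' x _ := by
    exact fun h => Real.exp_ne_zero x (congrArg NNReal.toReal h)
  map_target' _ _ := mem_univ _
  left_inv' x _ := Real.log_exp x
  right_inv' x hx := NNReal.eq (Real.exp_log (NNReal.coe_pos.2 (pos_iff_ne_zero.2 hx)))
  open_source := isOpen_univ
  open_target := isOpen_ne
  continuousOn_toFun := (Continuous.subtype_mk Real.continuous_exp _).continuousOn
  continuousOn_invFun := fun x hx =>
    ((Real.continuousAt_log (NNReal.coe_ne_zero.2 hx)).comp
      NNReal.continuous_coe.continuousAt).continuousWithinAt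

/-- The multiplicative group `(0, ∞)`. -/
abbrev PosReal : Type := {x : ℝ // 0 < x}

instance : ChartedSpace ℝ PosReal :=
  inferInstanceAs (ChartedSpace ℝ (⟨Ioi 0, isOpen_Ioi⟩ : TopologicalSpace.Opens ℝ))

/-- A positive real number as a non-negative one. -/
def PosReal.toNNReal (a : PosReal) : ℝ≥0 := ⟨a.1, a.2.le⟩

/-- The action of `(0, ∞)` on `[0, ∞)` by dilations. -/
instance dilationAction : MulAction PosRealᵐᵒᵖ ℝ≥0 where
  smul a x := x * a.unop.toNNReal
  one_smul x := NNReal.eq (mul_one (x : ℝ))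
  mul_smul a b x := NNReal.eq (by
    show (x : ℝ) * (b.unop.1 * a.unop.1) = x * b.unop.1 * a.unop.1
    ring)

/-- The groupoid `ℋ = [0, ∞) ⋊ (0, ∞)`. -/
abbrev dilationGroupoid : GroupoidOn (ℝ≥0 × PosReal) ℝ≥0 := GroupoidOn.action ℝ≥0 PosReal

/-! ### Smooth submanifolds -/

/-- The subset `S` of the manifold `N` is an embedded smooth submanifold (without boundary),
modelled on the vector space `F`. -/
def IsSmoothSubmanifold (F : Type) [NormedAddCommGroup F] [NormedSpace ℝ F]
    {E H N : Type} [NormedAddCommGroup E] [NormedSpace ℝ E] [TopologicalSpace H]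
    (I : ModelWithCorners ℝ E H) [TopologicalSpace N] [ChartedSpace H N] (S : Set N) : Prop :=
  ∃ _ : ChartedSpace F S, IsManifold 𝓘(ℝ, F) ∞ S ∧
    Manifold.IsSmoothEmbedding 𝓘(ℝ, F) I ∞ (Subtype.val : S → N)

/-- The smooth structure of a submanifold (it is unique). -/
@[reducible] def IsSmoothSubmanifold.chartedSpace {F : Type} [NormedAddCommGroup F]
    [NormedSpace ℝ F] {E H N : Type} [NormedAddCommGroup E] [NormedSpace ℝ E] [TopologicalSpace H]
    {I : ModelWithCorners ℝ E H} [TopologicalSpace N] [ChartedSpace H N] {S : Set N}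
    (h : IsSmoothSubmanifold F I S) : ChartedSpace F S :=
  h.choose

/-! ### Conical domains -/

/-- The Euclidean space `ℝⁿ`. -/
abbrev Euc (n : ℕ) : Type := EuclideanSpace ℝ (Fin n)

/-- The unit sphere of `ℝⁿ`. -/
abbrev UnitSphere (n : ℕ) : Type := sphere (0 : Euc n) 1

instance sphereDim (d : ℕ) : Fact (Module.finrank ℝ (Euc (d + 2)) = (d + 1) + 1) :=
  ⟨by simp⟩

/-- A domain with conical points in `ℝⁿ`, where `n = d + 2`: a bounded, open, connected set `Ω`
with points `p i ∈ ∂Ω`, `i < l`, such that `∂Ω ∖ {p i}` is a smooth hypersurface and such that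
near `p i` the set `Ω` is diffeomorphic to a truncated cone whose base is an open subset
`base i ≠ S^(n-1)` of the sphere with smooth boundary. -/
structure ConicalDomain (d : ℕ) where
  Ω : Set (Euc (d + 2))
  isOpen : IsOpen Ω
  isConnected : IsConnected Ω
  isBounded : Bornology.IsBounded Ω
  l : ℕ
  p : Fin l → Euc (d + 2)
  p_mem : ∀ i, p i ∈ frontier Ω
  smooth_boundary : IsSmoothSubmanifold (ℝ × Euc d) 𝓘(ℝ, Euc (d + 2)) (frontier Ω \ range p)
  base : Fin l → Set (UnitSphere (d + 2))
  base_isOpen : ∀ i, IsOpen (base i)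
  base_ne_univ : ∀ i, base i ≠ univ
  base_smooth : ∀ i, IsSmoothSubmanifold (Euc d) (𝓡 (d + 1)) (frontier (base i))
  φ : Fin l → OpenPartialHomeomorph (Euc (d + 2)) (Euc (d + 2))
  p_mem_source : ∀ i, p i ∈ (φ i).source
  φ_p : ∀ i, φ i (p i) = 0
  φ_target : ∀ i, (φ i).target = ball 0 1
  φ_smooth : ∀ i, ContDiffOn ℝ ∞ (φ i) (φ i).source
  φ_symm_smooth : ∀ i, ContDiffOn ℝ ∞ (φ i).symm (φ i).target
  φ_cone : ∀ i, φ i '' (Ω ∩ (φ i).source) =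
    {z | ∃ r ∈ Ioo (0 : ℝ) 1, ∃ x ∈ base i, z = r • (x : Euc (d + 2))}
  disjoint_charts : ∀ i j, i ≠ j → Disjoint (closure (φ i).source) (closure (φ j).source)

namespace ConicalDomain

variable {d : ℕ} (D : ConicalDomain d)

/-- The domain has no cracks: `∂Ω` is the boundary of the closure of `Ω`. -/
def NoCracks : Prop := frontier D.Ω = frontier (closure D.Ω)

/-- The smooth part `Ω₀ = ∂Ω ∖ {p i}` of the boundary. -/
abbrev SmoothPart : Type := (frontier D.Ω \ range D.p : Set (Euc (d + 2)))

/-- The boundary `∂ω_i` of the base of the cone at `p i`. -/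
abbrev Link (i : Fin D.l) : Type := frontier (D.base i)

instance : ChartedSpace (ℝ × Euc d) D.SmoothPart := D.smooth_boundary.chartedSpace

instance (i : Fin D.l) : ChartedSpace (Euc d) (D.Link i) := (D.base_smooth i).chartedSpace

/-- The cylinder `[0, 1) × ∂ω_i`, as an open subset of `[0, ∞) × ∂ω_i`. -/
def collar (i : Fin D.l) : TopologicalSpace.Opens (ℝ≥0 × D.Link i) where
  carrier := {x | x.1 < 1}
  is_open' := isOpen_lt continuous_fst continuous_const

/-- The part `(0, 1) × ∂ω_i` of the cylinder. -/
def collarInterior (i : Fin D.l) : Set (D.collar i) := {x | x.1.1 ≠ 0}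

theorem mem_frontier_iff (i : Fin D.l) {t : ℝ} (ht : t ∈ Ioo (0 : ℝ) 1)
    (y : UnitSphere (d + 2)) :
    (D.φ i).symm (t • (y : Euc (d + 2))) ∈ frontier D.Ω ↔ y ∈ frontier (D.base i) := by
  have hn : ‖t • (y : Euc (d + 2))‖ = t := by
    rw [norm_smul, norm_eq_of_mem_sphere, mul_one, Real.norm_of_nonneg ht.1.le]
  have htarget : t • (y : Euc (d + 2)) ∈ (D.φ i).target := by
    rw [D.φ_target, mem_ball_zero_iff, hn]; exact ht.2
  have himg : (D.φ i).symm.IsImage (D.φ i '' (D.Ω ∩ (D.φ i).source)) D.Ω := by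
    intro z hz
    constructor
    · intro h
      exact ⟨_, ⟨h, (D.φ i).map_target hz⟩, (D.φ i).right_inv hz⟩
    · rintro ⟨w, ⟨hw, hw'⟩, rfl⟩
      simpa [(D.φ i).left_inv hw'] using hw
  rw [himg.frontier htarget, D.φ_cone]
  -- polar coordinates `(y, t) ↦ t • y` near the point
  let P : UnitSphere (d + 2) × Ioi (0 : ℝ) → Euc (d + 2) :=
    fun q => ((homeomorphUnitSphereProd (Euc (d + 2))).symm q : Euc (d + 2))
  have hP : IsOpenEmbedding P :=
    isOpen_compl_singleton.isOpenEmbedding_subtypeVal.comp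
      (homeomorphUnitSphereProd (Euc (d + 2))).symm.isOpenEmbedding
  have hPval : ∀ q, P q = (q.2 : ℝ) • (q.1 : Euc (d + 2)) := fun q => by simp [P]
  have h1 : t • (y : Euc (d + 2)) = P (y, ⟨t, ht.1⟩) := by simp [hPval]
  set C : Set (Euc (d + 2)) := {z | ∃ r ∈ Ioo (0 : ℝ) 1, ∃ x ∈ D.base i, z = r • (x : Euc (d + 2))}
  have h2 : P ⁻¹' C = D.base i ×ˢ {r : Ioi (0 : ℝ) | (r : ℝ) < 1} := by
    ext ⟨x, r⟩
    constructor
    · rintro ⟨r', hr', x', hx', h⟩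
      have h3 : P (x, r) = P (x', ⟨r', hr'.1⟩) := by rw [h, hPval]
      obtain ⟨rfl, rfl⟩ := Prod.mk.inj (hP.injective h3)
      exact ⟨hx', hr'.2⟩
    · rintro ⟨hx, hr⟩
      exact ⟨r, ⟨r.2, hr⟩, x, hx, hPval _⟩
  have h3 : P (y, ⟨t, ht.1⟩) ∈ frontier C ↔ (y, (⟨t, ht.1⟩ : Ioi (0 : ℝ))) ∈ frontier (P ⁻¹' C) := by
    rw [← hP.isOpenMap.preimage_frontier_eq_frontier_preimage hP.continuous]; rfl
  have hI : IsOpen {r : Ioi (0 : ℝ) | (r : ℝ) < 1} :=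
    isOpen_lt continuous_subtype_val continuous_const
  have ht' : (⟨t, ht.1⟩ : Ioi (0 : ℝ)) ∈ {r : Ioi (0 : ℝ) | (r : ℝ) < 1} := ht.2
  rw [h1, h3, h2, frontier_prod_eq, hI.frontier_eq]
  simp only [mem_union, mem_prod, mem_sdiff]
  constructor
  · rintro (⟨-, -, h⟩ | ⟨h, -⟩)
    · exact absurd ht' h
    · exact h
  · intro h
    exact Or.inr ⟨h, subset_closure ht'⟩

theorem collar_mem_Ioo {i : Fin D.l} (x : D.collarInterior i) : (x.1.1.1 : ℝ) ∈ Ioo (0 : ℝ) 1 :=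
  ⟨NNReal.coe_pos.2 (pos_iff_ne_zero.2 x.2), NNReal.coe_lt_one.2 x.1.2⟩

theorem smul_mem_target {i : Fin D.l} (x : D.collarInterior i) :
    (x.1.1.1 : ℝ) • (x.1.1.2.1 : Euc (d + 2)) ∈ (D.φ i).target := by
  rw [D.φ_target, mem_ball_zero_iff, norm_smul, norm_eq_of_mem_sphere, mul_one,
    Real.norm_of_nonneg (D.collar_mem_Ioo x).1.le]
  exact (D.collar_mem_Ioo x).2

theorem symm_notMem_range {i : Fin D.l} (x : D.collarInterior i) :
    (D.φ i).symm ((x.1.1.1 : ℝ) • (x.1.1.2.1 : Euc (d + 2))) ∉ range D.p := by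
  rintro ⟨j, hj⟩
  have hs := (D.φ i).map_target (D.smul_mem_target x)
  by_cases hij : j = i
  · subst hij
    have h := congrArg (D.φ j) hj
    rw [D.φ_p, (D.φ j).right_inv (D.smul_mem_target x)] at h
    have h' := congrArg norm h
    rw [norm_zero, norm_smul, norm_eq_of_mem_sphere, mul_one,
      Real.norm_of_nonneg (D.collar_mem_Ioo x).1.le] at h'
    exact (D.collar_mem_Ioo x).1.ne h'
  · rw [← hj] at hs
    exact disjoint_left.1 (D.disjoint_charts j i hij) (subset_closure (D.p_mem_source j))
      (subset_closure hs)

/-- The diffeomorphism `(t, y) ↦ φ_i⁻¹ (t y)` of `(0, 1) × ∂ω_i` onto the part of `Ω₀` in the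
domain of `φ_i`. -/
def collarMap (i : Fin D.l) (x : D.collarInterior i) : D.SmoothPart :=
  ⟨(D.φ i).symm ((x.1.1.1 : ℝ) • (x.1.1.2.1 : Euc (d + 2))),
    (D.mem_frontier_iff i (D.collar_mem_Ioo x) x.1.1.2.1).2 x.1.1.2.2, D.symm_notMem_range x⟩

theorem range_collarMap (i : Fin D.l) :
    range (D.collarMap i) = {z : D.SmoothPart | z.1 ∈ (D.φ i).source} := by
  ext z
  constructor
  · rintro ⟨x, rfl⟩
    exact (D.φ i).map_target (D.smul_mem_target x)
  · intro hz
    have hz0 : D.φ i z.1 ≠ 0 := fun h => z.2.2 ⟨i, by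
      rw [← (D.φ i).left_inv (D.p_mem_source i), D.φ_p, ← h, (D.φ i).left_inv hz]⟩
    have hlt : ‖D.φ i z.1‖ < 1 := by
      have := (D.φ i).map_source hz
      rwa [D.φ_target, mem_ball_zero_iff] at this
    have hpos : 0 < ‖D.φ i z.1‖ := norm_pos_iff.2 hz0
    have hy : ‖D.φ i z.1‖⁻¹ • D.φ i z.1 ∈ sphere (0 : Euc (d + 2)) 1 := by
      rw [mem_sphere_zero_iff_norm, norm_smul, norm_inv, norm_norm, inv_mul_cancel₀ hpos.ne']
    have hz' : ‖D.φ i z.1‖ • ((⟨_, hy⟩ : UnitSphere (d + 2)) : Euc (d + 2)) = D.φ i z.1 :=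
      smul_inv_smul₀ hpos.ne' _
    have hfr : (⟨_, hy⟩ : UnitSphere (d + 2)) ∈ frontier (D.base i) := by
      rw [← D.mem_frontier_iff i ⟨hpos, hlt⟩, hz', (D.φ i).left_inv hz]
      exact z.2.1
    refine ⟨⟨⟨(⟨‖D.φ i z.1‖, hpos.le⟩, ⟨_, hfr⟩), ?_⟩, ?_⟩, Subtype.ext ?_⟩
    · exact NNReal.coe_lt_one.1 hlt
    · exact fun h => hpos.ne' (congrArg NNReal.toReal h)
    · show (D.φ i).symm (‖D.φ i z.1‖ • ((⟨_, hy⟩ : UnitSphere (d + 2)) : Euc (d + 2))) = z.1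
      rw [hz', (D.φ i).left_inv hz]

theorem isOpenEmbedding_collarMap (i : Fin D.l) : IsOpenEmbedding (D.collarMap i) := by
  refine ⟨?_, ?_⟩
  · let a : D.collarInterior i → UnitSphere (d + 2) × Ioi (0 : ℝ) :=
      fun x => (x.1.1.2.1, ⟨x.1.1.1, (D.collar_mem_Ioo x).1⟩)
    have ha_cont : Continuous a := by fun_prop
    have ha : IsEmbedding a := by
      have hcoe : IsEmbedding (fun q : ℝ≥0 × D.Link i => ((q.1 : ℝ), (q.2 : UnitSphere (d + 2)))) :=
        IsEmbedding.subtypeVal.prodMap IsEmbedding.subtypeVal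
      have h1 : IsEmbedding (fun x : D.collarInterior i =>
          ((x.1.1.1 : ℝ), (x.1.1.2 : UnitSphere (d + 2)))) :=
        hcoe.comp (IsEmbedding.subtypeVal.comp IsEmbedding.subtypeVal)
      have hg : Continuous (fun q : UnitSphere (d + 2) × Ioi (0 : ℝ) => ((q.2 : ℝ), q.1)) := by
        fun_prop
      exact IsEmbedding.of_comp ha_cont hg h1
    let b : D.collarInterior i → (D.φ i).target :=
      fun x => ⟨(x.1.1.1 : ℝ) • (x.1.1.2.1 : Euc (d + 2)), D.smul_mem_target x⟩
    have hb_cont : Continuous b := by fun_prop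
    have hb : IsEmbedding b := by
      have h1 : IsEmbedding (fun x => ((homeomorphUnitSphereProd (Euc (d + 2))).symm (a x)
          : Euc (d + 2))) :=
        IsEmbedding.subtypeVal.comp
          ((homeomorphUnitSphereProd (Euc (d + 2))).symm.isEmbedding.comp ha)
      have h2 : (fun x => ((homeomorphUnitSphereProd (Euc (d + 2))).symm (a x)
          : Euc (d + 2))) = Subtype.val ∘ b := by
        ext1 x; simp [a, b]
      exact IsEmbedding.of_comp hb_cont continuous_subtype_val (h2 ▸ h1)
    have hc : IsEmbedding (fun x => (((D.φ i).toHomeomorphSourceTarget.symm (b x) :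
        (D.φ i).source) : Euc (d + 2))) :=
      IsEmbedding.subtypeVal.comp ((D.φ i).toHomeomorphSourceTarget.symm.isEmbedding.comp hb)
    have hcont : Continuous (D.collarMap i) := by
      refine Continuous.subtype_mk ?_ _
      exact hc.continuous
    exact IsEmbedding.of_comp hcont continuous_subtype_val hc
  · rw [D.range_collarMap]
    exact (D.φ i).open_source.preimage continuous_subtype_val

theorem isOpen_collarInterior (i : Fin D.l) : IsOpen (D.collarInterior i) :=
  isOpen_ne.preimage (continuous_fst.comp continuous_subtype_val)

/-- The desingularized boundary
`M = (⊔ i, [0, 1) × ∂ω_i) ∪_φ Ω₀`. -/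
abbrev DesingBoundary : Type := Glue D.collarInterior D.collarMap

/-- The groupoid `ℋ × (∂ω_i)²` over `[0, ∞) × ∂ω_i`. -/
abbrev coneGroupoid (i : Fin D.l) :
    GroupoidOn ((ℝ≥0 × PosReal) × (D.Link i × D.Link i)) (ℝ≥0 × D.Link i) :=
  dilationGroupoid.prod (GroupoidOn.pair (D.Link i))

theorem continuous_coneGroupoid_d (i : Fin D.l) : Continuous (D.coneGroupoid i).d := by
  have h : Continuous fun q : (ℝ≥0 × PosReal) × (D.Link i × D.Link i) =>
      (q.1.1 * PosReal.toNNReal q.1.2⁻¹, q.2.2) := by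
    refine Continuous.prodMk (continuous_fst.fst.mul (Continuous.subtype_mk ?_ _)) (by fun_prop)
    show Continuous fun q : (ℝ≥0 × PosReal) × (D.Link i × D.Link i) => (q.1.2.1 : ℝ)⁻¹
    exact Continuous.inv₀ (by fun_prop) fun q => q.1.2.2.ne'
  exact h

theorem continuous_coneGroupoid_r (i : Fin D.l) : Continuous (D.coneGroupoid i).r := by
  show Continuous fun q : (ℝ≥0 × PosReal) × (D.Link i × D.Link i) => (q.1.1, q.2.1)
  fun_prop

/-- The arrows of `𝒥_i`, as an open set of arrows of `ℋ × (∂ω_i)²`. -/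
def collarArrows (i : Fin D.l) :
    TopologicalSpace.Opens ((ℝ≥0 × PosReal) × (D.Link i × D.Link i)) where
  carrier := (D.coneGroupoid i).arrowsOver (D.collar i)
  is_open' := ((D.collar i).isOpen.preimage (D.continuous_coneGroupoid_r i)).inter
    ((D.collar i).isOpen.preimage (D.continuous_coneGroupoid_d i))

/-- The groupoid `𝒥_i`: the reduction of `ℋ × (∂ω_i)²` to `[0, 1) × ∂ω_i`. -/
def collarGroupoid (i : Fin D.l) : GroupoidOn (D.collarArrows i) (D.collar i) :=
  (D.coneGroupoid i).reduction (D.collar i)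

theorem collarInterior_invariant (i : Fin D.l) (g : D.collarArrows i) :
    (D.collarGroupoid i).r g ∈ D.collarInterior i ↔
      (D.collarGroupoid i).d g ∈ D.collarInterior i := by
  show g.1.1.1 ≠ 0 ↔ g.1.1.1 * PosReal.toNNReal g.1.1.2⁻¹ ≠ 0
  have h : PosReal.toNNReal g.1.1.2⁻¹ ≠ 0 := fun h =>
    (g.1.1.2⁻¹).2.ne' (congrArg NNReal.toReal h)
  simp [h]

/-- The arrows of the layer potentials groupoid,
`𝒢 = (⊔ i, 𝒥_i) ∪_φ (Ω₀ × Ω₀)`. -/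
abbrev LayerArrows : Type := GlueArrows D.collarGroupoid D.collarInterior D.collarMap

theorem mul_toNNReal_div (s t : ℝ≥0) (hs : 0 < (s : ℝ)) (ht : 0 < (t : ℝ)) :
    s * PosReal.toNNReal (⟨s / t, div_pos hs ht⟩ : PosReal)⁻¹ = t :=
  NNReal.eq (by
    show (s : ℝ) * ((s : ℝ) / t)⁻¹ = t
    field_simp)

theorem div_mul_inv_toNNReal (s : ℝ≥0) (a : PosReal) (hs : 0 < (s : ℝ)) :
    (s : ℝ) / (s * PosReal.toNNReal a⁻¹ : ℝ≥0) = a.1 := by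
  show (s : ℝ) / (s * (a.1)⁻¹) = a.1
  have := a.2.ne'
  field_simp

/-- The homeomorphism `g ↦ (r g, d g)` of the arrows of `𝒥_i` over `(0, 1) × ∂ω_i` with the pair
groupoid of `(0, 1) × ∂ω_i`. -/
def collarPair (i : Fin D.l) :
    (D.collarGroupoid i).arrowsOver (D.collarInterior i) ≃ₜ
      D.collarInterior i × D.collarInterior i where
  toFun g := (⟨(D.collarGroupoid i).r g.1, g.2.1⟩, ⟨(D.collarGroupoid i).d g.1, g.2.2⟩)
  invFun q :=
    have hd : (D.coneGroupoid i).d ((q.1.1.1.1, ⟨(q.1.1.1.1 : ℝ) / q.2.1.1.1,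
        div_pos (D.collar_mem_Ioo q.1).1 (D.collar_mem_Ioo q.2).1⟩), (q.1.1.1.2, q.2.1.1.2)) =
        q.2.1.1 := Prod.ext (mul_toNNReal_div _ _ (D.collar_mem_Ioo q.1).1
          (D.collar_mem_Ioo q.2).1) rfl
    ⟨⟨((q.1.1.1.1, ⟨(q.1.1.1.1 : ℝ) / q.2.1.1.1,
        div_pos (D.collar_mem_Ioo q.1).1 (D.collar_mem_Ioo q.2).1⟩), (q.1.1.1.2, q.2.1.1.2)),
      q.1.1.2, mem_of_eq_of_mem hd q.2.1.2⟩, q.1.2,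
      mem_of_eq_of_mem (Subtype.ext hd : (_ : D.collar i) = q.2.1) q.2.2⟩
  left_inv g := by
    refine Subtype.ext (Subtype.ext (Prod.ext (Prod.ext rfl (Subtype.ext ?_)) rfl))
    exact div_mul_inv_toNNReal _ _ (NNReal.coe_pos.2 (pos_iff_ne_zero.2 g.2.1))
  right_inv q := by
    refine Prod.ext rfl (Subtype.ext (Subtype.ext (Prod.ext ?_ rfl)))
    exact mul_toNNReal_div _ _ (D.collar_mem_Ioo q.1).1 (D.collar_mem_Ioo q.2).1
  continuous_toFun :=
    ((((D.continuous_coneGroupoid_r i).comp (continuous_subtype_val.comp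
      continuous_subtype_val)).subtype_mk fun g => g.1.2.1).subtype_mk _).prodMk
    ((((D.continuous_coneGroupoid_d i).comp (continuous_subtype_val.comp
      continuous_subtype_val)).subtype_mk fun g => g.1.2.2).subtype_mk _)
  continuous_invFun := by
    refine Continuous.subtype_mk (Continuous.subtype_mk ?_ _) _
    refine Continuous.prodMk (Continuous.prodMk (by fun_prop) (Continuous.subtype_mk ?_ _))
      (by fun_prop)
    exact Continuous.div (by fun_prop) (by fun_prop) fun q => (D.collar_mem_Ioo q.2).1.ne'

theorem isOpen_arrowsOver (i : Fin D.l) :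
    IsOpen ((D.collarGroupoid i).arrowsOver (D.collarInterior i)) :=
  ((D.isOpen_collarInterior i).preimage (((D.continuous_coneGroupoid_r i).comp
    continuous_subtype_val).subtype_mk fun g => g.2.1)).inter
  ((D.isOpen_collarInterior i).preimage (((D.continuous_coneGroupoid_d i).comp
    continuous_subtype_val).subtype_mk fun g => g.2.2))

theorem isOpenEmbedding_arrowMap (i : Fin D.l) :
    IsOpenEmbedding (arrowMap D.collarGroupoid D.collarInterior D.collarMap i) :=
  ((D.isOpenEmbedding_collarMap i).prodMap (D.isOpenEmbedding_collarMap i)).comp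
    (D.collarPair i).isOpenEmbedding

/-- The space `[0, ∞) × ℝ^d` in which the charts of `M` take their values. -/
abbrev UnitModel (d : ℕ) : Type := ModelProd ℝ≥0 (Euc d)

/-- The model with corners of `M`. -/
abbrev unitModel (d : ℕ) : ModelWithCorners ℝ (ℝ × Euc d) (UnitModel d) :=
  halfLineModel.prod (𝓡 d)

/-- The space `([0, ∞) × ℝ) × (ℝ^d × ℝ^d)` in which the charts of `𝒢` take their values. -/
abbrev ArrowModel (d : ℕ) : Type := ModelProd (ModelProd ℝ≥0 ℝ) (ModelProd (Euc d) (Euc d))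

/-- The model with corners of `𝒢`. -/
abbrev arrowModel (d : ℕ) :
    ModelWithCorners ℝ ((ℝ × ℝ) × (Euc d × Euc d)) (ArrowModel d) :=
  (halfLineModel.prod 𝓘(ℝ, ℝ)).prod ((𝓡 d).prod (𝓡 d))

/-- The open embedding of `ℝ × ℝ^d` in `[0, ∞) × ℝ^d` given by `exp` on the first coordinate. -/
def unitEmbedding (d : ℕ) : OpenPartialHomeomorph (ℝ × Euc d) (UnitModel d) :=
  expEmbedding.prod (OpenPartialHomeomorph.refl (Euc d))

/-- The open embedding `((a, v), (b, w)) ↦ ((exp a, b), (v, w))`. -/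
def arrowEmbedding (d : ℕ) :
    OpenPartialHomeomorph (ModelProd (ℝ × Euc d) (ℝ × Euc d)) (ArrowModel d) :=
  (Homeomorph.prodProdProdComm ℝ (Euc d) ℝ (Euc d)).toOpenPartialHomeomorph.trans
    ((expEmbedding.prod (OpenPartialHomeomorph.refl ℝ)).prod
      (OpenPartialHomeomorph.refl (Euc d × Euc d)))

theorem unitEmbedding_source (d : ℕ) : (unitEmbedding d).source = univ := by
  simp [unitEmbedding, expEmbedding]

theorem arrowEmbedding_source (d : ℕ) : (arrowEmbedding d).source = univ := by
  simp [arrowEmbedding, expEmbedding]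

/-- The smooth structure of `M`, given by the charts of `[0, 1) × ∂ω_i` and of `Ω₀`. -/
instance : ChartedSpace (UnitModel d) D.DesingBoundary :=
  Glue.chartedSpace D.collarInterior D.collarMap D.isOpen_collarInterior
    D.isOpenEmbedding_collarMap (unitEmbedding d) (unitEmbedding_source d)

/-- The smooth structure of `𝒢`, given by the charts of `𝒥_i` and of `Ω₀ × Ω₀`. -/
instance : ChartedSpace (ArrowModel d) D.LayerArrows :=
  Glue.chartedSpace _ _ D.isOpen_arrowsOver D.isOpenEmbedding_arrowMap (arrowEmbedding d)
    (arrowEmbedding_source d)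

/-- The layer potentials groupoid `𝒢 ⇉ M`. -/
def layerPotentialsGroupoid : GroupoidOn D.LayerArrows D.DesingBoundary :=
  attachEnds D.collarGroupoid D.collarInterior D.collarMap D.collarInterior_invariant

end ConicalDomain

end

-- Over `t > 0` dilations act simply transitively: `(t, a) ↦ (t, t / a)` identifies the action
-- groupoid `ℋ` over `(0, ∞)` with a pair groupoid. This is why `𝒥_i` can be glued with `Ω₀ × Ω₀`,
-- and why only a pair groupoid is seen over `Ω₀`. The set `Ω₀` is dense in `M`, since `(0, y)` is
-- the limit of the points `(t, y)`, `t > 0`.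
--
-- Local action groupoids. The pair groupoid of an additive Lie group `T` is the action groupoid of
-- `T` on itself, through `(v, w) ↦ (v, v - w)`. A chart of `∂ω_i` with values in `T` therefore
-- presents the corresponding part of `𝒥_i` as a reduction of the action of `(0, ∞) × T` on `[0, ∞)
-- × T` (`endReduction`). The same action serves for `Ω₀`, once `exp` has moved the charts of `Ω₀`
-- into the region `t > 0` (`coreReduction`).
--
-- Weak gluing. Two composable arrows involve three units, which may be far apart or in different
-- components and need not lie in one ordinary chart. The remedy is to take `T = ℝ^d × ℤ`: charts
-- with disjoint domains around the three points are sent to different copies of `ℝ^d`, labelled by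
-- `ℤ`, and their union is a single chart with values in a Lie group (`exists_isDiffeo_of_finite`).
-- Two composable arrows are both in `Ω₀ × Ω₀` or both in the same `𝒥_i` (`composable_cases`),
-- because the interior of each collar is invariant; so these two types of chart suffice
-- (`exists_action_of_composable`). The cover consists of all open sets over which such an
-- isomorphism exists.
--
-- Lie groupoid. The gluing maps are polar coordinates followed by `φ_i⁻¹`, hence diffeomorphisms
-- onto their images (`exists_unit_transition`, `exists_arrow_transition`), so the charts of the
-- pieces form a smooth atlas. Smoothness of the structural maps is then tested on each piece. The
-- domain map is tame because it is locally the projection of a product whose other factor has no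
-- boundary (`isTameSubmersion_of_local_projection`). Finally `M` is Hausdorff because `φ_i⁻¹` of a
-- small closed ball is compact: it separates the end at `p_i` from the points of `Ω₀` outside the
-- domain of `φ_i`.

noncomputable section

/-! ### Smooth partial homeomorphisms -/

section Diffeo

variable {E H M E' H' M' E'' H'' M'' F K N F' K' N' : Type*}
  [NormedAddCommGroup E] [NormedSpace ℝ E] [TopologicalSpace H]
  [NormedAddCommGroup E'] [NormedSpace ℝ E'] [TopologicalSpace H']
  [NormedAddCommGroup E''] [NormedSpace ℝ E''] [TopologicalSpace H'']
  [NormedAddCommGroup F] [NormedSpace ℝ F] [TopologicalSpace K]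
  [NormedAddCommGroup F'] [NormedSpace ℝ F'] [TopologicalSpace K']
  {I : ModelWithCorners ℝ E H} {I' : ModelWithCorners ℝ E' H'} {I'' : ModelWithCorners ℝ E'' H''}
  {J : ModelWithCorners ℝ F K} {J' : ModelWithCorners ℝ F' K'}
  [TopologicalSpace M] [ChartedSpace H M] [TopologicalSpace M'] [ChartedSpace H' M']
  [TopologicalSpace M''] [ChartedSpace H'' M'']
  [TopologicalSpace N] [ChartedSpace K N] [TopologicalSpace N'] [ChartedSpace K' N']

/-- The partial homeomorphism `e` is smooth together with its inverse. -/
structure OpenPartialHomeomorph.IsDiffeo (I : ModelWithCorners ℝ E H)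
    (I' : ModelWithCorners ℝ E' H') (e : OpenPartialHomeomorph M M') : Prop where
  smooth : ContMDiffOn I I' ∞ e e.source
  symm_smooth : ContMDiffOn I' I ∞ e.symm e.target

namespace OpenPartialHomeomorph.IsDiffeo

variable {e : OpenPartialHomeomorph M M'} {e' : OpenPartialHomeomorph M' M''}

theorem contMDiffAt (he : e.IsDiffeo I I') {x : M} (hx : x ∈ e.source) : ContMDiffAt I I' ∞ e x :=
  (he.smooth x hx).contMDiffAt (e.open_source.mem_nhds hx)

theorem contMDiffAt_symm (he : e.IsDiffeo I I') {y : M'} (hy : y ∈ e.target) :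
    ContMDiffAt I' I ∞ e.symm y :=
  (he.symm_smooth y hy).contMDiffAt (e.open_target.mem_nhds hy)

theorem symm (he : e.IsDiffeo I I') : e.symm.IsDiffeo I' I :=
  ⟨he.symm_smooth, by simpa using he.smooth⟩

theorem trans (he : e.IsDiffeo I I') (he' : e'.IsDiffeo I' I'') :
    (e.trans e').IsDiffeo I I'' := by
  constructor
  · intro x hx
    rw [OpenPartialHomeomorph.trans_source] at hx
    exact ((he'.contMDiffAt hx.2).comp x (he.contMDiffAt hx.1)).contMDiffWithinAt
  · intro x hx
    rw [OpenPartialHomeomorph.trans_target] at hx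
    exact ((he.contMDiffAt_symm hx.2).comp x (he'.contMDiffAt_symm hx.1)).contMDiffWithinAt

theorem prod {e₁ : OpenPartialHomeomorph N N'} (he : e.IsDiffeo I I') (he₁ : e₁.IsDiffeo J J') :
    (e.prod e₁).IsDiffeo (I.prod J) (I'.prod J') :=
  ⟨he.smooth.prodMap he₁.smooth, he.symm_smooth.prodMap he₁.symm_smooth⟩

theorem restr (he : e.IsDiffeo I I') {s : Set M} (hs : IsOpen s) :
    (e.restrOpen s hs).IsDiffeo I I' := by
  constructor
  · exact he.smooth.mono (by simp)
  · exact he.symm_smooth.mono fun y hy => hy.1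

/-- The inverses agree locally as well: near a point of the target, `e₁.symm` takes its values in
`e.source`, where `e = e₁`. This serves for transition maps whose formula is known only on the
overlap. -/
theorem of_local
    (h : ∀ x ∈ e.source, ∃ e₁ : OpenPartialHomeomorph M M', e₁.IsDiffeo I I' ∧ x ∈ e₁.source ∧
      EqOn e e₁ (e.source ∩ e₁.source)) : e.IsDiffeo I I' := by
  constructor
  · intro x hx
    obtain ⟨e₁, he₁, hx₁, heq⟩ := h x hx
    refine ((he₁.contMDiffAt hx₁).congr_of_eventuallyEq ?_).contMDiffWithinAt
    filter_upwards [(e.open_source.inter e₁.open_source).mem_nhds ⟨hx, hx₁⟩] with z hz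
    exact heq hz
  · intro y hy
    have hx := e.map_target hy
    obtain ⟨e₁, he₁, hx₁, heq⟩ := h _ hx
    have h1 : e₁ (e.symm y) = y := by rw [← heq ⟨hx, hx₁⟩, e.right_inv hy]
    have hy₁ : y ∈ e₁.target := h1 ▸ e₁.map_source hx₁
    have h2 : e₁.symm y = e.symm y := by rw [← h1, e₁.left_inv hx₁, h1]
    refine ((he₁.contMDiffAt_symm hy₁).congr_of_eventuallyEq ?_).contMDiffWithinAt
    have h3 : ∀ᶠ z in 𝓝 y, e₁.symm z ∈ e.source := by
      refine (e₁.continuousAt_symm hy₁).eventually (e.open_source.mem_nhds ?_)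
      rw [h2]; exact hx
    filter_upwards [h3, e₁.open_target.mem_nhds hy₁] with z hz hz₁
    rw [← e.left_inv hz, heq ⟨hz, e₁.map_target hz₁⟩, e₁.right_inv hz₁]

theorem refl : (OpenPartialHomeomorph.refl M).IsDiffeo I I :=
  ⟨contMDiffOn_id, contMDiffOn_id⟩

theorem of_mem_maximalAtlas {e : OpenPartialHomeomorph M H}
    (he : e ∈ IsManifold.maximalAtlas I ∞ M) : e.IsDiffeo I I :=
  ⟨contMDiffOn_of_mem_maximalAtlas he, contMDiffOn_symm_of_mem_maximalAtlas he⟩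

theorem chartAt [IsManifold I ∞ M] (x : M) : (chartAt H x).IsDiffeo I I :=
  of_mem_maximalAtlas (IsManifold.chart_mem_maximalAtlas x)

theorem subtypeCoe (U : TopologicalSpace.Opens M) (hU : Nonempty U) :
    (U.openPartialHomeomorphSubtypeCoe hU).IsDiffeo I I := by
  constructor
  · exact contMDiff_subtype_val.contMDiffOn
  · intro x hx
    rw [← ContMDiffWithinAt.subtypeVal_comp_iff]
    refine contMDiffWithinAt_id.congr ?_ ?_
    · intro y hy
      exact (U.openPartialHomeomorphSubtypeCoe hU).right_inv hy
    · exact (U.openPartialHomeomorphSubtypeCoe hU).right_inv hx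

/-- Smoothness can be tested after a smooth change of variables. -/
theorem contMDiffWithinAt_of_comp (he : e.IsDiffeo I I') {f : M' → N} {s : Set M'} {x : M}
    (hx : x ∈ e.source) (hf : ContMDiffWithinAt I J ∞ (f ∘ e) (e.source ∩ e ⁻¹' s) x) :
    ContMDiffWithinAt I' J ∞ f s (e x) := by
  have hy := e.map_source hx
  have h1 : ContMDiffWithinAt I' J ∞ ((f ∘ e) ∘ e.symm) (s ∩ e.target) (e x) := by
    refine ContMDiffWithinAt.comp (e x) (t := e.source ∩ e ⁻¹' s) ?_
      (he.contMDiffAt_symm hy).contMDiffWithinAt ?_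
    · rwa [e.left_inv hx]
    · intro y hy'
      refine ⟨e.map_target hy'.2, ?_⟩
      rw [mem_preimage, e.right_inv hy'.2]
      exact hy'.1
  have h2 : ContMDiffWithinAt I' J ∞ f (s ∩ e.target) (e x) := by
    refine h1.congr (fun y hy' => ?_) ?_
    · simp [e.right_inv hy'.2]
    · simp [e.left_inv hx]
  exact h2.mono_of_mem_nhdsWithin (Filter.inter_mem self_mem_nhdsWithin
    (mem_nhdsWithin_of_mem_nhds (e.open_target.mem_nhds hy)))

theorem contMDiffAt_of_comp (he : e.IsDiffeo I I') {f : M' → N} {x : M}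
    (hx : x ∈ e.source) (hf : ContMDiffAt I J ∞ (f ∘ e) x) : ContMDiffAt I' J ∞ f (e x) :=
  he.contMDiffWithinAt_of_comp hx hf.contMDiffWithinAt

theorem mdifferentiable (he : e.IsDiffeo I I') : e.MDifferentiable I I' :=
  ⟨he.smooth.mdifferentiableOn (by simp), he.symm_smooth.mdifferentiableOn (by simp)⟩

end OpenPartialHomeomorph.IsDiffeo

/-! ### Inward pointing vectors and tame submersions -/

/-- The velocity of a curve starting in a model corner points into the corner. -/
theorem eventually_add_smul_mem_corner {k : ℕ} (b : Module.Basis (Fin k) ℝ E) (s : Set (Fin k))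
    {γ : ℝ → E} {w : E} {ε : ℝ} (hε : 0 < ε)
    (hγ : ∀ t ∈ Icc 0 ε, γ t ∈ {v | ∀ i ∈ s, 0 ≤ b.repr v i})
    (hw : HasDerivWithinAt γ w (Icc 0 ε) 0) :
    ∃ δ : ℝ, 0 < δ ∧ ∀ t ∈ Icc 0 δ, γ 0 + t • w ∈ {v | ∀ i ∈ s, 0 ≤ b.repr v i} := by
  have : FiniteDimensional ℝ E := b.finiteDimensional_of_finite
  have h : ∀ᶠ t in 𝓝[≥] (0 : ℝ), ∀ i, i ∈ s → 0 ≤ b.repr (γ 0 + t • w) i := by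
    rw [Filter.eventually_all]
    intro i
    by_cases hi : i ∈ s
    swap
    · exact Filter.Eventually.of_forall fun t h => absurd h hi
    let ℓ : E →L[ℝ] ℝ := LinearMap.toContinuousLinearMap (b.coord i)
    have hℓ : ∀ v, ℓ v = b.repr v i := fun v => rfl
    have h0 : 0 ≤ ℓ (γ 0) := hγ 0 ⟨le_rfl, hε.le⟩ i hi
    -- A coordinate that vanishes at time `0` is minimal there, so its derivative is nonnegative; a
    -- coordinate that is positive at time `0` stays positive for a short time by continuity.
    rcases h0.eq_or_lt with h0 | h0
    · have h1 : HasDerivWithinAt (fun t => ℓ (γ t)) (ℓ w) (Icc 0 ε) 0 :=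
        ℓ.hasFDerivAt.comp_hasDerivWithinAt 0 hw
      have h2 : 0 ≤ ℓ w := by
        have h3 : Filter.Tendsto (slope (fun t => ℓ (γ t)) 0) (𝓝[>] 0) (𝓝 (ℓ w)) := by
          have := (hasDerivWithinAt_iff_tendsto_slope.1 h1)
          refine this.mono_left (nhdsWithin_le_of_mem ?_)
          filter_upwards [Ioc_mem_nhdsGT hε] with t ht
          exact ⟨⟨ht.1.le, ht.2⟩, ht.1.ne'⟩
        refine ge_of_tendsto h3 ?_
        filter_upwards [Ioc_mem_nhdsGT hε] with t ht
        rw [slope_def_field, ← h0, sub_zero, sub_zero]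
        exact div_nonneg (hγ t ⟨ht.1.le, ht.2⟩ i hi) ht.1.le
      filter_upwards [self_mem_nhdsWithin] with t ht _
      rw [← hℓ, map_add, ← h0, map_smul, zero_add]
      exact mul_nonneg ht h2
    · have h1 : ContinuousAt (fun t : ℝ => ℓ (γ 0 + t • w)) 0 := by fun_prop
      have h2 : ∀ᶠ t in 𝓝 (0 : ℝ), 0 < ℓ (γ 0 + t • w) :=
        h1.eventually (lt_mem_nhds (by simpa using h0))
      filter_upwards [nhdsWithin_le_nhds h2] with t ht _
      exact ht.le
  obtain ⟨δ, hδ, h'⟩ := mem_nhdsGE_iff_exists_Icc_subset.1 h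
  exact ⟨δ, hδ, fun t ht => h' ht⟩

/-- Read in charts, `f` maps the segment `p + t v` to a curve in the corner of `M'` with initial
velocity `df(v)`, and `eventually_add_smul_mem_corner` applies. Finitely many linear inequalities
are essential here: in a curved convex set a velocity can be tangent to the boundary and point out
of the set. -/
theorem InwardPointing.mfderiv {f : M → M'} {p : M} (hf : MDifferentiableAt I I' f p)
    (hI' : IsCornerModel I') {v : TangentSpace I p} (hv : InwardPointing I p v) :
    InwardPointing I' (f p) (mfderiv I I' f p v) := by
  obtain ⟨ε, hε, hv⟩ := hv
  obtain ⟨k, b, s, hs⟩ := hI'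
  have h1 := hf.hasMFDerivAt.2
  have hline : HasDerivWithinAt (fun t : ℝ => extChartAt I p p + t • (show E from v)) (show E from v)
      (Icc 0 ε) 0 := by
    have := ((hasDerivWithinAt_id (0 : ℝ) (Icc 0 ε)).smul_const (show E from v)).const_add
      (extChartAt I p p)
    rwa [one_smul] at this
  have h2 := HasFDerivWithinAt.comp_hasDerivWithinAt_of_eq (0 : ℝ) h1 hline (fun t ht => hv t ht)
    (by rw [zero_smul, add_zero])
  obtain ⟨δ, hδ, h3⟩ := eventually_add_smul_mem_corner b s hε (γ := writtenInExtChartAt I I' p f ∘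
    fun t : ℝ => extChartAt I p p + t • (show E from v)) (fun t _ => by
      rw [← hs]
      exact mem_range_self _) h2
  refine ⟨δ, hδ, fun t ht => ?_⟩
  have h4 := h3 t ht
  rw [← hs, Function.comp_apply, zero_smul, add_zero] at h4
  simp only [writtenInExtChartAt, Function.comp_apply, extChartAt_to_inv] at h4
  exact h4

/-- A factor without boundary puts no condition on the vector, as its model has full range. -/
theorem inwardPointing_prod_iff [J.Boundaryless] {q : M × N} {w : TangentSpace (I.prod J) q} :
    InwardPointing (I.prod J) q w ↔ InwardPointing I q.1 (show E × F from w).1 := by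
  have h : range (I.prod J) = range I ×ˢ univ := by
    rw [modelWithCorners_prod_coe, range_prodMap, J.range_eq_univ]
  simp only [InwardPointing, extChartAt_prod, h]
  exact exists_congr fun ε => and_congr_right fun _ => forall₂_congr fun t _ =>
    (mem_prod.trans (and_iff_left (mem_univ _)))

/-- A map which is locally the projection of a product with a manifold without boundary is a tame
submersion. -/
theorem isTameSubmersion_of_local_projection {f : M → M'} (hI : IsCornerModel I)
    (hI' : IsCornerModel I') (hf : ContMDiff I I' ∞ f)
    (h : ∀ p : M, ∃ (F K N : Type) (_ : NormedAddCommGroup F) (_ : NormedSpace ℝ F)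
      (_ : TopologicalSpace K) (_ : TopologicalSpace N) (_ : ChartedSpace K N)
      (J : ModelWithCorners ℝ F K) (_ : J.Boundaryless) (e : OpenPartialHomeomorph M (M' × N)),
      p ∈ e.source ∧ e.IsDiffeo I (I'.prod J) ∧ ∀ q ∈ e.source, (e q).1 = f q) :
    IsTameSubmersion I I' f := by
  have key : ∀ p : M, Function.Surjective (mfderiv I I' f p) ∧ ∀ v : TangentSpace I p,
      InwardPointing I' (f p) (mfderiv I I' f p v) → InwardPointing I p v := by
    intro p
    obtain ⟨F, K, N, _, _, _, _, _, J, _, e, hp, he, hef⟩ := h p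
    have hmd := he.mdifferentiable
    have heq : f =ᶠ[𝓝 p] Prod.fst ∘ e := by
      filter_upwards [e.open_source.mem_nhds hp] with q hq
      exact (hef q hq).symm
    have hder : ∀ v : TangentSpace I p, mfderiv I I' f p v =
        (show E' × F from mfderiv I (I'.prod J) e p v).1 := by
      intro v
      rw [heq.mfderiv_eq, mfderiv_comp p mdifferentiableAt_fst (hmd.mdifferentiableAt hp),
        mfderiv_fst]
      rfl
    constructor
    · intro w
      obtain ⟨v, hv⟩ := hmd.mfderiv_surjective hp (show E' × F from (w, 0))
      refine ⟨v, ?_⟩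
      rw [hder, hv]
    · intro v hv
      -- The factor `N` imposes nothing, so `de(v)` is inward pointing as soon as its first
      -- component `df(v)` is. The smooth map `e.symm` then carries this property back to `v`.
      have h1 : InwardPointing (I'.prod J) (e p) (mfderiv I (I'.prod J) e p v) := by
        rw [inwardPointing_prod_iff, ← hder]
        rw [hef p hp]
        exact hv
      have h2 := InwardPointing.mfderiv (hmd.mdifferentiableAt_symm (e.map_source hp)) hI h1
      have h3 := DFunLike.congr_fun (hmd.symm_comp_deriv hp) v
      -- The base point obtained is `e.symm (e p)`, which is only propositionally equal to `p`;
      -- inward pointing vectors are transported along this equality.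
      have h4 : ∀ q (w w' : E), q = p → w = w' → InwardPointing I q w → InwardPointing I p w' := by
        rintro _ _ _ rfl rfl h; exact h
      exact h4 _ _ _ (e.left_inv hp) h3 h2
  refine ⟨hf, fun p => (key p).1, fun p v => ⟨(key p).2 v, fun hv => ?_⟩⟩
  exact hv.mfderiv ((hf p).mdifferentiableAt (by simp)) hI'

end Diffeo

/-! ### Model corners -/

section Corners

variable {E H F K : Type*} [NormedAddCommGroup E] [NormedSpace ℝ E] [TopologicalSpace H]
  [NormedAddCommGroup F] [NormedSpace ℝ F] [TopologicalSpace K]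

theorem IsCornerModel.of_boundaryless [FiniteDimensional ℝ E] (I : ModelWithCorners ℝ E H)
    [I.Boundaryless] : IsCornerModel I :=
  ⟨_, Module.finBasis ℝ E, ∅, by simp [I.range_eq_univ]⟩

theorem IsCornerModel.prod {I : ModelWithCorners ℝ E H} {J : ModelWithCorners ℝ F K}
    (hI : IsCornerModel I) (hJ : IsCornerModel J) : IsCornerModel (I.prod J) := by
  obtain ⟨k, b, s, hs⟩ := hI
  obtain ⟨m, c, t, ht⟩ := hJ
  refine ⟨k + m, (b.prod c).reindex finSumFinEquiv, finSumFinEquiv '' (Sum.inl '' s ∪ Sum.inr '' t),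
    ?_⟩
  rw [modelWithCorners_prod_coe, range_prodMap, hs, ht]
  ext ⟨v, w⟩
  simp only [mem_prod, mem_ofPred_eq, forall_mem_image, union_def, or_imp, forall_and,
    Module.Basis.repr_reindex, Finsupp.mapDomain_equiv_apply, Equiv.symm_apply_apply,
    Module.Basis.prod_repr_inl, Module.Basis.prod_repr_inr]

theorem isCornerModel_halfLine : IsCornerModel halfLineModel := by
  refine ⟨1, (Module.Basis.singleton (Fin 1) ℝ), univ, ?_⟩
  ext x
  constructor
  · rintro ⟨y, rfl⟩ i -
    have : (0 : ℝ) ≤ halfLineModel y := y.2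
    simpa using this
  · intro h
    exact ⟨⟨x, by simpa using h 0 trivial⟩, rfl⟩

end Corners

/-! ### Smooth maps to `[0, ∞)` -/

section HalfLine

variable {E H M : Type*} [NormedAddCommGroup E] [NormedSpace ℝ E] [TopologicalSpace H]
  {I : ModelWithCorners ℝ E H} [TopologicalSpace M] [ChartedSpace H M]

/-- The extended chart of `ℝ≥0` is the coercion to `ℝ`, so both sides concern the same function in
coordinates. Only continuity has to be compared, and `ℝ≥0` has the topology induced from `ℝ`. -/
theorem contMDiffWithinAt_nnreal_iff {f : M → ℝ≥0} {s : Set M} {x : M} :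
    ContMDiffWithinAt I halfLineModel ∞ f s x ↔
      ContMDiffWithinAt I 𝓘(ℝ, ℝ) ∞ (fun y => (f y : ℝ)) s x := by
  rw [contMDiffWithinAt_iff, contMDiffWithinAt_iff]
  refine and_congr ?_ Iff.rfl
  exact NNReal.isEmbedding_coe.isInducing.continuousWithinAt_iff

theorem contMDiffAt_nnreal_iff {f : M → ℝ≥0} {x : M} :
    ContMDiffAt I halfLineModel ∞ f x ↔ ContMDiffAt I 𝓘(ℝ, ℝ) ∞ (fun y => (f y : ℝ)) x :=
  contMDiffWithinAt_nnreal_iff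

theorem contMDiff_nnreal_coe : ContMDiff halfLineModel 𝓘(ℝ, ℝ) ∞ ((↑) : ℝ≥0 → ℝ) :=
  fun _ => contMDiffAt_nnreal_iff.1 contMDiffAt_id

theorem contMDiffAt_posReal_iff {f : M → PosReal} {x : M} :
    ContMDiffAt I 𝓘(ℝ, ℝ) ∞ f x ↔ ContMDiffAt I 𝓘(ℝ, ℝ) ∞ (fun y => (f y : ℝ)) x :=
  (ContMDiffAt.subtypeVal_comp_iff (⟨Ioi 0, isOpen_Ioi⟩ : TopologicalSpace.Opens ℝ) f x).symm

theorem contMDiff_posReal_coe : ContMDiff 𝓘(ℝ, ℝ) 𝓘(ℝ, ℝ) ∞ (Subtype.val : PosReal → ℝ) :=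
  fun _ => contMDiffAt_posReal_iff.1 contMDiffAt_id

theorem expEmbedding_isDiffeo : expEmbedding.IsDiffeo 𝓘(ℝ, ℝ) halfLineModel := by
  constructor
  · intro x _
    rw [contMDiffWithinAt_nnreal_iff]
    exact Real.contDiff_exp.contMDiff.contMDiffAt.contMDiffWithinAt
  · intro x hx
    have h1 : ContMDiffAt 𝓘(ℝ, ℝ) 𝓘(ℝ, ℝ) ∞ Real.log (x : ℝ) :=
      (Real.contDiffAt_log.2 (NNReal.coe_ne_zero.2 hx)).contMDiffAt
    exact (h1.comp x (contMDiff_nnreal_coe x)).contMDiffWithinAt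

end HalfLine

/-! ### The smooth structure of a glued space -/

namespace Glue

section Topology

variable {ι : Type} {X : ι → Type} {Y : Type} {U : ∀ i, Set (X i)} {f : ∀ i, U i → Y}
  [∀ i, TopologicalSpace (X i)] [TopologicalSpace Y]

theorem secondCountableTopology [Countable ι] (hU : ∀ i, IsOpen (U i))
    (hf : ∀ i, IsOpenEmbedding (f i)) [∀ i, SecondCountableTopology (X i)]
    [SecondCountableTopology Y] : SecondCountableTopology (Glue U f) := by
  let V : Option ι → Set (Glue U f) := fun o => o.elim (range (core U f)) fun i => range (piece U f i)
  have hV : ∀ o, IsOpen (V o) := by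
    rintro (_ | i)
    · exact (isOpenEmbedding_core U f hU hf).isOpen_range
    · exact (isOpenEmbedding_piece U f hU hf i).isOpen_range
  have (o : Option ι) : SecondCountableTopology (V o) := by
    rcases o with _ | i
    · exact (isOpenEmbedding_core U f hU hf).isEmbedding.toHomeomorph.symm.secondCountableTopology
    · exact (isOpenEmbedding_piece U f hU hf i).isEmbedding.toHomeomorph.symm.secondCountableTopology
  refine TopologicalSpace.secondCountableTopology_of_countable_cover hV ?_
  refine eq_univ_of_forall fun z => mem_iUnion.2 ?_
  rcases cases_on U f z with ⟨y, rfl⟩ | ⟨i, x, -, rfl⟩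
  · exact ⟨none, y, rfl⟩
  · exact ⟨some i, x, rfl⟩

/-- A glued space is Hausdorff if its pieces are, if points of different pieces can be separated,
and if each point of a piece can be separated from the points of the core outside of the piece. -/
theorem t2Space (hU : ∀ i, IsOpen (U i)) (hf : ∀ i, IsOpenEmbedding (f i)) [∀ i, T2Space (X i)]
    [T2Space Y]
    (h₁ : ∀ i j, i ≠ j → Disjoint (range (f i)) (range (f j)))
    (h₂ : ∀ i, ∀ x ∉ U i, ∀ y ∉ range (f i), ∃ s : Set (X i), IsOpen s ∧ x ∈ s ∧
      ∃ t : Set Y, IsOpen t ∧ y ∈ t ∧ Disjoint (f i '' (Subtype.val ⁻¹' s)) t) :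
    T2Space (Glue U f) := by
  have hc := isOpenEmbedding_core U f hU hf
  have hp := isOpenEmbedding_piece U f hU hf
  have hsep : ∀ {Z : Type} [TopologicalSpace Z] [T2Space Z] (F : Z → Glue U f)
      (hF : IsOpenEmbedding F) (a b : Z), F a ≠ F b → SeparatedNhds {F a} {F b} := by
    intro Z _ _ F hF a b hab
    obtain ⟨s, t, hs, ht, has, hbt, hst⟩ := t2_separation (fun h => hab (congrArg F h) : a ≠ b)
    exact ⟨F '' s, F '' t, hF.isOpenMap s hs, hF.isOpenMap t ht,
      singleton_subset_iff.2 (mem_image_of_mem F has),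
      singleton_subset_iff.2 (mem_image_of_mem F hbt), (disjoint_image_iff hF.injective).2 hst⟩
  have hpc : ∀ i, ∀ x ∉ U i, ∀ y, SeparatedNhds {piece U f i x} {core U f y} := by
    intro i x hx y
    -- A point of the core that is glued to `X i` is separated inside the Hausdorff open piece; `h₂`
    -- deals with the other points.
    by_cases hy : y ∈ range (f i)
    · obtain ⟨x', rfl⟩ := hy
      rw [← glue]
      refine hsep _ (hp i) x x' fun h => hx ?_
      rw [(hp i).injective h]
      exact x'.2
    · obtain ⟨s, hs, hxs, t, ht, hyt, hst⟩ := h₂ i x hx y hy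
      refine ⟨_, _, (hp i).isOpenMap s hs, hc.isOpenMap t ht,
        singleton_subset_iff.2 (mem_image_of_mem _ hxs),
        singleton_subset_iff.2 (mem_image_of_mem _ hyt), disjoint_left.2 ?_⟩
      rintro _ ⟨x', hx', rfl⟩ ⟨y', hy', h⟩
      obtain ⟨hxU, rfl⟩ := piece_eq_core U f h.symm
      exact disjoint_left.1 hst ⟨⟨x', hxU⟩, hx', rfl⟩ hy'
  have key : ∀ a b : Glue U f, a ≠ b → SeparatedNhds {a} {b} := by
    intro a b hab
    rcases cases_on U f a with ⟨y, rfl⟩ | ⟨i, x, hx, rfl⟩ <;>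
      rcases cases_on U f b with ⟨y', rfl⟩ | ⟨j, x', hx', rfl⟩
    · exact hsep _ hc y y' hab
    · exact (hpc j x' hx' y).symm
    · exact hpc i x hx y'
    · by_cases hij : i = j
      · subst hij
        exact hsep _ (hp i) x x' hab
      · refine ⟨_, _, (hp i).isOpen_range, (hp j).isOpen_range,
          singleton_subset_iff.2 (mem_range_self _), singleton_subset_iff.2 (mem_range_self _),
          disjoint_left.2 ?_⟩
        rintro _ ⟨u, rfl⟩ ⟨v, hv⟩
        -- A common point of two different pieces can only come from the core, hence from both
        -- `range (f i)` and `range (f j)`, which are disjoint.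
        by_cases hu : u ∈ U i
        · have h3 := hv.trans (glue U f i ⟨u, hu⟩)
          obtain ⟨hvU, h4⟩ := piece_eq_core U f h3
          exact disjoint_left.1 (h₁ i j hij) ⟨_, rfl⟩ ⟨_, h4⟩
        · exact hij (congrArg Sigma.fst (piece_eq_piece U f hu hv.symm))
  refine ⟨fun a b hab => ?_⟩
  obtain ⟨s, t, hs, ht, h1, h2, h3⟩ := key a b hab
  exact ⟨s, t, hs, ht, h1 rfl, h2 rfl, h3⟩

end Topology

section Smooth

variable {ι : Type} {X : ι → Type} {Y : Type} {U : ∀ i, Set (X i)} {f : ∀ i, U i → Y}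
  [∀ i, TopologicalSpace (X i)] [TopologicalSpace Y]
  (hU : ∀ i, IsOpen (U i)) (hf : ∀ i, IsOpenEmbedding (f i))

/-- The canonical map `X i → Glue U f` as a partial homeomorphism. -/
def pieceHomeo (i : ι) [Nonempty (X i)] : OpenPartialHomeomorph (X i) (Glue U f) :=
  (isOpenEmbedding_piece U f hU hf i).toOpenPartialHomeomorph _

/-- The canonical map `Y → Glue U f` as a partial homeomorphism. -/
def coreHomeo [Nonempty Y] : OpenPartialHomeomorph Y (Glue U f) :=
  (isOpenEmbedding_core U f hU hf).toOpenPartialHomeomorph _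

@[simp] theorem pieceHomeo_source (i : ι) [Nonempty (X i)] :
    (pieceHomeo hU hf i).source = univ := rfl

theorem pieceHomeo_target (i : ι) [Nonempty (X i)] :
    (pieceHomeo hU hf i).target = range (piece U f i) := by simp [pieceHomeo]

theorem coreHomeo_target [Nonempty Y] :
    (coreHomeo hU hf).target = range (core U f) := by simp [coreHomeo]

@[simp] theorem pieceHomeo_symm_apply (i : ι) [Nonempty (X i)] (x : X i) :
    (pieceHomeo hU hf i).symm (piece U f i x) = x :=
  (pieceHomeo hU hf i).left_inv (mem_univ x)

@[simp] theorem coreHomeo_symm_apply [Nonempty Y] (y : Y) :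
    (coreHomeo hU hf).symm (core U f y) = y :=
  (coreHomeo hU hf).left_inv (mem_univ y)

variable {E E₀ H H₀ : Type} [NormedAddCommGroup E] [NormedSpace ℝ E] [NormedAddCommGroup E₀]
  [NormedSpace ℝ E₀] [TopologicalSpace H] [TopologicalSpace H₀]
  {I : ModelWithCorners ℝ E H} {I₀ : ModelWithCorners ℝ E₀ H₀}
  [∀ i, ChartedSpace H (X i)] [ChartedSpace H₀ Y]

section Transition

-- The gluing maps are required to be diffeomorphisms onto their images. The point `x` provides the
-- inhabitants needed to extend `f i` to a total function on `X i`, and a total inverse; when `U i`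
-- is empty nothing is required.
variable (hg : ∀ i, ∀ x : U i, ∃ g : OpenPartialHomeomorph (X i) Y, g.source = U i ∧
  (∀ x : U i, g x = f i x) ∧ g.IsDiffeo I I₀)

include hg

theorem isDiffeo_piece_core (i : ι) [Nonempty (X i)] [Nonempty Y] :
    ((pieceHomeo hU hf i).trans (coreHomeo hU hf).symm).IsDiffeo I I₀ := by
  refine .of_local fun x hx => ?_
  simp only [OpenPartialHomeomorph.trans_source, pieceHomeo_source, univ_inter, mem_preimage,
    OpenPartialHomeomorph.symm_source, coreHomeo_target] at hx
  obtain ⟨y, hy⟩ := hx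
  obtain ⟨hxU, rfl⟩ := piece_eq_core U f hy.symm
  obtain ⟨g, hgs, hgf, hgd⟩ := hg i ⟨x, hxU⟩
  refine ⟨g, hgd, hgs ▸ hxU, ?_⟩
  rintro z ⟨-, hz⟩
  rw [hgs] at hz
  show (coreHomeo hU hf).symm (piece U f i z) = g z
  rw [show piece U f i z = _ from glue U f i ⟨z, hz⟩, coreHomeo_symm_apply]
  exact (hgf ⟨z, hz⟩).symm

/-- For `i ≠ j` the two pieces meet only inside the core, so the transition is `f i` followed by the
inverse of `f j`. -/
theorem isDiffeo_piece_piece (i j : ι) [Nonempty (X i)] [Nonempty (X j)] :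
    ((pieceHomeo hU hf i).trans (pieceHomeo hU hf j).symm).IsDiffeo I I := by
  refine .of_local fun x hx => ?_
  by_cases hij : i = j
  · subst hij
    exact ⟨.refl _, .refl, mem_univ _, fun z _ => pieceHomeo_symm_apply hU hf i z⟩
  simp only [OpenPartialHomeomorph.trans_source, pieceHomeo_source, univ_inter, mem_preimage,
    OpenPartialHomeomorph.symm_source, pieceHomeo_target] at hx
  obtain ⟨x', hx'⟩ := hx
  change piece U f j x' = piece U f i x at hx'
  by_cases hxU : x ∈ U i
  swap
  · exact absurd (congrArg Sigma.fst (piece_eq_piece U f hxU hx'.symm)) hij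
  obtain ⟨hxj, h1⟩ := piece_eq_core U f (hx'.trans (glue U f i ⟨x, hxU⟩))
  obtain ⟨g, hgs, hgf, hgd⟩ := hg i ⟨x, hxU⟩
  obtain ⟨g', hgs', hgf', hgd'⟩ := hg j ⟨x', hxj⟩
  refine ⟨g.trans g'.symm, hgd.trans hgd'.symm, ?_, ?_⟩
  · rw [OpenPartialHomeomorph.trans_source]
    refine ⟨hgs ▸ hxU, ?_⟩
    rw [mem_preimage, hgf ⟨x, hxU⟩, ← h1, ← hgf' ⟨x', hxj⟩]
    exact g'.map_source (mem_of_mem_of_subset hxj hgs'.ge)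
  · rintro z ⟨-, hz⟩
    rw [OpenPartialHomeomorph.trans_source, hgs] at hz
    have hz' := g'.map_target hz.2
    rw [hgs'] at hz'
    show (pieceHomeo hU hf j).symm (piece U f i z) = g'.symm (g z)
    have h2 : piece U f i z = piece U f j (g'.symm (g z)) := by
      rw [show piece U f i z = _ from glue U f i ⟨z, hz.1⟩, ← hgf ⟨z, hz.1⟩,
        show piece U f j (g'.symm (g z)) = _ from glue U f j ⟨_, hz'⟩, ← hgf' ⟨_, hz'⟩]
      exact congrArg _ (g'.right_inv hz.2).symm
    rw [h2, pieceHomeo_symm_apply]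

variable [∀ i, IsManifold I ∞ (X i)] [IsManifold I₀ ∞ Y] {k : OpenPartialHomeomorph H₀ H}
  (hk : k.IsDiffeo I₀ I) [ChartedSpace H (Glue U f)]
  (hatlas : atlas H (Glue U f) = {e | (∃ i x, e = pieceChart U f hU hf i x) ∨
    ∃ y, e = coreChart U f hU hf k y})

include hk hatlas

/-- Every chart of the atlas is the inverse of a canonical inclusion followed by a smooth chart of a
piece, or of the core. A change of charts is thus a transition between pieces framed by smooth
charts. -/
theorem isManifold : IsManifold I ∞ (Glue U f) := by
  have hpc := isDiffeo_piece_core hU hf hg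
  have hpp := isDiffeo_piece_piece hU hf hg
  have key : ∀ e ∈ atlas H (Glue U f), ∀ e' ∈ atlas H (Glue U f),
      (e.symm.trans e').IsDiffeo I I := by
    intro e he e' he'
    rw [hatlas] at he he'
    rcases he with ⟨i, x, rfl⟩ | ⟨y, rfl⟩ <;> rcases he' with ⟨j, x', rfl⟩ | ⟨y', rfl⟩
    · have : Nonempty (X i) := ⟨x⟩
      have : Nonempty (X j) := ⟨x'⟩
      have := ((OpenPartialHomeomorph.IsDiffeo.chartAt (I := I) x).symm.trans (hpp i j)).trans
        (.chartAt (I := I) x')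
      simpa [pieceChart, OpenPartialHomeomorph.trans_assoc,
        OpenPartialHomeomorph.trans_symm_eq_symm_trans_symm, pieceHomeo] using this
    · have : Nonempty (X i) := ⟨x⟩
      have : Nonempty Y := ⟨y'⟩
      have := ((OpenPartialHomeomorph.IsDiffeo.chartAt (I := I) x).symm.trans (hpc i)).trans
        ((OpenPartialHomeomorph.IsDiffeo.chartAt (I := I₀) y').trans hk)
      simpa [pieceChart, coreChart, OpenPartialHomeomorph.trans_assoc,
        OpenPartialHomeomorph.trans_symm_eq_symm_trans_symm, pieceHomeo, coreHomeo]
        using this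
    · have : Nonempty Y := ⟨y⟩
      have : Nonempty (X j) := ⟨x'⟩
      have := (((OpenPartialHomeomorph.IsDiffeo.chartAt (I := I₀) y).trans hk).symm.trans
        (hpc j).symm).trans (.chartAt (I := I) x')
      simpa [pieceChart, coreChart, OpenPartialHomeomorph.trans_assoc,
        OpenPartialHomeomorph.trans_symm_eq_symm_trans_symm, pieceHomeo, coreHomeo]
        using this
    · have : Nonempty Y := ⟨y⟩
      -- The transition from the core to itself is the identity.
      have h1 : ((coreHomeo hU hf).trans (coreHomeo hU hf).symm).IsDiffeo I₀ I₀ :=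
        .of_local fun z _ => ⟨.refl _, .refl, mem_univ _, fun z _ => coreHomeo_symm_apply hU hf z⟩
      have := (((OpenPartialHomeomorph.IsDiffeo.chartAt (I := I₀) y).trans hk).symm.trans
        h1).trans ((OpenPartialHomeomorph.IsDiffeo.chartAt (I := I₀) y').trans hk)
      simpa [pieceChart, coreChart, OpenPartialHomeomorph.trans_assoc,
        OpenPartialHomeomorph.trans_symm_eq_symm_trans_symm, pieceHomeo, coreHomeo]
        using this
  refine isManifold_of_contDiffOn I ∞ _ fun e e' he he' => ?_
  rw [← contMDiffOn_iff_contDiffOn]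
  refine I.contMDiff.comp_contMDiffOn ((key e he e' he').smooth.comp
    (I.contMDiffOn_symm.mono inter_subset_right) fun z hz => hz.1)

/-- Near `x` the inclusion is the chart of `X i` at `x` followed by the inverse of the chart of the
glued space built from it. -/
theorem pieceHomeo_isDiffeo (i : ι) [Nonempty (X i)] : (pieceHomeo hU hf i).IsDiffeo I I := by
  have := isManifold hU hf hg hk hatlas
  refine .of_local fun x _ => ?_
  have hmem : pieceChart U f hU hf i x ∈ atlas H (Glue U f) := by
    rw [hatlas]
    exact Or.inl ⟨i, x, rfl⟩
  refine ⟨(chartAt H x).trans (pieceChart U f hU hf i x).symm,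
    (OpenPartialHomeomorph.IsDiffeo.chartAt x).trans
      (.symm (.of_mem_maximalAtlas (StructureGroupoid.subset_maximalAtlas _ hmem))), ?_, ?_⟩
  · simp [pieceChart]
  · rintro z ⟨-, hz⟩
    rw [OpenPartialHomeomorph.trans_source] at hz
    show piece U f i z = piece U f i ((chartAt H x).symm (chartAt H x z))
    rw [(chartAt H x).left_inv hz.1]

theorem coreHomeo_isDiffeo (hks : k.source = univ) [Nonempty Y] :
    (coreHomeo hU hf).IsDiffeo I₀ I := by
  have := isManifold hU hf hg hk hatlas
  refine .of_local fun y _ => ?_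
  have hmem : coreChart U f hU hf k y ∈ atlas H (Glue U f) := by
    rw [hatlas]
    exact Or.inr ⟨y, rfl⟩
  refine ⟨((chartAt H₀ y).trans k).trans (coreChart U f hU hf k y).symm,
    ((OpenPartialHomeomorph.IsDiffeo.chartAt y).trans hk).trans
      (.symm (.of_mem_maximalAtlas (StructureGroupoid.subset_maximalAtlas _ hmem))), ?_, ?_⟩
  · simp [coreChart, hks]
  · rintro z ⟨-, hz⟩
    rw [OpenPartialHomeomorph.trans_source, OpenPartialHomeomorph.trans_source, hks] at hz
    show core U f z = core U f ((chartAt H₀ y).symm (k.symm (k (chartAt H₀ y z))))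
    rw [k.left_inv (hks ▸ mem_univ _), (chartAt H₀ y).left_inv hz.1.1]

end Transition

end Smooth

end Glue

/-! ### Smooth maps to submanifolds and to spheres -/

section Submanifolds

variable {E H M F : Type} [NormedAddCommGroup E] [NormedSpace ℝ E] [TopologicalSpace H]
  {I : ModelWithCorners ℝ E H} [TopologicalSpace M] [ChartedSpace H M]
  [NormedAddCommGroup F] [InnerProductSpace ℝ F]

/-- A map to a submanifold is smooth as soon as it is continuous, and smooth as a map to the
ambient manifold. -/
theorem contMDiffAt_of_isImmersion {E' H' N E'' H'' N' : Type}
    [NormedAddCommGroup E'] [NormedSpace ℝ E'] [TopologicalSpace H']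
    [NormedAddCommGroup E''] [NormedSpace ℝ E''] [TopologicalSpace H'']
    {I' : ModelWithCorners ℝ E' H'} {I'' : ModelWithCorners ℝ E'' H''}
    [TopologicalSpace N] [ChartedSpace H' N] [TopologicalSpace N'] [ChartedSpace H'' N']
    {ψ : N → N'} (hψ : Manifold.IsImmersion I' I'' ∞ ψ) {f : M → N} {x : M}
    (hf : ContinuousAt f x) (h : ContMDiffAt I I'' ∞ (ψ ∘ f) x) : ContMDiffAt I I' ∞ f x :=
  (ContMDiffAt.iff_comp_isImmersionAt (hψ.isImmersionAt (f x))).2 ⟨hf, h⟩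

/-- `ContMDiff.codRestrict_sphere` concerns maps that are smooth everywhere. It is applied on the
open submanifold `s`, and smoothness at a point does not change under restriction to an open set. -/
theorem contMDiffAt_sphere [IsManifold I ∞ M] {n : ℕ} [Fact (Module.finrank ℝ F = n + 1)]
    {f : M → sphere (0 : F) 1} {s : Set M} (hs : IsOpen s)
    (hf : ContMDiffOn I 𝓘(ℝ, F) ∞ (fun y => (f y : F)) s) {x : M} (hx : x ∈ s) :
    ContMDiffAt I (𝓡 n) ∞ f x := by
  let O : TopologicalSpace.Opens M := ⟨s, hs⟩
  have h1 : ContMDiff I 𝓘(ℝ, F) ∞ (fun y : O => (f y : F)) := fun y =>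
    contMDiffAt_subtype_iff (f := fun y => (f y : F)).2 ((hf y y.2).contMDiffAt (hs.mem_nhds y.2))
  have h2 := (h1.codRestrict_sphere (n := n) (fun y => (f y).2)) ⟨x, hx⟩
  exact contMDiffAt_subtype_iff (U := O) (x := ⟨x, hx⟩).1 h2

end Submanifolds

-- Smoothness of the gluing maps of a conical domain

namespace ConicalDomain

variable {d : ℕ} (D : ConicalDomain d)

instance : IsManifold 𝓘(ℝ, ℝ × Euc d) ∞ D.SmoothPart := D.smooth_boundary.choose_spec.1

theorem isImmersion_smoothPart :
    Manifold.IsImmersion 𝓘(ℝ, ℝ × Euc d) 𝓘(ℝ, Euc (d + 2)) ∞ (Subtype.val : D.SmoothPart → _) :=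
  D.smooth_boundary.choose_spec.2.isImmersion

instance (i : Fin D.l) : IsManifold (𝓡 d) ∞ (D.Link i) := (D.base_smooth i).choose_spec.1

theorem isImmersion_link (i : Fin D.l) :
    Manifold.IsImmersion (𝓡 d) (𝓡 (d + 1)) ∞ (Subtype.val : D.Link i → UnitSphere (d + 2)) :=
  (D.base_smooth i).choose_spec.2.isImmersion

instance : IsManifold 𝓘(ℝ, ℝ) ∞ PosReal :=
  inferInstanceAs (IsManifold 𝓘(ℝ, ℝ) ∞ (⟨Ioi 0, isOpen_Ioi⟩ : TopologicalSpace.Opens ℝ))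

theorem contMDiff_coneGroupoid_d (i : Fin D.l) :
    ContMDiff (arrowModel d) (unitModel d) ∞ (D.coneGroupoid i).d := by
  intro q
  refine ContMDiffAt.prodMk ?_ (contMDiffAt_snd.comp q contMDiffAt_snd)
  rw [contMDiffAt_nnreal_iff]
  have h1 : ContMDiffAt (arrowModel d) 𝓘(ℝ, ℝ) ∞ (fun q : (ℝ≥0 × PosReal) × (D.Link i × D.Link i) =>
      (q.1.1 : ℝ)) q := (contMDiff_nnreal_coe _).comp q (contMDiffAt_fst.comp q contMDiffAt_fst)
  have h2 : ContMDiffAt (arrowModel d) 𝓘(ℝ, ℝ) ∞ (fun q : (ℝ≥0 × PosReal) × (D.Link i × D.Link i) =>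
      (q.1.2 : ℝ)) q := (contMDiff_posReal_coe _).comp q (contMDiffAt_snd.comp q contMDiffAt_fst)
  exact h1.mul (h2.inv₀ q.1.2.2.ne')

theorem contMDiff_coneGroupoid_r (i : Fin D.l) :
    ContMDiff (arrowModel d) (unitModel d) ∞ (D.coneGroupoid i).r := fun q =>
  ContMDiffAt.prodMk (contMDiffAt_fst.comp q contMDiffAt_fst)
    (contMDiffAt_fst.comp q contMDiffAt_snd)

theorem contMDiff_collarGroupoid_d (i : Fin D.l) :
    ContMDiff (arrowModel d) (unitModel d) ∞ (D.collarGroupoid i).d := fun g =>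
  (ContMDiffAt.subtypeVal_comp_iff _ _ _).1
    ((D.contMDiff_coneGroupoid_d i).comp contMDiff_subtype_val g)

theorem contMDiff_collarGroupoid_r (i : Fin D.l) :
    ContMDiff (arrowModel d) (unitModel d) ∞ (D.collarGroupoid i).r := fun g =>
  (ContMDiffAt.subtypeVal_comp_iff _ _ _).1
    ((D.contMDiff_coneGroupoid_r i).comp contMDiff_subtype_val g)

/-- An open embedding of an open subset as a partial homeomorphism. -/
theorem _root_.exists_openPartialHomeomorph {X Y : Type} [TopologicalSpace X] [TopologicalSpace Y]
    {U : Set X} (hU : IsOpen U) {f : U → Y} (hf : IsOpenEmbedding f) (x : U) :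
    ∃ g : OpenPartialHomeomorph X Y, g.source = U ∧ g.target = range f ∧ ∀ x : U, g x = f x := by
  have : Nonempty U := ⟨x⟩
  let a := hU.isOpenEmbedding_subtypeVal.toOpenPartialHomeomorph
  refine ⟨a.symm.trans (hf.toOpenPartialHomeomorph f), ?_, ?_, fun z => ?_⟩
  · simp [a]
  · simp [a]
  · show f (a.symm z) = f z
    rw [show a.symm z = z from a.left_inv (mem_univ z)]

/-- The gluing map is `(t, y) ↦ φ_i⁻¹(t y)`, smooth into `ℝⁿ` and hence into the submanifold `Ω₀`.
Its inverse is given by polar coordinates, `t = ‖φ_i w‖` and `y = φ_i w / ‖φ_i w‖`; both are smooth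
because `φ_i w ≠ 0` away from the conical point. -/
theorem exists_unit_transition (i : Fin D.l) (x : D.collarInterior i) :
    ∃ g : OpenPartialHomeomorph (D.collar i) D.SmoothPart, g.source = D.collarInterior i ∧
      (∀ x : D.collarInterior i, g x = D.collarMap i x) ∧
      g.IsDiffeo (unitModel d) 𝓘(ℝ, ℝ × Euc d) := by
  obtain ⟨g, hgs, hgt, hgf⟩ :=
    exists_openPartialHomeomorph (D.isOpen_collarInterior i) (D.isOpenEmbedding_collarMap i) x
  rw [D.range_collarMap] at hgt
  refine ⟨g, hgs, hgf, fun z hz => ContMDiffAt.contMDiffWithinAt ?_,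
    fun z hz => ContMDiffAt.contMDiffWithinAt ?_⟩
  · refine contMDiffAt_of_isImmersion D.isImmersion_smoothPart (g.continuousAt hz) ?_
    have hz' : z ∈ D.collarInterior i := hgs ▸ hz
    have h1 : ContMDiffAt (unitModel d) 𝓘(ℝ, ℝ) ∞ (fun x : D.collar i => (x.1.1 : ℝ)) z :=
      (contMDiff_nnreal_coe _).comp z (contMDiffAt_fst.comp z (contMDiff_subtype_val z))
    have h2 : ContMDiffAt (unitModel d) 𝓘(ℝ, Euc (d + 2)) ∞
        (fun x : D.collar i => (x.1.2.1 : Euc (d + 2))) z :=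
      (contMDiff_coe_sphere (n := d + 1) (m := ∞) _).comp z
        (((D.isImmersion_link i).contMDiff _).comp z
          (contMDiffAt_snd.comp z (contMDiff_subtype_val z)))
    have h3 := h1.smul h2
    have h4 : ContMDiffAt 𝓘(ℝ, Euc (d + 2)) 𝓘(ℝ, Euc (d + 2)) ∞ (D.φ i).symm
        ((z.1.1 : ℝ) • (z.1.2.1 : Euc (d + 2))) :=
      ((D.φ_symm_smooth i).contDiffAt
        ((D.φ i).open_target.mem_nhds (D.smul_mem_target ⟨z, hz'⟩))).contMDiffAt
    refine (h4.comp z h3).congr_of_eventuallyEq ?_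
    filter_upwards [g.open_source.mem_nhds hz] with w hw
    rw [hgs] at hw
    exact congrArg Subtype.val (hgf ⟨w, hw⟩)
  · -- the components of `φ_i`
    have hcont := g.continuousAt_symm hz
    have hright : ∀ w ∈ g.target, D.φ i w.1 =
        ((g.symm w).1.1 : ℝ) • ((g.symm w).1.2.1 : Euc (d + 2)) := by
      intro w hw
      have h1 := g.map_target hw
      have h2 := g.right_inv hw
      rw [hgs] at h1
      rw [hgf ⟨g.symm w, h1⟩] at h2
      rw [← congrArg Subtype.val h2]
      exact (D.φ i).right_inv (D.smul_mem_target ⟨_, h1⟩)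
    have hnorm : ∀ w ∈ g.target, ((g.symm w).1.1 : ℝ) = ‖D.φ i w.1‖ := by
      intro w hw
      rw [hright w hw, norm_smul, norm_eq_of_mem_sphere, mul_one,
        Real.norm_of_nonneg (NNReal.coe_nonneg _)]
    have hpos : ∀ w ∈ g.target, D.φ i w.1 ≠ 0 := by
      intro w hw h0
      have h1 := g.map_target hw
      rw [hgs] at h1
      have h2 := hnorm w hw
      rw [h0, norm_zero] at h2
      exact h1 (NNReal.coe_eq_zero.1 h2)
    have hφ : ∀ w ∈ g.target, ContMDiffAt 𝓘(ℝ, ℝ × Euc d) 𝓘(ℝ, Euc (d + 2)) ∞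
        (fun w : D.SmoothPart => D.φ i w.1) w := by
      intro w hw
      have h1 : ContMDiffAt 𝓘(ℝ, Euc (d + 2)) 𝓘(ℝ, Euc (d + 2)) ∞ (D.φ i) w.1 := by
        refine ((D.φ_smooth i).contDiffAt ((D.φ i).open_source.mem_nhds ?_)).contMDiffAt
        rw [hgt] at hw
        exact hw
      exact h1.comp w (D.isImmersion_smoothPart.contMDiff w)
    have hφn : ∀ w ∈ g.target, ContMDiffAt 𝓘(ℝ, ℝ × Euc d) 𝓘(ℝ, ℝ) ∞
        (fun w : D.SmoothPart => ‖D.φ i w.1‖) w := by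
      intro w hw
      exact ContMDiffAt.comp w (contDiffAt_norm ℝ (hpos w hw)).contMDiffAt (hφ w hw)
    rw [← ContMDiffAt.subtypeVal_comp_iff]
    refine ContMDiffAt.prodMk ?_ ?_
    · rw [contMDiffAt_nnreal_iff]
      refine (hφn z hz).congr_of_eventuallyEq ?_
      filter_upwards [g.open_target.mem_nhds hz] with w hw using hnorm w hw
    -- Smoothness of the angular component is checked first as a map to the sphere, then as a map to
    -- `ℝⁿ`, where it is `‖φ_i w‖⁻¹ • φ_i w`. The continuity into `∂ω_i` that the first reduction
    -- needs is that of `g.symm`.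
    · refine contMDiffAt_of_isImmersion (D.isImmersion_link i)
        (continuousAt_snd.comp (continuousAt_subtype_val.comp hcont)) ?_
      refine contMDiffAt_sphere g.open_target (fun w hw => ContMDiffAt.contMDiffWithinAt ?_) hz
      refine (((hφn w hw).inv₀ (norm_ne_zero_iff.2 (hpos w hw))).smul
        (hφ w hw)).congr_of_eventuallyEq ?_
      filter_upwards [g.open_target.mem_nhds hw] with v hv
      have h1 : ‖D.φ i v.1‖ ≠ 0 := norm_ne_zero_iff.2 (hpos v hv)
      show ((g.symm v).1.2.1 : Euc (d + 2)) = ‖D.φ i v.1‖⁻¹ • D.φ i v.1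
      rw [eq_inv_smul_iff₀ h1, ← hnorm v hv]
      exact (hright v hv).symm

/-- An arrow over the interior of the collar is determined by its range and domain. If these have
polar coordinates `(t, y)` and `(s, z)`, the arrow is `((t, t / s), (y, z))`, which depends smoothly
on them as `s ≠ 0`. -/
theorem exists_arrow_transition (i : Fin D.l)
    (g₀ : (D.collarGroupoid i).arrowsOver (D.collarInterior i)) :
    ∃ g : OpenPartialHomeomorph (D.collarArrows i) (D.SmoothPart × D.SmoothPart),
      g.source = (D.collarGroupoid i).arrowsOver (D.collarInterior i) ∧
      (∀ x : (D.collarGroupoid i).arrowsOver (D.collarInterior i),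
        g x = arrowMap D.collarGroupoid D.collarInterior D.collarMap i x) ∧
      g.IsDiffeo (arrowModel d) (𝓘(ℝ, ℝ × Euc d).prod 𝓘(ℝ, ℝ × Euc d)) := by
  obtain ⟨e, hes, hef, hed⟩ := D.exists_unit_transition i ⟨_, g₀.2.1⟩
  obtain ⟨g, hgs, hgt, hgf⟩ :=
    exists_openPartialHomeomorph (D.isOpen_arrowsOver i) (D.isOpenEmbedding_arrowMap i) g₀
  refine ⟨g, hgs, hgf, fun z hz => ContMDiffAt.contMDiffWithinAt ?_,
    fun z hz => ContMDiffAt.contMDiffWithinAt ?_⟩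
  · have hz' := hz
    rw [hgs] at hz'
    have h1 := ((hed.contMDiffAt (hes ▸ hz'.1)).comp z (D.contMDiff_collarGroupoid_r i z)).prodMk
      ((hed.contMDiffAt (hes ▸ hz'.2)).comp z (D.contMDiff_collarGroupoid_d i z))
    refine h1.congr_of_eventuallyEq ?_
    filter_upwards [g.open_source.mem_nhds hz] with w hw
    rw [hgs] at hw
    rw [hgf ⟨w, hw⟩]
    exact Prod.ext (hef ⟨_, hw.1⟩).symm (hef ⟨_, hw.2⟩).symm
  · have hmem : ∀ w ∈ g.target, w.1 ∈ e.target ∧ w.2 ∈ e.target ∧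
        (D.collarGroupoid i).r (g.symm w) = e.symm w.1 ∧
        (D.collarGroupoid i).d (g.symm w) = e.symm w.2 ∧ e.symm w.1 ∈ D.collarInterior i ∧
        e.symm w.2 ∈ D.collarInterior i := by
      intro w hw
      have h1 := g.map_target hw
      have h2 := g.right_inv hw
      rw [hgs] at h1
      rw [hgf ⟨g.symm w, h1⟩] at h2
      have h3 : e ((D.collarGroupoid i).r (g.symm w)) = w.1 :=
        (hef ⟨_, h1.1⟩).trans (congrArg Prod.fst h2)
      have h4 : e ((D.collarGroupoid i).d (g.symm w)) = w.2 :=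
        (hef ⟨_, h1.2⟩).trans (congrArg Prod.snd h2)
      have h5 := e.map_source (hes ▸ h1.1)
      have h6 := e.map_source (hes ▸ h1.2)
      have h7 := e.left_inv (hes ▸ h1.1)
      have h8 := e.left_inv (hes ▸ h1.2)
      rw [h3] at h5 h7
      rw [h4] at h6 h8
      exact ⟨h5, h6, h7.symm, h8.symm, h7 ▸ h1.1, h8 ▸ h1.2⟩
    obtain ⟨hz1, hz2, -, -, hz5, hz6⟩ := hmem z hz
    have hA : ContMDiffAt (𝓘(ℝ, ℝ × Euc d).prod 𝓘(ℝ, ℝ × Euc d)) (unitModel d) ∞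
        (fun w : D.SmoothPart × D.SmoothPart => (e.symm w.1).1) z :=
      (contMDiff_subtype_val _).comp z ((hed.contMDiffAt_symm hz1).comp z contMDiffAt_fst)
    have hB : ContMDiffAt (𝓘(ℝ, ℝ × Euc d).prod 𝓘(ℝ, ℝ × Euc d)) (unitModel d) ∞
        (fun w : D.SmoothPart × D.SmoothPart => (e.symm w.2).1) z :=
      (contMDiff_subtype_val _).comp z ((hed.contMDiffAt_symm hz2).comp z contMDiffAt_snd)
    have hAt := contMDiffAt_nnreal_iff.1 (hA.fst)
    have hBt := contMDiffAt_nnreal_iff.1 (hB.fst)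
    rw [← ContMDiffAt.subtypeVal_comp_iff]
    refine ContMDiffAt.prodMk (ContMDiffAt.prodMk ?_ ?_) (ContMDiffAt.prodMk ?_ ?_)
    · refine (hA.fst).congr_of_eventuallyEq ?_
      filter_upwards [g.open_target.mem_nhds hz] with w hw
      exact congrArg (fun x => x.1.1) (hmem w hw).2.2.1
    -- The domain of `(t, a)` has radius `s = t / a`, so `a` is recovered as `t / s`.
    · rw [contMDiffAt_posReal_iff]
      refine (hAt.mul (hBt.inv₀ fun h => hz6 (NNReal.coe_eq_zero.1 h))).congr_of_eventuallyEq ?_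
      filter_upwards [g.open_target.mem_nhds hz] with w hw
      obtain ⟨-, -, h3, h4, h5, -⟩ := hmem w hw
      have h7 : (0 : ℝ) < (g.symm w).1.1.1 := by
        rw [← h3] at h5
        exact NNReal.coe_pos.2 (pos_iff_ne_zero.2 h5)
      have h8 := div_mul_inv_toNNReal _ (g.symm w).1.1.2 h7
      show ((g.symm w).1.1.2 : ℝ) = (e.symm w.1).1.1 * ((e.symm w.2).1.1 : ℝ)⁻¹
      rw [← h3, ← h4, ← h8, div_eq_mul_inv]
      rfl
    · refine (hA.snd).congr_of_eventuallyEq ?_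
      filter_upwards [g.open_target.mem_nhds hz] with w hw
      exact congrArg (fun x => x.1.2) (hmem w hw).2.2.1
    · refine (hB.snd).congr_of_eventuallyEq ?_
      filter_upwards [g.open_target.mem_nhds hz] with w hw
      exact congrArg (fun x => x.1.2) (hmem w hw).2.2.2.1

/-- The model space carries both its own charted structure and the product one. The product of
diffeomorphisms uses the latter, the gluing construction the former; `chartedSpaceSelf_prod`
identifies them. -/
theorem unitEmbedding_isDiffeo :
    letI : ChartedSpace (UnitModel d) (UnitModel d) := chartedSpaceSelf _
    (unitEmbedding d).IsDiffeo 𝓘(ℝ, ℝ × Euc d) (unitModel d) := by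
  have h := expEmbedding_isDiffeo.prod (.refl (M := Euc d) (I := 𝓡 d))
  rw [← modelWithCornersSelf_prod] at h
  have e1 : chartedSpaceSelf (ModelProd ℝ (Euc d)) = prodChartedSpace _ _ _ _ :=
    chartedSpaceSelf_prod.symm
  have e2 : chartedSpaceSelf (UnitModel d) = prodChartedSpace _ _ _ _ :=
    chartedSpaceSelf_prod.symm
  rw [← e1, ← e2] at h
  exact h

theorem arrowEmbedding_isDiffeo :
    letI : ChartedSpace (ArrowModel d) (ArrowModel d) := chartedSpaceSelf _
    (arrowEmbedding d).IsDiffeo (𝓘(ℝ, ℝ × Euc d).prod 𝓘(ℝ, ℝ × Euc d)) (arrowModel d) := by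
  have h1 : ((Homeomorph.prodProdProdComm ℝ (Euc d) ℝ (Euc d)).toOpenPartialHomeomorph).IsDiffeo
      (𝓘(ℝ, ℝ × Euc d).prod 𝓘(ℝ, ℝ × Euc d))
      ((𝓘(ℝ, ℝ).prod 𝓘(ℝ, ℝ)).prod ((𝓡 d).prod (𝓡 d))) := by
    have hf : ContMDiff 𝓘(ℝ, ℝ × Euc d) 𝓘(ℝ, ℝ) ∞ (Prod.fst : ℝ × Euc d → ℝ) :=
      contDiff_fst.contMDiff
    have hs : ContMDiff 𝓘(ℝ, ℝ × Euc d) (𝓡 d) ∞ (Prod.snd : ℝ × Euc d → Euc d) :=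
      contDiff_snd.contMDiff
    constructor
    · exact (((hf.comp contMDiff_fst).prodMk (hf.comp contMDiff_snd)).prodMk
        ((hs.comp contMDiff_fst).prodMk (hs.comp contMDiff_snd))).contMDiffOn
    · exact (((contMDiff_fst.comp contMDiff_fst).prodMk_space
        (contMDiff_fst.comp contMDiff_snd)).prodMk
        ((contMDiff_snd.comp contMDiff_fst).prodMk_space
        (contMDiff_snd.comp contMDiff_snd))).contMDiffOn
  have h2 := h1.trans ((expEmbedding_isDiffeo.prod (.refl (I := 𝓘(ℝ, ℝ)))).prod
    (.refl (I := (𝓡 d).prod (𝓡 d))))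
  have e1 : chartedSpaceSelf (ModelProd (ℝ × Euc d) (ℝ × Euc d)) = prodChartedSpace _ _ _ _ :=
    chartedSpaceSelf_prod.symm
  have e2 : chartedSpaceSelf (ArrowModel d) = prodChartedSpace _ _ _ _ :=
    chartedSpaceSelf_prod.symm
  have e3 : chartedSpaceSelf (ModelProd ℝ≥0 ℝ) = prodChartedSpace _ _ _ _ :=
    chartedSpaceSelf_prod.symm
  have e4 : chartedSpaceSelf (ModelProd (Euc d) (Euc d)) = prodChartedSpace _ _ _ _ :=
    chartedSpaceSelf_prod.symm
  rw [e1, e2, e3, e4]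
  exact h2

end ConicalDomain

namespace ConicalDomain

variable {d : ℕ} (D : ConicalDomain d)

/-! ### The smooth structures of the units and of the arrows -/

instance : IsManifold (unitModel d) ∞ D.DesingBoundary :=
  Glue.isManifold D.isOpen_collarInterior D.isOpenEmbedding_collarMap D.exists_unit_transition
    unitEmbedding_isDiffeo rfl

instance : IsManifold (arrowModel d) ∞ D.LayerArrows :=
  Glue.isManifold D.isOpen_arrowsOver D.isOpenEmbedding_arrowMap D.exists_arrow_transition
    arrowEmbedding_isDiffeo rfl

instance (i : Fin D.l) [h : Nonempty (D.Link i)] : Nonempty (D.collar i) :=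
  h.map fun y => ⟨(0, y), (zero_lt_one : (0 : ℝ≥0) < 1)⟩

instance (i : Fin D.l) [Nonempty (D.Link i)] : Nonempty (D.collarArrows i) :=
  (inferInstance : Nonempty (D.collar i)).map (D.collarGroupoid i).u

/-- The inclusion of `Ω₀` in `M`. -/
def unitCore [Nonempty D.SmoothPart] : OpenPartialHomeomorph D.SmoothPart D.DesingBoundary :=
  Glue.coreHomeo D.isOpen_collarInterior D.isOpenEmbedding_collarMap

/-- The inclusion of `Ω₀ × Ω₀` in `𝒢`. -/
def arrowCore [Nonempty D.SmoothPart] :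
    OpenPartialHomeomorph (D.SmoothPart × D.SmoothPart) D.LayerArrows :=
  Glue.coreHomeo D.isOpen_arrowsOver D.isOpenEmbedding_arrowMap

/-- The inclusion of `[0, 1) × ∂ω_i` in `M`, defined on a part of `[0, ∞) × ∂ω_i`. -/
def unitEnd (i : Fin D.l) [Nonempty (D.Link i)] :
    OpenPartialHomeomorph (ℝ≥0 × D.Link i) D.DesingBoundary :=
  ((D.collar i).openPartialHomeomorphSubtypeCoe inferInstance).symm.trans
    (Glue.pieceHomeo D.isOpen_collarInterior D.isOpenEmbedding_collarMap i)

/-- The inclusion of `𝒥_i` in `𝒢`, defined on a part of `ℋ × (∂ω_i)²`. -/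
def arrowEnd (i : Fin D.l) [Nonempty (D.Link i)] :
    OpenPartialHomeomorph ((ℝ≥0 × PosReal) × (D.Link i × D.Link i)) D.LayerArrows :=
  ((D.collarArrows i).openPartialHomeomorphSubtypeCoe inferInstance).symm.trans
    (Glue.pieceHomeo D.isOpen_arrowsOver D.isOpenEmbedding_arrowMap i)

theorem unitCore_isDiffeo [Nonempty D.SmoothPart] :
    D.unitCore.IsDiffeo 𝓘(ℝ, ℝ × Euc d) (unitModel d) :=
  Glue.coreHomeo_isDiffeo D.isOpen_collarInterior D.isOpenEmbedding_collarMap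
    D.exists_unit_transition unitEmbedding_isDiffeo rfl (unitEmbedding_source d)

theorem arrowCore_isDiffeo [Nonempty D.SmoothPart] :
    D.arrowCore.IsDiffeo (𝓘(ℝ, ℝ × Euc d).prod 𝓘(ℝ, ℝ × Euc d)) (arrowModel d) :=
  Glue.coreHomeo_isDiffeo D.isOpen_arrowsOver D.isOpenEmbedding_arrowMap
    D.exists_arrow_transition arrowEmbedding_isDiffeo rfl (arrowEmbedding_source d)

theorem unitEnd_isDiffeo (i : Fin D.l) [Nonempty (D.Link i)] :
    (D.unitEnd i).IsDiffeo (unitModel d) (unitModel d) :=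
  (OpenPartialHomeomorph.IsDiffeo.subtypeCoe _ _).symm.trans
    (Glue.pieceHomeo_isDiffeo D.isOpen_collarInterior D.isOpenEmbedding_collarMap
      D.exists_unit_transition unitEmbedding_isDiffeo rfl i)

theorem arrowEnd_isDiffeo (i : Fin D.l) [Nonempty (D.Link i)] :
    (D.arrowEnd i).IsDiffeo (arrowModel d) (arrowModel d) :=
  (OpenPartialHomeomorph.IsDiffeo.subtypeCoe _ _).symm.trans
    (Glue.pieceHomeo_isDiffeo D.isOpen_arrowsOver D.isOpenEmbedding_arrowMap
      D.exists_arrow_transition arrowEmbedding_isDiffeo rfl i)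

-- The structural maps read in the ends

section Ends

variable (i : Fin D.l) [Nonempty (D.Link i)]

theorem unitEnd_source : (D.unitEnd i).source = D.collar i := by
  simp [unitEnd]

theorem arrowEnd_source : (D.arrowEnd i).source = D.collarArrows i := by
  simp [arrowEnd]

theorem unitEnd_coe (x : D.collar i) : D.unitEnd i x.1 = Glue.piece _ _ i x := by
  exact congrArg (Glue.piece D.collarInterior D.collarMap i)
    (((D.collar i).openPartialHomeomorphSubtypeCoe inferInstance).left_inv
    (mem_univ x))

theorem arrowEnd_coe (g : D.collarArrows i) : D.arrowEnd i g.1 = Glue.piece _ _ i g := by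
  exact congrArg (Glue.piece _ (arrowMap D.collarGroupoid D.collarInterior D.collarMap) i)
    (((D.collarArrows i).openPartialHomeomorphSubtypeCoe inferInstance).left_inv
    (mem_univ g))

variable {i}

/-- Read through `arrowEnd` and `unitEnd`, the structural maps are those of `coneGroupoid`, whose
arrows and units form plain products of manifolds. Smoothness is checked there. -/
theorem d_arrowEnd {g} (hg : g ∈ D.collarArrows i) :
    D.layerPotentialsGroupoid.d (D.arrowEnd i g) = D.unitEnd i ((D.coneGroupoid i).d g) := by
  rw [D.arrowEnd_coe i ⟨g, hg⟩]
  exact (D.unitEnd_coe i ((D.collarGroupoid i).d ⟨g, hg⟩)).symm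

theorem r_arrowEnd {g} (hg : g ∈ D.collarArrows i) :
    D.layerPotentialsGroupoid.r (D.arrowEnd i g) = D.unitEnd i ((D.coneGroupoid i).r g) := by
  rw [D.arrowEnd_coe i ⟨g, hg⟩]
  exact (D.unitEnd_coe i ((D.collarGroupoid i).r ⟨g, hg⟩)).symm

theorem inv_arrowEnd {g} (hg : g ∈ D.collarArrows i) :
    D.layerPotentialsGroupoid.inv (D.arrowEnd i g) = D.arrowEnd i ((D.coneGroupoid i).inv g) := by
  rw [D.arrowEnd_coe i ⟨g, hg⟩]
  exact (D.arrowEnd_coe i ((D.collarGroupoid i).inv ⟨g, hg⟩)).symm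

theorem u_unitEnd {x} (hx : x ∈ D.collar i) :
    D.layerPotentialsGroupoid.u (D.unitEnd i x) = D.arrowEnd i ((D.coneGroupoid i).u x) := by
  rw [D.unitEnd_coe i ⟨x, hx⟩]
  exact (D.arrowEnd_coe i ((D.collarGroupoid i).u ⟨x, hx⟩)).symm

theorem coneGroupoid_d_mem {g} (hg : g ∈ D.collarArrows i) :
    (D.coneGroupoid i).d g ∈ D.collar i := hg.2

theorem coneGroupoid_r_mem {g} (hg : g ∈ D.collarArrows i) :
    (D.coneGroupoid i).r g ∈ D.collar i := hg.1

theorem composable_arrowEnd {g k} (hg : g ∈ D.collarArrows i) (hk : k ∈ D.collarArrows i)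
    (h : D.layerPotentialsGroupoid.d (D.arrowEnd i g) =
      D.layerPotentialsGroupoid.r (D.arrowEnd i k)) :
    (D.coneGroupoid i).d g = (D.coneGroupoid i).r k := by
  rw [D.d_arrowEnd hg, D.r_arrowEnd hk] at h
  refine (D.unitEnd i).injOn ?_ ?_ h
  · rw [D.unitEnd_source]; exact hg.2
  · rw [D.unitEnd_source]; exact hk.1

theorem mul_mem_collarArrows {g k} (hg : g ∈ D.collarArrows i) (hk : k ∈ D.collarArrows i)
    (h : (D.coneGroupoid i).d g = (D.coneGroupoid i).r k) :
    (D.coneGroupoid i).mul g k h ∈ D.collarArrows i :=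
  ((D.collarGroupoid i).mul ⟨g, hg⟩ ⟨k, hk⟩ (Subtype.ext h)).2

theorem mul_arrowEnd {g k} (hg : g ∈ D.collarArrows i) (hk : k ∈ D.collarArrows i)
    (h : D.layerPotentialsGroupoid.d (D.arrowEnd i g) =
      D.layerPotentialsGroupoid.r (D.arrowEnd i k)) :
    D.layerPotentialsGroupoid.mul _ _ h =
      D.arrowEnd i ((D.coneGroupoid i).mul g k (D.composable_arrowEnd hg hk h)) := by
  have h' := D.composable_arrowEnd hg hk h
  have hgk : (D.collarGroupoid i).d ⟨g, hg⟩ = (D.collarGroupoid i).r ⟨k, hk⟩ := Subtype.ext h'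
  have h1 := D.arrowEnd_coe i ⟨g, hg⟩
  have h2 := D.arrowEnd_coe i ⟨k, hk⟩
  simp only at h1 h2
  generalize_proofs
  -- The product takes the proof of composability as an argument, so this proof must be rewritten
  -- together with the arrows.
  revert h
  rw [h1, h2]
  intro h
  refine (GlueArrows.product_piece D.collarInterior_invariant i _ _ hgk h).trans ?_
  exact (D.arrowEnd_coe i ((D.collarGroupoid i).mul ⟨g, hg⟩ ⟨k, hk⟩ hgk)).symm

end Ends

theorem mul_arrowCore [Nonempty D.SmoothPart] (b c : D.SmoothPart × D.SmoothPart)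
    (h : D.layerPotentialsGroupoid.d (D.arrowCore b) =
      D.layerPotentialsGroupoid.r (D.arrowCore c)) :
    D.layerPotentialsGroupoid.mul _ _ h = D.arrowCore (b.1, c.2) :=
  GlueArrows.product_core D.collarInterior_invariant b c h

theorem nonempty_link_of_collar {i : Fin D.l} (x : D.collar i) : Nonempty (D.Link i) := ⟨x.1.2⟩

theorem nonempty_link_of_arrow {i : Fin D.l} (g : D.collarArrows i) : Nonempty (D.Link i) :=
  ⟨g.1.2.1⟩

/-- Besides the coordinates, each case yields the inhabitant on which `unitCore` or `unitEnd`
depends. -/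
theorem unit_cases (x : D.DesingBoundary) :
    (∃ (_ : Nonempty D.SmoothPart) (y : D.SmoothPart), x = D.unitCore y) ∨
    ∃ (i : Fin D.l) (_ : Nonempty (D.Link i)), ∃ z ∈ D.collar i, x = D.unitEnd i z := by
  rcases Glue.cases_on _ _ x with ⟨y, rfl⟩ | ⟨i, z, -, rfl⟩
  · exact Or.inl ⟨⟨y⟩, y, rfl⟩
  · have := D.nonempty_link_of_collar z
    exact Or.inr ⟨i, this, z.1, z.2, (D.unitEnd_coe i z).symm⟩

theorem arrow_cases (g : D.LayerArrows) :
    (∃ (_ : Nonempty D.SmoothPart) (b : D.SmoothPart × D.SmoothPart), g = D.arrowCore b) ∨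
    ∃ (i : Fin D.l) (_ : Nonempty (D.Link i)), ∃ k ∈ D.collarArrows i, g = D.arrowEnd i k := by
  rcases Glue.cases_on _ _ g with ⟨b, rfl⟩ | ⟨i, k, -, rfl⟩
  · exact Or.inl ⟨⟨b.1⟩, b, rfl⟩
  · have := D.nonempty_link_of_arrow k
    exact Or.inr ⟨i, this, k.1, k.2, (D.arrowEnd_coe i k).symm⟩

/-- Two composable arrows are both in `Ω₀ × Ω₀`, or both in the same `𝒥_i`. -/
theorem composable_cases (g h : D.LayerArrows)
    (hgh : D.layerPotentialsGroupoid.d g = D.layerPotentialsGroupoid.r h) :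
    (∃ (_ : Nonempty D.SmoothPart) (b c : D.SmoothPart × D.SmoothPart), b.2 = c.1 ∧
      g = D.arrowCore b ∧ h = D.arrowCore c) ∨
    ∃ (i : Fin D.l) (_ : Nonempty (D.Link i)), ∃ g' ∈ D.collarArrows i,
      ∃ h' ∈ D.collarArrows i, (D.coneGroupoid i).d g' = (D.coneGroupoid i).r h' ∧
      g = D.arrowEnd i g' ∧ h = D.arrowEnd i h' := by
  rcases GlueArrows.cases_comp D.collarInterior_invariant g h hgh with
    ⟨b, c, hbc, rfl, rfl⟩ | ⟨i, g', h', -, -, -, hgh', rfl, rfl⟩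
  · exact Or.inl ⟨⟨b.1⟩, b, c, hbc, rfl, rfl⟩
  · have := D.nonempty_link_of_arrow g'
    exact Or.inr ⟨i, this, g'.1, g'.2, h'.1, h'.2, congrArg Subtype.val hgh',
      (D.arrowEnd_coe i g').symm, (D.arrowEnd_coe i h').symm⟩

/-! ### Smoothness of the structural maps -/

/-- As `arrowCore` and `arrowEnd` are diffeomorphisms onto open sets that cover the arrows,
smoothness is tested after composition with them. On the core the map is a projection, on an end it
is the domain map of `coneGroupoid`. The other structural maps are treated in the same way. -/
theorem contMDiff_layer_d : ContMDiff (arrowModel d) (unitModel d) ∞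
    D.layerPotentialsGroupoid.d := by
  intro g
  rcases D.arrow_cases g with ⟨_, b, rfl⟩ | ⟨i, _, k, hk, rfl⟩
  · exact D.arrowCore_isDiffeo.contMDiffAt_of_comp (mem_univ b)
      ((D.unitCore_isDiffeo.contMDiffAt (mem_univ b.2)).comp b contMDiffAt_snd)
  · have hs : k ∈ (D.arrowEnd i).source := by rw [D.arrowEnd_source]; exact hk
    refine (D.arrowEnd_isDiffeo i).contMDiffAt_of_comp hs ?_
    refine (((D.unitEnd_isDiffeo i).contMDiffAt ?_).comp k
      (D.contMDiff_coneGroupoid_d i k)).congr_of_eventuallyEq ?_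
    · rw [D.unitEnd_source]; exact hk.2
    · filter_upwards [(D.collarArrows i).isOpen.mem_nhds hk] with k' hk' using D.d_arrowEnd hk'

theorem contMDiff_layer_r : ContMDiff (arrowModel d) (unitModel d) ∞
    D.layerPotentialsGroupoid.r := by
  intro g
  rcases D.arrow_cases g with ⟨_, b, rfl⟩ | ⟨i, _, k, hk, rfl⟩
  · exact D.arrowCore_isDiffeo.contMDiffAt_of_comp (mem_univ b)
      ((D.unitCore_isDiffeo.contMDiffAt (mem_univ b.1)).comp b contMDiffAt_fst)
  · have hs : k ∈ (D.arrowEnd i).source := by rw [D.arrowEnd_source]; exact hk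
    refine (D.arrowEnd_isDiffeo i).contMDiffAt_of_comp hs ?_
    refine (((D.unitEnd_isDiffeo i).contMDiffAt ?_).comp k
      (D.contMDiff_coneGroupoid_r i k)).congr_of_eventuallyEq ?_
    · rw [D.unitEnd_source]; exact hk.1
    · filter_upwards [(D.collarArrows i).isOpen.mem_nhds hk] with k' hk' using D.r_arrowEnd hk'

theorem contMDiff_coneGroupoid_inv (i : Fin D.l) :
    ContMDiff (arrowModel d) (arrowModel d) ∞ (D.coneGroupoid i).inv := by
  intro q
  have hd := D.contMDiff_coneGroupoid_d i q
  refine ContMDiffAt.prodMk (ContMDiffAt.prodMk hd.fst ?_)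
    (contMDiffAt_snd.comp q contMDiffAt_snd |>.prodMk (contMDiffAt_fst.comp q contMDiffAt_snd))
  rw [contMDiffAt_posReal_iff]
  have h2 : ContMDiffAt (arrowModel d) 𝓘(ℝ, ℝ) ∞ (fun q : (ℝ≥0 × PosReal) × (D.Link i × D.Link i) =>
      (q.1.2 : ℝ)) q := (contMDiff_posReal_coe _).comp q (contMDiffAt_snd.comp q contMDiffAt_fst)
  exact h2.inv₀ q.1.2.2.ne'

theorem contMDiff_coneGroupoid_u (i : Fin D.l) :
    ContMDiff (unitModel d) (arrowModel d) ∞ (D.coneGroupoid i).u := fun q =>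
  ContMDiffAt.prodMk (contMDiffAt_fst.prodMk contMDiffAt_const)
    (contMDiffAt_snd.prodMk contMDiffAt_snd)

theorem contMDiff_layer_inv : ContMDiff (arrowModel d) (arrowModel d) ∞
    D.layerPotentialsGroupoid.inv := by
  intro g
  rcases D.arrow_cases g with ⟨_, b, rfl⟩ | ⟨i, _, k, hk, rfl⟩
  · exact D.arrowCore_isDiffeo.contMDiffAt_of_comp (mem_univ b)
      (ContMDiffAt.comp (f := fun b : D.SmoothPart × D.SmoothPart => (b.2, b.1)) b
        (D.arrowCore_isDiffeo.contMDiffAt (mem_univ (b.2, b.1)))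
        (contMDiffAt_snd.prodMk contMDiffAt_fst))
  · have hs : k ∈ (D.arrowEnd i).source := by rw [D.arrowEnd_source]; exact hk
    refine (D.arrowEnd_isDiffeo i).contMDiffAt_of_comp hs ?_
    refine (((D.arrowEnd_isDiffeo i).contMDiffAt ?_).comp k
      (D.contMDiff_coneGroupoid_inv i k)).congr_of_eventuallyEq ?_
    · rw [D.arrowEnd_source]; exact ((D.collarGroupoid i).inv ⟨k, hk⟩).2
    · filter_upwards [(D.collarArrows i).isOpen.mem_nhds hk] with k' hk' using D.inv_arrowEnd hk'

theorem contMDiff_layer_u : ContMDiff (unitModel d) (arrowModel d) ∞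
    D.layerPotentialsGroupoid.u := by
  intro x
  rcases D.unit_cases x with ⟨_, y, rfl⟩ | ⟨i, _, z, hz, rfl⟩
  · exact D.unitCore_isDiffeo.contMDiffAt_of_comp (mem_univ y)
      (ContMDiffAt.comp (f := fun y : D.SmoothPart => (y, y)) y
        (D.arrowCore_isDiffeo.contMDiffAt (mem_univ (y, y))) (contMDiffAt_id.prodMk contMDiffAt_id))
  · have hs : z ∈ (D.unitEnd i).source := by rw [D.unitEnd_source]; exact hz
    refine (D.unitEnd_isDiffeo i).contMDiffAt_of_comp hs ?_
    refine (((D.arrowEnd_isDiffeo i).contMDiffAt ?_).comp z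
      (D.contMDiff_coneGroupoid_u i z)).congr_of_eventuallyEq ?_
    · rw [D.arrowEnd_source]; exact ((D.collarGroupoid i).u ⟨z, hz⟩).2
    · filter_upwards [(D.collar i).isOpen.mem_nhds hz] with z' hz' using D.u_unitEnd hz'

/-- The product of `ℋ × (∂ω_i)²`, extended to all pairs of arrows. -/
def coneMul (i : Fin D.l) (q : ((ℝ≥0 × PosReal) × (D.Link i × D.Link i)) ×
    ((ℝ≥0 × PosReal) × (D.Link i × D.Link i))) : (ℝ≥0 × PosReal) × (D.Link i × D.Link i) :=
  ((q.1.1.1, q.2.1.2 * q.1.1.2), (q.1.2.1, q.2.2.2))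

theorem contMDiff_coneMul (i : Fin D.l) :
    ContMDiff ((arrowModel d).prod (arrowModel d)) (arrowModel d) ∞ (D.coneMul i) := by
  intro q
  have h1 := contMDiffAt_fst (I := arrowModel d) (J := arrowModel d) (n := ∞) (p := q)
  have h2 := contMDiffAt_snd (I := arrowModel d) (J := arrowModel d) (n := ∞) (p := q)
  refine ContMDiffAt.prodMk (ContMDiffAt.prodMk h1.fst.fst ?_) (h1.snd.fst.prodMk h2.snd.snd)
  rw [contMDiffAt_posReal_iff]
  exact (contMDiffAt_posReal_iff.1 h2.fst.snd).mul (contMDiffAt_posReal_iff.1 h1.fst.snd)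

-- A composable pair lies in the core or in a single end. On composable pairs the product there is
-- the restriction of a map that is smooth on all pairs: `(b, c) ↦ (b.1, c.2)`, respectively
-- `coneMul`.
open Classical in
theorem contMDiffOn_layer_mul : ContMDiffOn ((arrowModel d).prod (arrowModel d)) (arrowModel d) ∞
    (fun q : D.LayerArrows × D.LayerArrows =>
      if h : D.layerPotentialsGroupoid.d q.1 = D.layerPotentialsGroupoid.r q.2 then
        D.layerPotentialsGroupoid.mul q.1 q.2 h else q.1)
    {q | D.layerPotentialsGroupoid.d q.1 = D.layerPotentialsGroupoid.r q.2} := by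
  rintro ⟨g, h⟩ hgh
  rcases D.composable_cases g h hgh with ⟨_, b, c, hbc, rfl, rfl⟩ |
    ⟨i, _, g', hg', h', hh', hgh', rfl, rfl⟩
  · refine (D.arrowCore_isDiffeo.prod D.arrowCore_isDiffeo).contMDiffWithinAt_of_comp
      (x := (b, c)) ⟨mem_univ _, mem_univ _⟩ ?_
    have h1 : ContMDiffAt ((𝓘(ℝ, ℝ × Euc d).prod 𝓘(ℝ, ℝ × Euc d)).prod
        (𝓘(ℝ, ℝ × Euc d).prod 𝓘(ℝ, ℝ × Euc d))) (arrowModel d) ∞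
        (fun q : (D.SmoothPart × D.SmoothPart) × (D.SmoothPart × D.SmoothPart) =>
          D.arrowCore (q.1.1, q.2.2)) (b, c) :=
      (D.arrowCore_isDiffeo.contMDiffAt (mem_univ (b.1, c.2))).comp (b, c)
        ((contMDiffAt_fst.comp _ contMDiffAt_fst).prodMk (contMDiffAt_snd.comp _ contMDiffAt_snd))
    have key : ∀ q : (D.SmoothPart × D.SmoothPart) × (D.SmoothPart × D.SmoothPart),
        D.layerPotentialsGroupoid.d (D.arrowCore q.1) =
          D.layerPotentialsGroupoid.r (D.arrowCore q.2) →
        (if h : D.layerPotentialsGroupoid.d (D.arrowCore q.1) =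
          D.layerPotentialsGroupoid.r (D.arrowCore q.2) then
        D.layerPotentialsGroupoid.mul (D.arrowCore q.1) (D.arrowCore q.2) h else D.arrowCore q.1) =
          D.arrowCore (q.1.1, q.2.2) := by
      intro q hq
      rw [dif_pos hq, D.mul_arrowCore]
    exact h1.contMDiffWithinAt.congr (fun q hq => key q hq.2) (key (b, c) hgh)
  · have hs : ∀ {g}, g ∈ D.collarArrows i → g ∈ (D.arrowEnd i).source := fun hg => by
      rw [D.arrowEnd_source]; exact hg
    refine ((D.arrowEnd_isDiffeo i).prod (D.arrowEnd_isDiffeo i)).contMDiffWithinAt_of_comp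
      (x := (g', h')) ⟨hs hg', hs hh'⟩ ?_
    have h1 : ContMDiffAt ((arrowModel d).prod (arrowModel d)) (arrowModel d) ∞
        (fun q => D.arrowEnd i (D.coneMul i q)) (g', h') :=
      ((D.arrowEnd_isDiffeo i).contMDiffAt (hs (D.mul_mem_collarArrows hg' hh' hgh'))).comp
        (g', h') (D.contMDiff_coneMul i (g', h'))
    have key : ∀ q : ((ℝ≥0 × PosReal) × (D.Link i × D.Link i)) ×
        ((ℝ≥0 × PosReal) × (D.Link i × D.Link i)),
        q.1 ∈ D.collarArrows i → q.2 ∈ D.collarArrows i →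
        D.layerPotentialsGroupoid.d (D.arrowEnd i q.1) =
          D.layerPotentialsGroupoid.r (D.arrowEnd i q.2) →
        (if h : D.layerPotentialsGroupoid.d (D.arrowEnd i q.1) =
          D.layerPotentialsGroupoid.r (D.arrowEnd i q.2) then
        D.layerPotentialsGroupoid.mul (D.arrowEnd i q.1) (D.arrowEnd i q.2) h
          else D.arrowEnd i q.1) = D.arrowEnd i (D.coneMul i q) := by
      intro q h1 h2 hq
      rw [dif_pos hq, D.mul_arrowEnd h1 h2]
      rfl
    refine h1.contMDiffWithinAt.congr (fun q hq => key q ?_ ?_ hq.2) (key (g', h') hg' hh' hgh)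
    · have := hq.1.1; rwa [D.arrowEnd_source] at this
    · have := hq.1.2; rwa [D.arrowEnd_source] at this

/-- The change of variables `((t, a), (y, z)) ↦ ((t / a, z), (a, y))` of `ℋ × (∂ω_i)²`, the first
component of which is the domain map. -/
def coneShear (i : Fin D.l) : (ℝ≥0 × PosReal) × (D.Link i × D.Link i) ≃
    (ℝ≥0 × D.Link i) × (PosReal × D.Link i) where
  toFun q := ((D.coneGroupoid i).d q, (q.1.2, q.2.1))
  invFun q := ((q.1.1 * q.2.1.toNNReal, q.2.1), (q.2.2, q.1.2))
  left_inv q := by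
    refine Prod.ext (Prod.ext (NNReal.eq ?_) rfl) rfl
    show (q.1.1 : ℝ) * (q.1.2.1)⁻¹ * q.1.2.1 = q.1.1
    rw [mul_assoc, inv_mul_cancel₀ q.1.2.2.ne', mul_one]
  right_inv q := by
    refine Prod.ext (Prod.ext (NNReal.eq ?_) rfl) rfl
    show (q.1.1 : ℝ) * q.2.1.1 * (q.2.1.1)⁻¹ = q.1.1
    rw [mul_assoc, mul_inv_cancel₀ q.2.1.2.ne', mul_one]

theorem contMDiff_coneShear (i : Fin D.l) : ContMDiff (arrowModel d)
    ((unitModel d).prod (𝓘(ℝ, ℝ).prod (𝓡 d))) ∞ (D.coneShear i) := fun q =>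
  (D.contMDiff_coneGroupoid_d i q).prodMk
    ((contMDiffAt_snd.comp q contMDiffAt_fst).prodMk (contMDiffAt_fst.comp q contMDiffAt_snd))

theorem contMDiff_coneShear_symm (i : Fin D.l) : ContMDiff
    ((unitModel d).prod (𝓘(ℝ, ℝ).prod (𝓡 d))) (arrowModel d) ∞ (D.coneShear i).symm := by
  intro q
  have h1 := contMDiffAt_fst (I := unitModel d) (J := 𝓘(ℝ, ℝ).prod (𝓡 d)) (n := ∞) (p := q)
  have h2 := contMDiffAt_snd (I := unitModel d) (J := 𝓘(ℝ, ℝ).prod (𝓡 d)) (n := ∞) (p := q)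
  refine ContMDiffAt.prodMk (ContMDiffAt.prodMk ?_ h2.fst) (h2.snd.prodMk h1.snd)
  rw [contMDiffAt_nnreal_iff]
  exact (contMDiffAt_nnreal_iff.1 h1.fst).mul (contMDiffAt_posReal_iff.1 h2.fst)

theorem isCornerModel_unitModel (d : ℕ) : IsCornerModel (unitModel d) :=
  isCornerModel_halfLine.prod (.of_boundaryless _)

theorem isCornerModel_arrowModel (d : ℕ) : IsCornerModel (arrowModel d) :=
  (isCornerModel_halfLine.prod (.of_boundaryless _)).prod (.of_boundaryless _)

/-- On the core, exchanging the two factors turns `d` into a first projection with fibre `Ω₀`. On an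
end, `coneShear` does so with fibre `(0, ∞) × ∂ω_i`. Neither fibre has a boundary. -/
theorem isTameSubmersion_layer_d :
    IsTameSubmersion (arrowModel d) (unitModel d) D.layerPotentialsGroupoid.d := by
  refine isTameSubmersion_of_local_projection (isCornerModel_arrowModel d)
    (isCornerModel_unitModel d) D.contMDiff_layer_d fun g => ?_
  rcases D.arrow_cases g with ⟨_, b, rfl⟩ | ⟨i, _, k, hk, rfl⟩
  · have hswap : ((Homeomorph.prodComm D.SmoothPart D.SmoothPart).toOpenPartialHomeomorph).IsDiffeo
        (𝓘(ℝ, ℝ × Euc d).prod 𝓘(ℝ, ℝ × Euc d)) (𝓘(ℝ, ℝ × Euc d).prod 𝓘(ℝ, ℝ × Euc d)) :=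
      ⟨(contMDiff_snd.prodMk contMDiff_fst).contMDiffOn,
        (contMDiff_snd.prodMk contMDiff_fst).contMDiffOn⟩
    refine ⟨ℝ × Euc d, ℝ × Euc d, D.SmoothPart, inferInstance, inferInstance, inferInstance,
      inferInstance, inferInstance, 𝓘(ℝ, ℝ × Euc d), inferInstance,
      (D.arrowCore.symm.trans
        (Homeomorph.prodComm D.SmoothPart D.SmoothPart).toOpenPartialHomeomorph).trans
        (D.unitCore.prod (.refl D.SmoothPart)), ?_,
      (D.arrowCore_isDiffeo.symm.trans hswap).trans (D.unitCore_isDiffeo.prod .refl), ?_⟩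
    · simp only [OpenPartialHomeomorph.trans_source, OpenPartialHomeomorph.symm_source]
      exact ⟨⟨D.arrowCore.map_source (mem_univ b), mem_univ _⟩, mem_univ _, mem_univ _⟩
    · intro q hq
      simp only [OpenPartialHomeomorph.trans_source, OpenPartialHomeomorph.symm_source] at hq
      conv_rhs => rw [← D.arrowCore.right_inv hq.1.1]
      rfl
  · let e : (ℝ≥0 × PosReal) × (D.Link i × D.Link i) ≃ₜ
        (ℝ≥0 × D.Link i) × (PosReal × D.Link i) :=
      { D.coneShear i with
        continuous_toFun := (D.contMDiff_coneShear i).continuous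
        continuous_invFun := (D.contMDiff_coneShear_symm i).continuous }
    have he : e.toOpenPartialHomeomorph.IsDiffeo (arrowModel d)
        ((unitModel d).prod (𝓘(ℝ, ℝ).prod (𝓡 d))) :=
      ⟨(D.contMDiff_coneShear i).contMDiffOn, (D.contMDiff_coneShear_symm i).contMDiffOn⟩
    have hs : k ∈ (D.arrowEnd i).source := by rw [D.arrowEnd_source]; exact hk
    refine ⟨ℝ × Euc d, ModelProd ℝ (Euc d), PosReal × D.Link i, inferInstance, inferInstance,
      inferInstance, inferInstance, inferInstance, 𝓘(ℝ, ℝ).prod (𝓡 d), inferInstance,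
      ((D.arrowEnd i).symm.trans e.toOpenPartialHomeomorph).trans
        ((D.unitEnd i).prod (.refl (PosReal × D.Link i))), ?_,
      ((D.arrowEnd_isDiffeo i).symm.trans he).trans ((D.unitEnd_isDiffeo i).prod .refl), ?_⟩
    · simp only [OpenPartialHomeomorph.trans_source, OpenPartialHomeomorph.symm_source,
        OpenPartialHomeomorph.prod_source, D.unitEnd_source]
      refine ⟨⟨(D.arrowEnd i).map_source hs, mem_univ _⟩, ?_, mem_univ _⟩
      show (D.coneGroupoid i).d ((D.arrowEnd i).symm (D.arrowEnd i k)) ∈ D.collar i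
      rw [(D.arrowEnd i).left_inv hs]
      exact hk.2
    · intro q hq
      simp only [OpenPartialHomeomorph.trans_source, OpenPartialHomeomorph.symm_source] at hq
      have hq' := (D.arrowEnd i).map_target hq.1.1
      rw [D.arrowEnd_source] at hq'
      conv_rhs => rw [← (D.arrowEnd i).right_inv hq.1.1, D.d_arrowEnd hq']
      rfl

/-! ### The layer potentials groupoid is a Lie groupoid -/

/-- Different ends do not meet because the chart domains have disjoint closures. The remaining
danger is a boundary point `(0, y)` that cannot be separated from a point of `Ω₀` outside the domain
of `φ_i`; a compact neighbourhood of `p_i` excludes it. -/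
instance : T2Space D.DesingBoundary := by
  refine Glue.t2Space D.isOpen_collarInterior D.isOpenEmbedding_collarMap ?_ ?_
  · intro i j hij
    rw [range_collarMap, range_collarMap]
    exact disjoint_left.2 fun z hz hz' => disjoint_left.1 (D.disjoint_charts i j hij)
      (subset_closure hz) (subset_closure hz')
  · intro i x hx y hy
    rw [range_collarMap] at hy
    have hx0 : x.1.1 = 0 := not_not.1 hx
    -- Any radius less than `1` would do: the closed ball is compact and contained in the target of
    -- `φ_i`, so its preimage is closed in `ℝⁿ` and its complement is an open neighbourhood of `y`.
    have hsub : closedBall (0 : Euc (d + 2)) (1 / 2) ⊆ (D.φ i).target := by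
      rw [D.φ_target]
      exact closedBall_subset_ball (by norm_num)
    have hK : IsCompact ((D.φ i).symm '' closedBall (0 : Euc (d + 2)) (1 / 2)) :=
      (isCompact_closedBall _ _).image_of_continuousOn ((D.φ i).continuousOn_symm.mono hsub)
    refine ⟨{x | x.1.1 < 1 / 2}, isOpen_lt (by fun_prop) continuous_const, ?_,
      {z | z.1 ∉ (D.φ i).symm '' closedBall (0 : Euc (d + 2)) (1 / 2)},
      hK.isClosed.isOpen_compl.preimage continuous_subtype_val, ?_, ?_⟩
    · show x.1.1 < 1 / 2
      rw [hx0]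
      norm_num
    · rintro ⟨w, hw, hwy⟩
      refine hy ?_
      show (y : Euc (d + 2)) ∈ (D.φ i).source
      rw [← hwy]
      exact (D.φ i).map_target (hsub hw)
    · refine disjoint_left.2 ?_
      rintro _ ⟨w, hw, rfl⟩ h
      refine h ⟨_, ?_, rfl⟩
      rw [mem_closedBall_zero_iff, norm_smul, norm_eq_of_mem_sphere, mul_one,
        Real.norm_of_nonneg (NNReal.coe_nonneg _)]
      have : (w.1.1.1 : ℝ) < (1 / 2 : ℝ≥0) := NNReal.coe_lt_coe.2 hw
      exact this.le.trans (by norm_num)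

theorem isLieGroupoid_layer :
    IsLieGroupoid (arrowModel d) (unitModel d) D.layerPotentialsGroupoid where
  corner_arrows := isCornerModel_arrowModel d
  corner_units := isCornerModel_unitModel d
  manifold_arrows := inferInstance
  manifold_units := inferInstance
  countable_arrows := Glue.secondCountableTopology D.isOpen_arrowsOver D.isOpenEmbedding_arrowMap
  countable_units := Glue.secondCountableTopology D.isOpen_collarInterior D.isOpenEmbedding_collarMap
  hausdorff_units := inferInstance
  smooth_d := D.contMDiff_layer_d
  smooth_r := D.contMDiff_layer_r
  smooth_inv := D.contMDiff_layer_inv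
  smooth_u := D.contMDiff_layer_u
  tame_d := D.isTameSubmersion_layer_d
  smooth_mul := D.contMDiffOn_layer_mul

end ConicalDomain

/-! ### Charts around finitely many points -/

/-- The group `ℤ` is regarded as a zero-dimensional manifold, so that `M' × ℤ` is a disjoint union
of copies of `M'` with the same model vector space up to a trivial factor. -/
instance : ChartedSpace PUnit.{1} ℤ := ChartedSpace.ofDiscreteTopology

instance : IsManifold 𝓘(ℝ, PUnit.{1}) ∞ ℤ := IsManifold.of_discreteTopology _

section Levels

variable {E H N E' H' M' : Type} [NormedAddCommGroup E] [NormedSpace ℝ E] [TopologicalSpace H]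
  [NormedAddCommGroup E'] [NormedSpace ℝ E'] [TopologicalSpace H']
  {I : ModelWithCorners ℝ E H} {I' : ModelWithCorners ℝ E' H'}
  [TopologicalSpace N] [ChartedSpace H N] [TopologicalSpace M'] [ChartedSpace H' M']

/-- The inclusion of the component `M' × {m}` of `M' × ℤ`. -/
def levelEmbedding (M' : Type) [TopologicalSpace M'] (m : ℤ) :
    OpenPartialHomeomorph M' (M' × ℤ) where
  toFun x := (x, m)
  invFun p := p.1
  source := univ
  target := univ ×ˢ {m}
  map_source' _ _ := ⟨mem_univ _, rfl⟩
  map_target' _ _ := mem_univ _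
  left_inv' _ _ := rfl
  right_inv' p hp := Prod.ext rfl hp.2.symm
  open_source := isOpen_univ
  open_target := isOpen_univ.prod (isOpen_discrete _)
  continuousOn_toFun := by fun_prop
  continuousOn_invFun := by fun_prop

theorem levelEmbedding_isDiffeo (m : ℤ) :
    (levelEmbedding M' m).IsDiffeo I' (I'.prod 𝓘(ℝ, PUnit.{1})) :=
  ⟨(contMDiff_id.prodMk contMDiff_const).contMDiffOn, contMDiff_fst.contMDiffOn⟩

/-- Local charts at finitely many points can be put together to a map to several copies of the
model. -/
theorem exists_isDiffeo_of_finite [T2Space N] {S : Set N} (hS : S.Finite) (hne : S.Nonempty)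
    (hc : ∀ x : N, ∃ c : OpenPartialHomeomorph N M', x ∈ c.source ∧ c.IsDiffeo I I') :
    ∃ ψ : OpenPartialHomeomorph N (M' × ℤ), S ⊆ ψ.source ∧
      ψ.IsDiffeo I (I'.prod 𝓘(ℝ, PUnit.{1})) := by
  classical
  choose c hcx hcd using hc
  -- The points of `S` have disjoint neighbourhoods `O x`, and an injection `n` assigns different
  -- levels to them.
  obtain ⟨O, hO, hdisj⟩ := hS.t2_separation
  obtain ⟨n, hn⟩ := Set.countable_iff_exists_injOn.1 hS.countable
  -- The induction also records that sources stay in the sets `O x` and targets in the levels `n x`.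
  -- This makes the next chart disjoint from the previous ones both in source and in target, as the
  -- disjoint union of partial homeomorphisms requires.
  have key : ∀ T : Finset N, T.Nonempty → (T : Set N) ⊆ S →
      ∃ ψ : OpenPartialHomeomorph N (M' × ℤ), (T : Set N) ⊆ ψ.source ∧
      ψ.IsDiffeo I (I'.prod 𝓘(ℝ, PUnit.{1})) ∧ (ψ.source ⊆ ⋃ x ∈ T, O x) ∧
      ∀ q ∈ ψ.target, ∃ x ∈ T, q.2 = n x := by
    have hone : ∀ a, ∃ ψ : OpenPartialHomeomorph N (M' × ℤ), a ∈ ψ.source ∧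
        ψ.IsDiffeo I (I'.prod 𝓘(ℝ, PUnit.{1})) ∧ ψ.source ⊆ O a ∧
        ∀ q ∈ ψ.target, q.2 = n a := by
      intro a
      refine ⟨((c a).restrOpen (O a) (hO a).2).trans (levelEmbedding M' (n a)), ?_,
        ((hcd a).restr (hO a).2).trans (levelEmbedding_isDiffeo _), ?_, ?_⟩
      · exact ⟨⟨hcx a, (hO a).1⟩, mem_univ _⟩
      · intro y hy
        exact hy.1.2
      · intro q hq
        rw [OpenPartialHomeomorph.trans_target] at hq
        exact hq.1.2
    intro T hT
    induction hT using Finset.Nonempty.cons_induction with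
    | singleton a =>
      intro _
      obtain ⟨ψ, h1, h2, h3, h4⟩ := hone a
      exact ⟨ψ, by simpa using h1, h2, by simpa using h3, by simpa using h4⟩
    | cons a T ha hT ih =>
      intro hTS
      obtain ⟨ψ, h1, h2, h3, h4⟩ := hone a
      obtain ⟨ψ', h1', h2', h3', h4'⟩ := ih fun x hx => hTS (by simp [Finset.mem_coe.1 hx])
      have haS : a ∈ S := hTS (by simp)
      have hTS' : ∀ x ∈ T, x ∈ S ∧ a ≠ x := fun x hx =>
        ⟨hTS (by simp [hx]), fun h => ha (h ▸ hx)⟩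
      have hs : Disjoint ψ.source ψ'.source := by
        refine disjoint_left.2 fun y hy hy' => ?_
        obtain ⟨x, hx, hyx⟩ := mem_iUnion₂.1 (h3' hy')
        exact disjoint_left.1 (hdisj haS (hTS' x hx).1 (hTS' x hx).2) (h3 hy) hyx
      have ht : Disjoint ψ.target ψ'.target := by
        refine disjoint_left.2 fun q hq hq' => ?_
        obtain ⟨x, hx, hqx⟩ := h4' q hq'
        refine (hTS' x hx).2 (hn haS (hTS' x hx).1 ?_)
        exact_mod_cast (h4 q hq).symm.trans hqx
      refine ⟨ψ.disjointUnion ψ' hs ht, ?_, ?_, ?_, ?_⟩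
      · intro x hx
        rcases Finset.mem_cons.1 hx with rfl | hx
        · exact Or.inl h1
        · exact Or.inr (h1' hx)
      · refine .of_local fun x hx => ?_
        rcases hx with hx | hx
        · refine ⟨ψ, h2, hx, fun y hy => ?_⟩
          exact Set.piecewise_eq_of_mem _ _ _ hy.2
        · refine ⟨ψ', h2', hx, fun y hy => ?_⟩
          exact Set.piecewise_eq_of_notMem _ _ _ fun h => disjoint_left.1 hs h hy.2
      · rintro x (hx | hx)
        · exact mem_iUnion₂.2 ⟨a, by simp, h3 hx⟩
        · obtain ⟨y, hy, hxy⟩ := mem_iUnion₂.1 (h3' hx)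
          exact mem_iUnion₂.2 ⟨y, by simp [hy], hxy⟩
      · rintro q (hq | hq)
        · exact ⟨a, by simp, h4 q hq⟩
        · obtain ⟨x, hx, hqx⟩ := h4' q hq
          exact ⟨x, by simp [hx], hqx⟩
  obtain ⟨ψ, h1, h2, -, -⟩ := key hS.toFinset (by simpa using hne) (by simp)
  exact ⟨ψ, by simpa using h1, h2⟩

end Levels

/-! ### The action of dilations and translations on a half space -/

instance : LieAddGroup 𝓘(ℝ, PUnit.{1}) ∞ ℤ where
  contMDiff_add := contMDiff_of_discreteTopology
  contMDiff_neg := contMDiff_of_discreteTopology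

instance : LieGroup 𝓘(ℝ, ℝ) ∞ PosReal where
  contMDiff_mul p := contMDiffAt_posReal_iff.2
    ((contMDiffAt_posReal_iff.1 contMDiffAt_fst).mul (contMDiffAt_posReal_iff.1 contMDiffAt_snd))
  contMDiff_inv p := contMDiffAt_posReal_iff.2 ((contMDiff_posReal_coe p).inv₀ p.2.ne')

/-- The additive Lie group `ℝ^d × ℤ`. -/
abbrev Translations (d : ℕ) : Type := Euc d × ℤ

/-- The model of `ℝ^d × ℤ`. -/
abbrev translationsModel (d : ℕ) : ModelWithCorners ℝ (Euc d × PUnit.{1})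
    (ModelProd (Euc d) PUnit.{1}) := (𝓡 d).prod 𝓘(ℝ, PUnit.{1})

instance (d : ℕ) : ChartedSpace (ModelProd (Euc d) PUnit.{1}) (Multiplicative (Translations d)) :=
  inferInstanceAs (ChartedSpace (ModelProd (Euc d) PUnit.{1}) (Translations d))

theorem contMDiff_ofAdd (d : ℕ) : ContMDiff (translationsModel d) (translationsModel d) ∞
    (Multiplicative.ofAdd : Translations d → Multiplicative (Translations d)) :=
  (contMDiff_id : ContMDiff (translationsModel d) (translationsModel d) ∞
    (id : Translations d → Translations d))

theorem contMDiff_toAdd (d : ℕ) : ContMDiff (translationsModel d) (translationsModel d) ∞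
    (Multiplicative.toAdd : Multiplicative (Translations d) → Translations d) :=
  (contMDiff_id : ContMDiff (translationsModel d) (translationsModel d) ∞
    (id : Translations d → Translations d))

instance (d : ℕ) : IsManifold (translationsModel d) ∞ (Multiplicative (Translations d)) :=
  inferInstanceAs (IsManifold (translationsModel d) ∞ (Translations d))

instance (d : ℕ) : LieGroup (translationsModel d) ∞ (Multiplicative (Translations d)) where
  contMDiff_mul p := (contMDiff_ofAdd d _).comp p
    (((contMDiff_toAdd d _).comp p contMDiffAt_fst).add
      ((contMDiff_toAdd d _).comp p contMDiffAt_snd))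
  contMDiff_inv p := (contMDiff_ofAdd d _).comp p (contMDiff_toAdd d p).neg

/-- The Lie group of dilations and translations. -/
abbrev CylinderGroup (d : ℕ) : Type := PosReal × Multiplicative (Translations d)

/-- The manifold with boundary `[0, ∞) × (ℝ^d × ℤ)`. -/
abbrev Cylinder (d : ℕ) : Type := ℝ≥0 × Translations d

/-- The model of `[0, ∞) × (ℝ^d × ℤ)`. -/
abbrev cylinderModel (d : ℕ) : ModelWithCorners ℝ (ℝ × (Euc d × PUnit.{1}))
    (ModelProd ℝ≥0 (ModelProd (Euc d) PUnit.{1})) := halfLineModel.prod (translationsModel d)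

/-- The model of the group of dilations and translations. -/
abbrev cylinderGroupModel (d : ℕ) : ModelWithCorners ℝ (ℝ × (Euc d × PUnit.{1}))
    (ModelProd ℝ (ModelProd (Euc d) PUnit.{1})) := 𝓘(ℝ, ℝ).prod (translationsModel d)

/-- Translations are simply transitive on `ℝ^d × ℤ`, so they reproduce its pair groupoid; dilations
fix `t = 0` and are simply transitive on `t > 0`. The resulting action groupoid is the common local
model of the ends and of the core. -/
instance cylinderMulAction (d : ℕ) : MulAction (CylinderGroup d)ᵐᵒᵖ (Cylinder d) where
  smul g x := (x.1 * g.unop.1.toNNReal, x.2 + g.unop.2.toAdd)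
  one_smul x := Prod.ext (NNReal.eq (mul_one (x.1 : ℝ))) (add_zero x.2)
  mul_smul a b x := Prod.ext (NNReal.eq (by
    show (x.1 : ℝ) * (b.unop.1.1 * a.unop.1.1) = x.1 * b.unop.1.1 * a.unop.1.1
    ring)) (by
    show x.2 + (b.unop.2.toAdd + a.unop.2.toAdd) = x.2 + b.unop.2.toAdd + a.unop.2.toAdd
    rw [add_assoc])

theorem contMDiff_cylinder_smul (d : ℕ) :
    ContMDiff ((cylinderModel d).prod (cylinderGroupModel d)) (cylinderModel d) ∞
      (fun q : Cylinder d × CylinderGroup d => MulOpposite.op q.2 • q.1) := by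
  intro q
  have h1 := contMDiffAt_fst (I := cylinderModel d) (J := cylinderGroupModel d) (n := ∞) (p := q)
  have h2 := contMDiffAt_snd (I := cylinderModel d) (J := cylinderGroupModel d) (n := ∞) (p := q)
  refine ContMDiffAt.prodMk ?_ (h1.snd.add ((contMDiff_toAdd d _).comp q h2.snd))
  rw [contMDiffAt_nnreal_iff]
  exact (contMDiffAt_nnreal_iff.1 h1.fst).mul (contMDiffAt_posReal_iff.1 h2.fst)

/-- The group of dilations and translations, acting on `[0, ∞) × (ℝ^d × ℤ)`. -/
def cylinderAction (d : ℕ) : SmoothRightAction where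
  X := Cylinder d
  G := CylinderGroup d
  EX := _
  HX := _
  EG := _
  HG := _
  IX := cylinderModel d
  IG := cylinderGroupModel d
  corner := isCornerModel_halfLine.prod (.of_boundaryless _)
  smooth_act := contMDiff_cylinder_smul d

namespace ConicalDomain

variable {d : ℕ} (D : ConicalDomain d)

/-! ### Reductions to the ends and to the core -/

theorem unitEnd_target (i : Fin D.l) [Nonempty (D.Link i)] :
    (D.unitEnd i).target = range (Glue.piece D.collarInterior D.collarMap i) := by
  ext x
  constructor
  · intro hx
    have h1 := (D.unitEnd i).map_target hx
    rw [D.unitEnd_source] at h1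
    exact ⟨⟨_, h1⟩, (D.unitEnd_coe i ⟨_, h1⟩).symm.trans ((D.unitEnd i).right_inv hx)⟩
  · rintro ⟨z, rfl⟩
    rw [← D.unitEnd_coe]
    refine (D.unitEnd i).map_source ?_
    rw [D.unitEnd_source]
    exact z.2

theorem unitCore_target [Nonempty D.SmoothPart] :
    D.unitCore.target = range (Glue.core D.collarInterior D.collarMap) :=
  Glue.coreHomeo_target _ _

theorem arrowCore_target [Nonempty D.SmoothPart] :
    D.arrowCore.target = range (Glue.core _ (arrowMap D.collarGroupoid D.collarInterior
      D.collarMap)) :=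
  Glue.coreHomeo_target _ _

/-- An arrow whose range is in `Ω₀` is in `Ω₀ × Ω₀`. -/
theorem mem_arrowCore_target [Nonempty D.SmoothPart] {g : D.LayerArrows}
    (h : D.layerPotentialsGroupoid.r g ∈ D.unitCore.target) : g ∈ D.arrowCore.target := by
  rw [D.unitCore_target] at h
  obtain ⟨y, hy⟩ := h
  obtain ⟨b, rfl⟩ := GlueArrows.core_of_rng D.collarInterior_invariant hy.symm
  rw [D.arrowCore_target]
  exact ⟨b, rfl⟩

/-- An arrow whose domain and range are in `[0, 1) × ∂ω_i` is in `𝒥_i`. -/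
theorem mem_arrowEnd_target {i : Fin D.l} [Nonempty (D.Link i)] {g : D.LayerArrows}
    (hr : D.layerPotentialsGroupoid.r g ∈ (D.unitEnd i).target)
    (hd : D.layerPotentialsGroupoid.d g ∈ (D.unitEnd i).target) :
    ∃ k ∈ D.collarArrows i, g = D.arrowEnd i k := by
  rw [D.unitEnd_target] at hr hd
  obtain ⟨x, hx⟩ := hr
  obtain ⟨x', hx'⟩ := hd
  rcases Glue.cases_on _ _ g with ⟨b, rfl⟩ | ⟨j, k, hk, rfl⟩
  · obtain ⟨hxU, h1⟩ := Glue.piece_eq_core _ _ hx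
    obtain ⟨hxU', h1'⟩ := Glue.piece_eq_core _ _ hx'
    -- An arrow of the core between two points of the collar is the image of the unique arrow of
    -- `𝒥_i` with that range and domain, which `collarPair` provides.
    let k := (D.collarPair i).symm (⟨x, hxU⟩, ⟨x', hxU'⟩)
    refine ⟨k.1.1, k.1.2, ?_⟩
    rw [D.arrowEnd_coe]
    refine Eq.trans (congrArg _ ?_) (Glue.glue _ (arrowMap D.collarGroupoid D.collarInterior
      D.collarMap) i k).symm
    have h2 : D.collarPair i k = (⟨x, hxU⟩, ⟨x', hxU'⟩) := (D.collarPair i).apply_symm_apply _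
    refine Prod.ext (h1.symm.trans ?_) (h1'.symm.trans ?_)
    · exact congrArg (D.collarMap i) (congrArg Prod.fst h2).symm
    · exact congrArg (D.collarMap i) (congrArg Prod.snd h2).symm
  -- An arrow outside the core has its range over `t = 0`. Such a unit belongs to one end only,
  -- whence `j = i`.
  · have hk' : (D.collarGroupoid j).r k ∉ D.collarInterior j := fun h =>
      hk ⟨h, (D.collarInterior_invariant j k).1 h⟩
    obtain rfl : j = i := congrArg Sigma.fst (Glue.piece_eq_piece _ D.collarMap hk' hx.symm)
    exact ⟨k.1, k.2, (D.arrowEnd_coe j k).symm⟩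

/-! ### Local structure near the conical points -/

/-- The diffeomorphism `((t, a), (v, w)) ↦ ((t, v), (a, v - w))`. -/
def cylinderShift (d : ℕ) : (ℝ≥0 × PosReal) × (Translations d × Translations d) ≃
    Cylinder d × CylinderGroup d where
  toFun q := ((q.1.1, q.2.1), (q.1.2, Multiplicative.ofAdd (q.2.1 - q.2.2)))
  invFun q := ((q.1.1, q.2.1), (q.1.2, q.1.2 - q.2.2.toAdd))
  left_inv q := Prod.ext rfl (Prod.ext rfl (sub_sub_cancel _ _))
  right_inv q := Prod.ext rfl (Prod.ext rfl (sub_sub_cancel q.1.2 q.2.2.toAdd))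

theorem contMDiff_cylinderShift (d : ℕ) : ContMDiff
    ((halfLineModel.prod 𝓘(ℝ, ℝ)).prod ((translationsModel d).prod (translationsModel d)))
    ((cylinderModel d).prod (cylinderGroupModel d)) ∞ (cylinderShift d) := by
  intro q
  have h1 := contMDiffAt_fst (I := halfLineModel.prod 𝓘(ℝ, ℝ))
    (J := (translationsModel d).prod (translationsModel d)) (n := ∞) (p := q)
  have h2 := contMDiffAt_snd (I := halfLineModel.prod 𝓘(ℝ, ℝ))
    (J := (translationsModel d).prod (translationsModel d)) (n := ∞) (p := q)
  exact (h1.fst.prodMk h2.fst).prodMk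
    (h1.snd.prodMk ((contMDiff_ofAdd d _).comp q (h2.fst.sub h2.snd)))

theorem contMDiff_cylinderShift_symm (d : ℕ) : ContMDiff
    ((cylinderModel d).prod (cylinderGroupModel d))
    ((halfLineModel.prod 𝓘(ℝ, ℝ)).prod ((translationsModel d).prod (translationsModel d)))
    ∞ (cylinderShift d).symm := by
  intro q
  have h1 := contMDiffAt_fst (I := cylinderModel d) (J := cylinderGroupModel d) (n := ∞) (p := q)
  have h2 := contMDiffAt_snd (I := cylinderModel d) (J := cylinderGroupModel d) (n := ∞) (p := q)
  exact (h1.fst.prodMk h2.fst).prodMk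
    (h1.snd.prodMk (h1.snd.sub ((contMDiff_toAdd d _).comp q h2.snd)))

/-- `cylinderShift` as a homeomorphism. -/
def cylinderShiftHomeo (d : ℕ) : (ℝ≥0 × PosReal) × (Translations d × Translations d) ≃ₜ
    Cylinder d × CylinderGroup d :=
  { cylinderShift d with
    continuous_toFun := (contMDiff_cylinderShift d).continuous
    continuous_invFun := (contMDiff_cylinderShift_symm d).continuous }

theorem cylinderShiftHomeo_isDiffeo (d : ℕ) :
    (cylinderShiftHomeo d).toOpenPartialHomeomorph.IsDiffeo
      ((halfLineModel.prod 𝓘(ℝ, ℝ)).prod ((translationsModel d).prod (translationsModel d)))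
      ((cylinderModel d).prod (cylinderGroupModel d)) :=
  ⟨(contMDiff_cylinderShift d).contMDiffOn, (contMDiff_cylinderShift_symm d).contMDiffOn⟩

theorem cylinder_op_inv_smul (x : Cylinder d) (g : CylinderGroup d) :
    MulOpposite.op g⁻¹ • x = (x.1 * PosReal.toNNReal g.1⁻¹, x.2 - g.2.toAdd) :=
  Prod.ext rfl (sub_eq_add_neg x.2 g.2.toAdd).symm

section EndReduction

variable {i : Fin D.l} [Nonempty (D.Link i)]
  (ψ : OpenPartialHomeomorph (D.Link i) (Translations d))

/-- The chart of `M` on `[0, 1) × V` given by a chart of `∂ω_i` on `V`. -/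
def endUnits : OpenPartialHomeomorph D.DesingBoundary (Cylinder d) :=
  (D.unitEnd i).symm.trans ((OpenPartialHomeomorph.refl ℝ≥0).prod ψ)

/-- The chart of `𝒢` over `[0, 1) × V` given by a chart of `∂ω_i` on `V`. -/
def endArrows : OpenPartialHomeomorph D.LayerArrows (Cylinder d × CylinderGroup d) :=
  ((D.arrowEnd i).symm.trans ((OpenPartialHomeomorph.refl (ℝ≥0 × PosReal)).prod (ψ.prod ψ))).trans
    (cylinderShiftHomeo d).toOpenPartialHomeomorph

theorem mem_endUnits_source {x} (hx : x ∈ D.collar i) :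
    D.unitEnd i x ∈ (D.endUnits ψ).source ↔ x.2 ∈ ψ.source := by
  have hs : x ∈ (D.unitEnd i).source := by rw [D.unitEnd_source]; exact hx
  simp [endUnits, (D.unitEnd i).left_inv hs, (D.unitEnd i).map_source hs]

theorem endUnits_apply {x} (hx : x ∈ D.collar i) :
    D.endUnits ψ (D.unitEnd i x) = (x.1, ψ x.2) := by
  have hs : x ∈ (D.unitEnd i).source := by rw [D.unitEnd_source]; exact hx
  simp [endUnits, (D.unitEnd i).left_inv hs]

theorem mem_endArrows_source {g} (hg : g ∈ D.collarArrows i) :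
    D.arrowEnd i g ∈ (D.endArrows ψ).source ↔ g.2.1 ∈ ψ.source ∧ g.2.2 ∈ ψ.source := by
  have hs : g ∈ (D.arrowEnd i).source := by rw [D.arrowEnd_source]; exact hg
  simp [endArrows, (D.arrowEnd i).left_inv hs, (D.arrowEnd i).map_source hs]

theorem endArrows_apply {g} (hg : g ∈ D.collarArrows i) :
    D.endArrows ψ (D.arrowEnd i g) =
      ((g.1.1, ψ g.2.1), (g.1.2, Multiplicative.ofAdd (ψ g.2.1 - ψ g.2.2))) := by
  have hs : g ∈ (D.arrowEnd i).source := by rw [D.arrowEnd_source]; exact hg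
  exact congrArg (fun g : (ℝ≥0 × PosReal) × (D.Link i × D.Link i) =>
    cylinderShift d (g.1, (ψ g.2.1, ψ g.2.2))) ((D.arrowEnd i).left_inv hs)

theorem mem_endUnits_target {x} :
    x ∈ (D.endUnits ψ).target ↔ x.1 < 1 ∧ x.2 ∈ ψ.target := by
  have : (x.1, ψ.symm x.2) ∈ D.collar i ↔ x.1 < 1 := Iff.rfl
  simp [endUnits, D.unitEnd_source, and_comm, this]

/-- The inclusion from right to left holds because an arrow with both ends in the `i`-th collar
comes from `𝒥_i`, even when it is an arrow of `Ω₀ × Ω₀` (`mem_arrowEnd_target`). -/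
theorem endArrows_source : (D.endArrows ψ).source =
    D.layerPotentialsGroupoid.arrowsOver (D.endUnits ψ).source := by
  ext g
  constructor
  · intro hg
    have h1 := (D.arrowEnd i).right_inv hg.1.1
    have h2 := (D.arrowEnd i).map_target hg.1.1
    rw [D.arrowEnd_source] at h2
    rw [← h1, D.mem_endArrows_source ψ h2] at hg
    rw [← h1, GroupoidOn.arrowsOver, mem_ofPred_eq, D.d_arrowEnd h2, D.r_arrowEnd h2,
      D.mem_endUnits_source ψ (D.coneGroupoid_r_mem h2),
      D.mem_endUnits_source ψ (D.coneGroupoid_d_mem h2)]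
    exact hg
  · rintro ⟨hr, hd⟩
    obtain ⟨k, hk, rfl⟩ := D.mem_arrowEnd_target hr.1 hd.1
    rw [D.r_arrowEnd hk, D.mem_endUnits_source ψ (D.coneGroupoid_r_mem hk)] at hr
    rw [D.d_arrowEnd hk, D.mem_endUnits_source ψ (D.coneGroupoid_d_mem hk)] at hd
    exact (D.mem_endArrows_source ψ hk).2 ⟨hr, hd⟩

/-- Both sides say that `x` and `x · g⁻¹` have radius less than `1` and second component in
`ψ.target`: the radii come from the collar, the second components from `ψ`. -/
theorem endArrows_target : (D.endArrows ψ).target =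
    (GroupoidOn.action (Cylinder d) (CylinderGroup d)).arrowsOver (D.endUnits ψ).target := by
  ext ⟨x, g⟩
  have h1 : (x, g) ∈ (D.endArrows ψ).target ↔ (x.2 ∈ ψ.target ∧ x.2 - g.2.toAdd ∈ ψ.target) ∧
      ((x.1, g.1), (ψ.symm x.2, ψ.symm (x.2 - g.2.toAdd))) ∈ D.collarArrows i := by
    rw [endArrows, OpenPartialHomeomorph.trans_target, OpenPartialHomeomorph.trans_target,
      OpenPartialHomeomorph.symm_target, D.arrowEnd_source]
    constructor
    · rintro ⟨-, ⟨-, h⟩, h'⟩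
      exact ⟨h, h'⟩
    · rintro ⟨h, h'⟩
      exact ⟨mem_univ _, ⟨mem_univ _, h⟩, h'⟩
  have h2 : ((x.1, g.1), (ψ.symm x.2, ψ.symm (x.2 - g.2.toAdd))) ∈ D.collarArrows i ↔
      x.1 < 1 ∧ x.1 * PosReal.toNNReal g.1⁻¹ < 1 := Iff.rfl
  rw [h1, h2]
  show _ ↔ x ∈ (D.endUnits ψ).target ∧ MulOpposite.op g⁻¹ • x ∈ (D.endUnits ψ).target
  rw [D.mem_endUnits_target, D.mem_endUnits_target, cylinder_op_inv_smul]
  tauto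

variable {ψ}

theorem endUnits_isDiffeo (hψ : ψ.IsDiffeo (𝓡 d) (translationsModel d)) :
    (D.endUnits ψ).IsDiffeo (unitModel d) (cylinderModel d) :=
  (D.unitEnd_isDiffeo i).symm.trans
    ((OpenPartialHomeomorph.IsDiffeo.refl (I := halfLineModel)).prod hψ)

theorem endArrows_isDiffeo (hψ : ψ.IsDiffeo (𝓡 d) (translationsModel d)) :
    (D.endArrows ψ).IsDiffeo (arrowModel d) ((cylinderModel d).prod (cylinderGroupModel d)) :=
  ((D.arrowEnd_isDiffeo i).symm.trans
    ((OpenPartialHomeomorph.IsDiffeo.refl (I := halfLineModel.prod 𝓘(ℝ, ℝ))).prod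
      (hψ.prod hψ))).trans (cylinderShiftHomeo_isDiffeo d)

/-- Near the conical points, the layer potentials groupoid is the reduction of an action
groupoid. -/
def endReduction (hψ : ψ.IsDiffeo (𝓡 d) (translationsModel d)) :
    ReductionIso (arrowModel d) (unitModel d) ((cylinderModel d).prod (cylinderGroupModel d))
      (cylinderModel d) D.layerPotentialsGroupoid (D.endUnits ψ).source
      (GroupoidOn.action (Cylinder d) (CylinderGroup d)) (D.endUnits ψ).target where
  onArrows := D.endArrows ψ
  onUnits := D.endUnits ψ
  arrows_source := D.endArrows_source ψ
  arrows_target := D.endArrows_target ψ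
  units_source := rfl
  units_target := rfl
  arrows_smooth := (D.endArrows_isDiffeo hψ).smooth
  arrows_symm_smooth := (D.endArrows_isDiffeo hψ).symm_smooth
  units_smooth := (D.endUnits_isDiffeo hψ).smooth
  units_symm_smooth := (D.endUnits_isDiffeo hψ).symm_smooth
  map_r := by
    rintro g ⟨hr, hd⟩
    obtain ⟨k, hk, rfl⟩ := D.mem_arrowEnd_target hr.1 hd.1
    rw [D.r_arrowEnd hk, D.endUnits_apply ψ (D.coneGroupoid_r_mem hk), D.endArrows_apply ψ hk]
    rfl
  map_d := by
    rintro g ⟨hr, hd⟩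
    obtain ⟨k, hk, rfl⟩ := D.mem_arrowEnd_target hr.1 hd.1
    rw [D.d_arrowEnd hk, D.endUnits_apply ψ (D.coneGroupoid_d_mem hk), D.endArrows_apply ψ hk]
    refine (cylinder_op_inv_smul _ _).trans (Prod.ext rfl ?_)
    exact sub_sub_cancel (ψ k.2.1) (ψ k.2.2)
  map_mul := by
    rintro g ⟨hr, hd⟩ h ⟨hr', hd'⟩ hgh hgh'
    obtain ⟨k, hk, rfl⟩ := D.mem_arrowEnd_target hr.1 hd.1
    obtain ⟨k', hk', rfl⟩ := D.mem_arrowEnd_target hr'.1 hd'.1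
    have h1 := D.composable_arrowEnd hk hk' hgh
    rw [D.mul_arrowEnd hk hk' hgh, D.endArrows_apply ψ (D.mul_mem_collarArrows hk hk' h1)]
    simp only [GroupoidOn.action, D.endArrows_apply ψ hk, D.endArrows_apply ψ hk']
    -- The dilation parts agree by definition, both being multiplied as in an action groupoid. The
    -- translation parts are differences, which telescope because the middle points coincide.
    refine Prod.ext rfl (Prod.ext rfl ?_)
    have h2 : k.2.2 = k'.2.1 := congrArg Prod.snd h1
    show ψ k.2.1 - ψ k'.2.2 = (ψ k'.2.1 - ψ k'.2.2) + (ψ k.2.1 - ψ k.2.2)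
    rw [h2]
    abel

end EndReduction

/-! ### Local structure in the smooth part of the boundary -/

open Classical in
/-- A positive number of `[0, ∞)` as an element of the group `(0, ∞)`, and `1` for `0`. -/
def posPart (t : ℝ≥0) : PosReal := if h : 0 < (t : ℝ) then ⟨t, h⟩ else 1

theorem coe_posPart {t : ℝ≥0} (ht : t ≠ 0) : (posPart t : ℝ) = t := by
  rw [posPart, dif_pos (NNReal.coe_pos.2 (pos_iff_ne_zero.2 ht))]

theorem contMDiffAt_posPart {t : ℝ≥0} (ht : t ≠ 0) :
    ContMDiffAt halfLineModel 𝓘(ℝ, ℝ) ∞ posPart t := by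
  rw [contMDiffAt_posReal_iff]
  refine (contMDiff_nnreal_coe t).congr_of_eventuallyEq ?_
  filter_upwards [isOpen_ne.mem_nhds ht] with s hs using coe_posPart hs

/-- The identification `((t, v), (s, w)) ↦ ((t, v), (t / s, v - w))` of the pair groupoid of
`(0, ∞) × (ℝ^d × ℤ)` with a reduction of an action groupoid. -/
def pairToAction (d : ℕ) : PartialEquiv (Cylinder d × Cylinder d) (Cylinder d × CylinderGroup d) where
  toFun q := (q.1, (posPart q.1.1 / posPart q.2.1, Multiplicative.ofAdd (q.1.2 - q.2.2)))
  invFun q := (q.1, MulOpposite.op q.2⁻¹ • q.1)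
  source := {q | q.1.1 ≠ 0 ∧ q.2.1 ≠ 0}
  target := {q | q.1.1 ≠ 0}
  map_source' q hq := hq.1
  map_target' q hq := ⟨hq, by
    rw [cylinder_op_inv_smul]
    refine mul_ne_zero hq fun h => ?_
    exact (q.2.1⁻¹).2.ne' (congrArg NNReal.toReal h)⟩
  left_inv' q hq := by
    refine Prod.ext rfl ?_
    rw [cylinder_op_inv_smul]
    refine Prod.ext (NNReal.eq ?_) (sub_sub_cancel _ _)
    show (q.1.1 : ℝ) * ((posPart q.1.1 : ℝ) * (posPart q.2.1 : ℝ)⁻¹)⁻¹ = q.2.1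
    rw [coe_posPart hq.1, coe_posPart hq.2]
    have h1 := NNReal.coe_ne_zero.2 hq.1
    have h2 := NNReal.coe_ne_zero.2 hq.2
    field_simp
  right_inv' q hq := by
    refine Prod.ext rfl ?_
    rw [cylinder_op_inv_smul]
    refine Prod.ext (Subtype.ext ?_) (sub_sub_cancel q.1.2 q.2.2.toAdd)
    have h1 : q.1.1 * PosReal.toNNReal q.2.1⁻¹ ≠ 0 :=
      mul_ne_zero hq fun h => (q.2.1⁻¹).2.ne' (congrArg NNReal.toReal h)
    show (posPart q.1.1 : ℝ) * (posPart (q.1.1 * PosReal.toNNReal q.2.1⁻¹) : ℝ)⁻¹ = q.2.1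
    rw [coe_posPart hq, coe_posPart h1, ← div_eq_mul_inv]
    exact div_mul_inv_toNNReal _ _ (NNReal.coe_pos.2 (pos_iff_ne_zero.2 hq))

theorem contMDiffOn_pairToAction (d : ℕ) :
    ContMDiffOn ((cylinderModel d).prod (cylinderModel d))
      ((cylinderModel d).prod (cylinderGroupModel d)) ∞ (pairToAction d)
      (pairToAction d).source := by
  rintro q ⟨hq1, hq2⟩
  have h1 := contMDiffAt_fst (I := cylinderModel d) (J := cylinderModel d) (n := ∞) (p := q)
  have h2 := contMDiffAt_snd (I := cylinderModel d) (J := cylinderModel d) (n := ∞) (p := q)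
  exact (h1.prodMk ((((contMDiffAt_posPart hq1).comp q h1.fst).div
    ((contMDiffAt_posPart hq2).comp q h2.fst)).prodMk
    ((contMDiff_ofAdd d _).comp q (h1.snd.sub h2.snd)))).contMDiffWithinAt

theorem contMDiff_pairToAction_symm (d : ℕ) :
    ContMDiff ((cylinderModel d).prod (cylinderGroupModel d))
      ((cylinderModel d).prod (cylinderModel d)) ∞ (pairToAction d).symm := by
  intro q
  have h1 := contMDiffAt_fst (I := cylinderModel d) (J := cylinderGroupModel d) (n := ∞) (p := q)
  have h2 := contMDiffAt_snd (I := cylinderModel d) (J := cylinderGroupModel d) (n := ∞) (p := q)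
  exact h1.prodMk ((contMDiff_cylinder_smul d _).comp q (h1.prodMk h2.inv))

/-- `pairToAction` as a partial homeomorphism. -/
def pairToActionHomeo (d : ℕ) :
    OpenPartialHomeomorph (Cylinder d × Cylinder d) (Cylinder d × CylinderGroup d) where
  toPartialEquiv := pairToAction d
  open_source := (isOpen_ne.preimage (continuous_fst.comp continuous_fst)).inter
    (isOpen_ne.preimage (continuous_fst.comp continuous_snd))
  open_target := isOpen_ne.preimage (continuous_fst.comp continuous_fst)
  continuousOn_toFun := (contMDiffOn_pairToAction d).continuousOn
  continuousOn_invFun := (contMDiff_pairToAction_symm d).continuous.continuousOn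

theorem pairToActionHomeo_isDiffeo (d : ℕ) : (pairToActionHomeo d).IsDiffeo
    ((cylinderModel d).prod (cylinderModel d)) ((cylinderModel d).prod (cylinderGroupModel d)) :=
  ⟨contMDiffOn_pairToAction d, (contMDiff_pairToAction_symm d).contMDiffOn⟩

section CoreReduction

variable [Nonempty D.SmoothPart] {κ : OpenPartialHomeomorph D.SmoothPart (Cylinder d)}

theorem mem_unitCore_trans_source {y : D.SmoothPart} :
    D.unitCore y ∈ (D.unitCore.symm.trans κ).source ↔ y ∈ κ.source := by
  simp [D.unitCore.left_inv (mem_univ y), D.unitCore.map_source (mem_univ y)]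

/-- In the smooth part of the boundary, the layer potentials groupoid is locally the reduction of
an action groupoid. -/
def coreReduction (hκ : κ.IsDiffeo 𝓘(ℝ, ℝ × Euc d) (cylinderModel d))
    (hκt : ∀ x ∈ κ.target, x.1 ≠ 0) :
    ReductionIso (arrowModel d) (unitModel d) ((cylinderModel d).prod (cylinderGroupModel d))
      (cylinderModel d) D.layerPotentialsGroupoid (D.unitCore.symm.trans κ).source
      (GroupoidOn.action (Cylinder d) (CylinderGroup d)) κ.target :=
  have hcases : ∀ g ∈ D.layerPotentialsGroupoid.arrowsOver (D.unitCore.symm.trans κ).source,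
      ∃ b : D.SmoothPart × D.SmoothPart, g = D.arrowCore b ∧ b.1 ∈ κ.source ∧ b.2 ∈ κ.source := by
    rintro g ⟨hr, hd⟩
    have hg := D.mem_arrowCore_target hr.1
    rw [D.arrowCore_target] at hg
    obtain ⟨b, rfl⟩ := hg
    exact ⟨b, rfl, D.mem_unitCore_trans_source.1 hr, D.mem_unitCore_trans_source.1 hd⟩
  have hne : ∀ y ∈ κ.source, (κ y).1 ≠ 0 := fun y hy => hκt _ (κ.map_source hy)
  have hu : ∀ y, (D.unitCore.symm.trans κ) (D.unitCore y) = κ y := fun y =>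
    congrArg κ (D.unitCore.left_inv (mem_univ y))
  have ha : ∀ b, ((D.arrowCore.symm.trans (κ.prod κ)).trans (pairToActionHomeo d))
      (D.arrowCore b) = pairToAction d (κ b.1, κ b.2) := fun b =>
    congrArg (fun b : D.SmoothPart × D.SmoothPart => pairToAction d (κ b.1, κ b.2))
      (D.arrowCore.left_inv (mem_univ b))
  have hd : ∀ b : D.SmoothPart × D.SmoothPart, b.1 ∈ κ.source → b.2 ∈ κ.source →
      (GroupoidOn.action (Cylinder d) (CylinderGroup d)).d (pairToAction d (κ b.1, κ b.2)) =
        κ b.2 := fun b h1 h2 =>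
    congrArg Prod.snd ((pairToAction d).left_inv (x := (κ b.1, κ b.2)) ⟨hne _ h1, hne _ h2⟩)
  { onArrows := (D.arrowCore.symm.trans (κ.prod κ)).trans (pairToActionHomeo d)
    onUnits := D.unitCore.symm.trans κ
    arrows_source := by
      ext g
      constructor
      · rintro ⟨⟨h1, h2⟩, -⟩
        have h3 := D.arrowCore.right_inv h1
        rw [← h3]
        exact ⟨D.mem_unitCore_trans_source.2 h2.1, D.mem_unitCore_trans_source.2 h2.2⟩
      · intro hg
        obtain ⟨b, rfl, h1, h2⟩ := hcases g hg
        have h3 := D.arrowCore.left_inv (mem_univ b)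
        refine ⟨⟨D.arrowCore.map_source (mem_univ b), ?_⟩, ?_⟩
        · show D.arrowCore.symm (D.arrowCore b) ∈ (κ.prod κ).source
          rw [h3]
          exact ⟨h1, h2⟩
        · show (κ.prod κ) (D.arrowCore.symm (D.arrowCore b)) ∈ (pairToActionHomeo d).source
          rw [h3]
          exact ⟨hne _ h1, hne _ h2⟩
    arrows_target := by
      rw [OpenPartialHomeomorph.trans_target, OpenPartialHomeomorph.trans_target]
      ext ⟨x, g⟩
      constructor
      · rintro ⟨-, h, -⟩
        exact h
      · intro h
        -- The condition `t ≠ 0` in the target of `pairToAction` is automatic over `κ.target`.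
        exact ⟨hκt x h.1, h, mem_univ _⟩
    units_source := rfl
    units_target := by
      rw [OpenPartialHomeomorph.trans_target]
      exact inter_eq_left.2 fun _ _ => mem_univ _
    arrows_smooth := ((D.arrowCore_isDiffeo.symm.trans (hκ.prod hκ)).trans
      (pairToActionHomeo_isDiffeo d)).smooth
    arrows_symm_smooth := ((D.arrowCore_isDiffeo.symm.trans (hκ.prod hκ)).trans
      (pairToActionHomeo_isDiffeo d)).symm_smooth
    units_smooth := (D.unitCore_isDiffeo.symm.trans hκ).smooth
    units_symm_smooth := (D.unitCore_isDiffeo.symm.trans hκ).symm_smooth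
    map_r := by
      intro g hg
      obtain ⟨b, rfl, h1, h2⟩ := hcases g hg
      rw [ha]
      exact (hu b.1).symm
    map_d := by
      intro g hg
      obtain ⟨b, rfl, h1, h2⟩ := hcases g hg
      rw [ha, hd b h1 h2]
      exact (hu b.2).symm
    map_mul := by
      intro g hg h hh hgh hgh'
      obtain ⟨b, rfl, h1, h2⟩ := hcases g hg
      obtain ⟨c, rfl, h3, h4⟩ := hcases h hh
      have h5 : b.2 = c.1 := D.unitCore.injOn (mem_univ _) (mem_univ _) hgh
      rw [D.mul_arrowCore, ha]
      simp only [GroupoidOn.action, ha]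
      refine Prod.ext rfl (Prod.ext ?_ ?_)
      -- The dilation parts are quotients of radii and telescope, as the differences of the
      -- translation parts do.
      · show posPart (κ b.1).1 / posPart (κ c.2).1 =
          posPart (κ c.1).1 / posPart (κ c.2).1 * (posPart (κ b.1).1 / posPart (κ b.2).1)
        rw [h5, mul_comm, div_mul_div_cancel]
      · show (κ b.1).2 - (κ c.2).2 = ((κ c.1).2 - (κ c.2).2) + ((κ b.1).2 - (κ b.2).2)
        rw [h5]
        abel }

/-- The charts of `Ω₀` take values in `ℝ × ℝ^d`. Copies indexed by `ℤ` accommodate finitely many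
points, and `exp` on the first coordinate moves everything to `t > 0`, where `pairToAction`
identifies the pair groupoid with the action groupoid. -/
theorem exists_core_chart {S : Set D.SmoothPart} (hS : S.Finite) (hne : S.Nonempty) :
    ∃ κ : OpenPartialHomeomorph D.SmoothPart (Cylinder d), S ⊆ κ.source ∧
      κ.IsDiffeo 𝓘(ℝ, ℝ × Euc d) (cylinderModel d) ∧ ∀ x ∈ κ.target, x.1 ≠ 0 := by
  have hexp : (expEmbedding.prod (OpenPartialHomeomorph.refl (Euc d))).IsDiffeo
      𝓘(ℝ, ℝ × Euc d) (halfLineModel.prod (𝓡 d)) := by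
    have h := expEmbedding_isDiffeo.prod (.refl (M := Euc d) (I := 𝓡 d))
    rw [← modelWithCornersSelf_prod] at h
    have e1 : chartedSpaceSelf (ModelProd ℝ (Euc d)) = prodChartedSpace _ _ _ _ :=
      chartedSpaceSelf_prod.symm
    rw [← e1] at h
    exact h
  have hassoc : (Homeomorph.prodAssoc ℝ≥0 (Euc d) ℤ).toOpenPartialHomeomorph.IsDiffeo
      ((halfLineModel.prod (𝓡 d)).prod 𝓘(ℝ, PUnit.{1})) (cylinderModel d) :=
    ⟨(contMDiff_fst.fst.prodMk (contMDiff_fst.snd.prodMk contMDiff_snd)).contMDiffOn,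
      ((contMDiff_fst.prodMk contMDiff_snd.fst).prodMk contMDiff_snd.snd).contMDiffOn⟩
  obtain ⟨ψ, hψS, hψ⟩ := exists_isDiffeo_of_finite (I := 𝓘(ℝ, ℝ × Euc d))
    (I' := 𝓘(ℝ, ℝ × Euc d)) (M' := ℝ × Euc d) hS hne
    fun x => ⟨chartAt (ℝ × Euc d) x, mem_chart_source _ x, .chartAt x⟩
  refine ⟨(ψ.trans ((expEmbedding.prod (.refl (Euc d))).prod (.refl ℤ))).trans
    (Homeomorph.prodAssoc ℝ≥0 (Euc d) ℤ).toOpenPartialHomeomorph, ?_,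
    (hψ.trans (hexp.prod .refl)).trans hassoc, ?_⟩
  · intro x hx
    exact ⟨⟨hψS hx, ⟨mem_univ _, mem_univ _⟩, mem_univ _⟩, mem_univ _⟩
  · rintro x hx
    rw [OpenPartialHomeomorph.trans_target, OpenPartialHomeomorph.trans_target] at hx
    exact hx.2.1.1.1

end CoreReduction

/-! ### The smooth part of the boundary is dense -/

/-- Only the points `(0, y)` of an end are outside the core, and `(t, y)` tends to `(0, y)` as `t`
tends to `0` through nonzero values. -/
theorem dense_unitCore_target [Nonempty D.SmoothPart] : Dense D.unitCore.target := by
  intro x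
  rcases D.unit_cases x with ⟨_, y, rfl⟩ | ⟨i, _, ⟨t, y⟩, hz, rfl⟩
  · exact subset_closure (D.unitCore.map_source (mem_univ y))
  · by_cases ht : t = 0
    · subst ht
      have hc : Filter.Tendsto (fun t : ℝ≥0 => D.unitEnd i (t, y)) (𝓝[≠] 0)
          (𝓝 (D.unitEnd i (0, y))) := by
        have h1 : ContinuousAt (D.unitEnd i) (0, y) :=
          (D.unitEnd i).continuousAt (by rw [D.unitEnd_source]; exact hz)
        have h2 : ContinuousAt (fun t : ℝ≥0 => (t, y)) 0 := by fun_prop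
        exact (ContinuousAt.comp (f := fun t : ℝ≥0 => (t, y)) h1 h2).tendsto.mono_left
          nhdsWithin_le_nhds
      refine mem_closure_of_tendsto hc ?_
      filter_upwards [self_mem_nhdsWithin,
        nhdsWithin_le_nhds (Iio_mem_nhds (zero_lt_one : (0 : ℝ≥0) < 1))] with t ht ht1
      rw [D.unitCore_target]
      exact ⟨_, ((D.unitEnd_coe i ⟨(t, y), ht1⟩).trans
        (Glue.glue D.collarInterior D.collarMap i ⟨⟨(t, y), ht1⟩, ht⟩)).symm⟩
    · refine subset_closure ?_
      rw [D.unitCore_target]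
      exact ⟨_, ((D.unitEnd_coe i ⟨(t, y), hz⟩).trans
        (Glue.glue D.collarInterior D.collarMap i ⟨⟨(t, y), hz⟩, ht⟩)).symm⟩

/-- Over the smooth part of the boundary, the layer potentials groupoid is the pair groupoid. -/
def pairReduction [Nonempty D.SmoothPart] :
    ReductionIso (arrowModel d) (unitModel d) ((unitModel d).prod (unitModel d)) (unitModel d)
      D.layerPotentialsGroupoid D.unitCore.target (GroupoidOn.pair D.DesingBoundary)
      D.unitCore.target :=
  have hcases : ∀ g ∈ D.layerPotentialsGroupoid.arrowsOver D.unitCore.target,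
      ∃ b : D.SmoothPart × D.SmoothPart, g = D.arrowCore b := by
    rintro g ⟨hr, -⟩
    have hg := D.mem_arrowCore_target hr
    rw [D.arrowCore_target] at hg
    obtain ⟨b, rfl⟩ := hg
    exact ⟨b, rfl⟩
  have hu : ∀ x ∈ D.unitCore.target, (D.unitCore.symm.trans D.unitCore) x = x := fun x hx =>
    D.unitCore.right_inv hx
  have ha : ∀ b, (D.arrowCore.symm.trans (D.unitCore.prod D.unitCore)) (D.arrowCore b) =
      (D.unitCore b.1, D.unitCore b.2) := fun b =>
    congrArg (D.unitCore.prod D.unitCore) (D.arrowCore.left_inv (mem_univ b))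
  { onArrows := D.arrowCore.symm.trans (D.unitCore.prod D.unitCore)
    -- This is the identity of `unitCore.target`; the map on arrows is `g ↦ (r g, d g)`.
    onUnits := D.unitCore.symm.trans D.unitCore
    arrows_source := by
      ext g
      constructor
      · rintro ⟨h1, -⟩
        rw [← D.arrowCore.right_inv h1]
        exact ⟨D.unitCore.map_source (mem_univ _), D.unitCore.map_source (mem_univ _)⟩
      · intro hg
        exact ⟨D.mem_arrowCore_target hg.1, mem_univ _, mem_univ _⟩
    arrows_target := by
      rw [OpenPartialHomeomorph.trans_target]
      exact inter_eq_left.2 fun _ _ => mem_univ _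
    units_source := inter_eq_left.2 fun _ _ => mem_univ _
    units_target := by
      rw [OpenPartialHomeomorph.trans_target]
      exact inter_eq_left.2 fun _ _ => mem_univ _
    arrows_smooth :=
      (D.arrowCore_isDiffeo.symm.trans (D.unitCore_isDiffeo.prod D.unitCore_isDiffeo)).smooth
    arrows_symm_smooth :=
      (D.arrowCore_isDiffeo.symm.trans (D.unitCore_isDiffeo.prod D.unitCore_isDiffeo)).symm_smooth
    units_smooth := (D.unitCore_isDiffeo.symm.trans D.unitCore_isDiffeo).smooth
    units_symm_smooth := (D.unitCore_isDiffeo.symm.trans D.unitCore_isDiffeo).symm_smooth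
    map_r := by
      intro g hg
      obtain ⟨b, rfl⟩ := hcases g hg
      rw [ha, hu _ hg.1]
      rfl
    map_d := by
      intro g hg
      obtain ⟨b, rfl⟩ := hcases g hg
      rw [ha, hu _ hg.2]
      rfl
    map_mul := by
      intro g hg h hh hgh hgh'
      obtain ⟨b, rfl⟩ := hcases g hg
      obtain ⟨c, rfl⟩ := hcases h hh
      rw [D.mul_arrowCore, ha]
      simp only [GroupoidOn.pair, ha] }

-- Nonemptiness of the links and of the smooth part

/-- As `p i` is in the closure of `Ω`, the set `Ω` meets the domain of `φ i`, so the cone over `base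
i` has a point. -/
theorem base_nonempty (i : Fin D.l) : (D.base i).Nonempty := by
  obtain ⟨x, hx⟩ := mem_closure_iff.1 (frontier_subset_closure (D.p_mem i)) _
    (D.φ i).open_source (D.p_mem_source i)
  obtain ⟨r, -, y, hy, -⟩ := (D.φ_cone i).subset (mem_image_of_mem _ hx.symm)
  exact ⟨y, hy⟩

/-- The sphere is connected because the dimension is at least `2`, and a nonempty proper subset of a
connected space has a nonempty frontier. -/
theorem nonempty_link (i : Fin D.l) : Nonempty (D.Link i) := by
  have : PreconnectedSpace (UnitSphere (d + 2)) := by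
    refine isPreconnected_iff_preconnectedSpace.1 (isPreconnected_sphere ?_ 0 1)
    rw [rank_eq_card_basis (EuclideanSpace.basisFun (Fin (d + 2)) ℝ).toBasis]
    simp only [Fintype.card_fin]
    exact_mod_cast (by omega : 1 < d + 2)
  exact (nonempty_frontier_iff.2 ⟨D.base_nonempty i, D.base_ne_univ i⟩).to_subtype

/-- A bounded nonempty set is not the whole space, so `∂Ω` has a point. If that point is conical,
the lateral boundary of the cone, at radius `1/2` over a point of the link, supplies a smooth one.
-/
theorem nonempty_smoothPart : Nonempty D.SmoothPart := by
  have h1 : (frontier D.Ω).Nonempty := by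
    refine nonempty_frontier_iff.2 ⟨D.isConnected.nonempty, fun h => ?_⟩
    exact NormedSpace.unbounded_univ ℝ (Euc (d + 2)) (h ▸ D.isBounded)
  obtain ⟨x, hx⟩ := h1
  by_cases hp : x ∈ range D.p
  · obtain ⟨i, -⟩ := hp
    obtain ⟨y⟩ := D.nonempty_link i
    have h2 : (2⁻¹ : ℝ≥0) < 1 := by norm_num
    have h3 : (2⁻¹ : ℝ≥0) ≠ 0 := by norm_num
    exact ⟨D.collarMap i ⟨⟨(2⁻¹, y), h2⟩, h3⟩⟩
  · exact ⟨⟨x, hx, hp⟩⟩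

theorem pair_on_dense : ∃ U : Set D.DesingBoundary, IsOpen U ∧ Dense U ∧
    (∀ g, D.layerPotentialsGroupoid.d g ∈ U → D.layerPotentialsGroupoid.r g ∈ U) ∧
    Nonempty (ReductionIso (arrowModel d) (unitModel d) ((unitModel d).prod (unitModel d))
      (unitModel d) D.layerPotentialsGroupoid U (GroupoidOn.pair D.DesingBoundary) U) := by
  have := D.nonempty_smoothPart
  refine ⟨D.unitCore.target, D.unitCore.open_target, D.dense_unitCore_target, fun g hg => ?_,
    ⟨D.pairReduction⟩⟩
  -- `mem_arrowCore_target` starts from the range of an arrow, so it is applied to the inverse of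
  -- `g`.
  rw [← D.layerPotentialsGroupoid.r_inv] at hg
  have h1 := D.mem_arrowCore_target hg
  rw [← D.layerPotentialsGroupoid.d_inv, ← D.arrowCore.right_inv h1]
  exact D.unitCore.map_source (mem_univ _)

/-! ### The layer potentials groupoid is a boundary action groupoid -/

/-- Any two composable arrows lie over an open set on which the layer potentials groupoid is the
reduction of an action groupoid. -/
theorem exists_action_of_composable (g h : D.LayerArrows)
    (hgh : D.layerPotentialsGroupoid.d g = D.layerPotentialsGroupoid.r h) :
    ∃ W : Set D.DesingBoundary, IsOpen W ∧ g ∈ D.layerPotentialsGroupoid.arrowsOver W ∧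
      h ∈ D.layerPotentialsGroupoid.arrowsOver W ∧
      ∃ W' : Set (Cylinder d), IsOpen W' ∧ Nonempty (ReductionIso (arrowModel d) (unitModel d)
        ((cylinderModel d).prod (cylinderGroupModel d)) (cylinderModel d)
        D.layerPotentialsGroupoid W (GroupoidOn.action (Cylinder d) (CylinderGroup d)) W') := by
  rcases D.composable_cases g h hgh with ⟨_, b, c, hbc, rfl, rfl⟩ |
    ⟨i, _, g', hg', h', hh', hgh', rfl, rfl⟩
  -- Three points suffice, since the composability condition makes `c.1 = b.2`.
  · obtain ⟨κ, hS, hκ, hκt⟩ := D.exists_core_chart (S := {b.1, b.2, c.2}) (by simp) (by simp)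
    have hb1 : b.1 ∈ κ.source := hS (by simp)
    have hb2 : b.2 ∈ κ.source := hS (by simp)
    have hc2 : c.2 ∈ κ.source := hS (by simp)
    have hc1 : c.1 ∈ κ.source := hbc ▸ hb2
    exact ⟨_, (D.unitCore.symm.trans κ).open_source,
      ⟨D.mem_unitCore_trans_source.2 hb1, D.mem_unitCore_trans_source.2 hb2⟩,
      ⟨D.mem_unitCore_trans_source.2 hc1, D.mem_unitCore_trans_source.2 hc2⟩,
      κ.target, κ.open_target, ⟨D.coreReduction hκ hκt⟩⟩
  -- Only the components in `∂ω_i` need a chart; the radial coordinate in `[0, 1)` is global.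
  · obtain ⟨ψ, hS, hψ⟩ := exists_isDiffeo_of_finite (I := 𝓡 d) (I' := 𝓡 d) (M' := Euc d)
      (S := {g'.2.1, g'.2.2, h'.2.2}) (by simp) (by simp)
      fun x => ⟨chartAt (Euc d) x, mem_chart_source _ x, .chartAt x⟩
    have h1 : g'.2.1 ∈ ψ.source := hS (by simp)
    have h2 : g'.2.2 ∈ ψ.source := hS (by simp)
    have h3 : h'.2.2 ∈ ψ.source := hS (by simp)
    have h4 : h'.2.1 ∈ ψ.source := by
      have : g'.2.2 = h'.2.1 := congrArg Prod.snd hgh'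
      exact this ▸ h2
    refine ⟨_, (D.endUnits ψ).open_source, ?_, ?_, (D.endUnits ψ).target,
      (D.endUnits ψ).open_target, ⟨D.endReduction hψ⟩⟩
    · rw [← D.endArrows_source, D.mem_endArrows_source ψ hg']
      exact ⟨h1, h2⟩
    · rw [← D.endArrows_source, D.mem_endArrows_source ψ hh']
      exact ⟨h4, h3⟩

end ConicalDomain

theorem mainTheorem5 (d : ℕ) (D : ConicalDomain d) (hD : D.NoCracks) :
    IsBoundaryActionGroupoid (ConicalDomain.arrowModel d) (ConicalDomain.unitModel d)
      D.layerPotentialsGroupoid where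
  lie := D.isLieGroupoid_layer
  pair_on_dense := D.pair_on_dense
  local_action := by
    -- The cover is indexed by all the open sets over which the groupoid is a reduction of the
    -- cylinder action groupoid, so covering and weak gluing both become existence statements.
    refine ⟨{W : Set D.DesingBoundary // IsOpen W ∧ ∃ W' : Set (Cylinder d), IsOpen W' ∧
      Nonempty (ReductionIso (ConicalDomain.arrowModel d) (ConicalDomain.unitModel d)
        ((cylinderModel d).prod (cylinderGroupModel d)) (cylinderModel d)
        D.layerPotentialsGroupoid W (GroupoidOn.action (Cylinder d) (CylinderGroup d)) W')},
      Subtype.val, fun W => W.2.1, ?_, fun W => ?_, fun g h hgh => ?_⟩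
    · refine eq_univ_of_forall fun x => mem_iUnion.2 ?_
      -- The unit at `x` is composable with itself, so the statement on composable arrows also gives
      -- a member of the cover containing `x`.
      obtain ⟨W, hW, hx, -, h⟩ := D.exists_action_of_composable (D.layerPotentialsGroupoid.u x)
        (D.layerPotentialsGroupoid.u x) (by rw [GroupoidOn.d_u, GroupoidOn.r_u])
      refine ⟨⟨W, hW, h⟩, ?_⟩
      have h1 := hx.1
      rwa [GroupoidOn.r_u] at h1
    · obtain ⟨W', hW', h⟩ := W.2.2
      exact ⟨cylinderAction d, W', hW', h⟩
    · obtain ⟨W, hW, hg, hh, h⟩ := D.exists_action_of_composable g h hgh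
      exact ⟨⟨W, hW, h⟩, hg, hh⟩

end
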